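/- Setting. Let $(M,\omega)$ be a compact symplectic manifold and $\iota:L\hookrightarrow M$ a compact Lagrangian submanifold. Fix a symplectomorphism $\psi:(V,\omega_{can})\to(U,\omega)$ from an open neighbourhood $V$ of the zero section of $T^*L$ (with $\omega_{can}=-d\theta_{taut}$) onto an open neighbourhood $U$ of $L$ in $M$ with $\psi|_L=\iota$; an open, fibrewise convex neighbourhood $V'$ of the zero section such that $\overline{V'}\subset V$ and, with $U'=\psi(V')$, $\overline{U'}\subset U$; and $f\in C^\infty(M)$ with $f=1$ on $\overline{U'}$ and $\operatorname{supp} f\subset U$. Let $\Gamma_{V'}(T^*L)$ be the set of $1$-forms $\sigma\in\Omega^1(L)$ with $\sigma(L)\subset V'$, and $\mathcal U'$ the set of submanifolds $\psi(\sigma(L))$ with $\sigma\in\Gamma_{V'}(T^*L)$. Let $\mathcal D_{\mathcal U'}(\omega,L)$ be the set of pairs $(\omega',L')$ with $\omega'$ a symplectic form on $M$ and $L'\in\mathcal U'$ Lagrangian for $\omega'$, where $(\omega',L')\sim(\omega'',L'')$ if there is an isotopy $(\rho_t)_{t\in[0,1]}$ of $M$ with $\rho_1(L')=L''$, $\rho_1^*\omega''=\omega'$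 and $\rho_t(L')\in\mathcal U'$ for all $t$. Let $\mathrm{Def}_L(\omega)$ be the set of symplectic forms on $M$ for which $L$ is Lagrangian, where $\omega'\sim\omega''$ if there is an isotopy with $\rho_1^*\omega''=\omega'$ and $\rho_t(L)=L$ for all $t$. For $L'=\psi(\sigma(L))\in\mathcal U'$ let $\phi_{L'}$ be the time-one flow of the vector field $f\,\psi_*X_\sigma$ on $M$, where $X_\sigma$ is the vertical, fibrewise constant vector field on $T^*L$ given by $\sigma$, and put $q(\omega',L')=\phi_{L'}^*\omega'$. Formal tangent spaces. A path $(\omega_t,L_t)_{0\le t\le\varepsilon}$ ($\varepsilon>0$) in $\mathcal D_{\mathcal U'}(\omega,L)$ with $L_t=\psi(\alpha_t(L))$ is smooth if $\omega_t$ and $\alpha_t$ are smooth in $t$; if it starts at $(\omega,L)$, its first order deformation is $(\dot\omega_0,\dot\alpha_0)\in\Omega^2(M)\times\Omega^1(L)$. It is generated by an isotopy $(\rho_t)$ if $\rho_t(L)=L_t$ and $\rho_t^*\omega_t=\omega$ for all $t\in[0,\varepsilon]$. The formal tangent space $T_{[(\omega,L)]}(\mathcal D_{\mathcal U'}(\omega,L)/\!\sim)$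 is the quotient of the space of first order deformations of smooth paths starting at $(\omega,L)$ by the subspace of those of paths generated by isotopies. Similarly, $T_{[\omega]}(\mathrm{Def}_L(\omega)/\!\sim)$ is the quotient of the space of derivatives $\dot\omega_0$ of smooth paths in $\mathrm{Def}_L(\omega)$ starting at $\omega$ by the subspace of those of paths for which there is an isotopy with $\rho_t(L)=L$ and $\rho_t^*\omega_t=\omega$ for all $t$. Cohomology. $H^2(\mathcal C(\iota^*))$ is the second cohomology of the mapping cone $\Omega^\bullet(M)\oplus\Omega^{\bullet-1}(L)$ with differential $(a,b)\mapsto(da,\iota^*a-db)$, and $H^2(M,L)$ is the second cohomology of the complex $\{a\in\Omega^\bullet(M):\iota^*a=0\}$ with differential $d$. Proposition. (1) The first order deformations of smooth paths in $\mathcal D_{\mathcal U'}(\omega,L)$ starting at $(\omega,L)$ are exactly the $2$-cocycles of $\mathcal C(\iota^*)$, and those of paths generated by isotopies are exactly the $2$-coboundaries. Likewise, the first order deformations of smooth paths in $\mathrm{Def}_L(\omega)$ starting at $\omega$ are exactly the closed $2$-forms with vanishing pullback to $L$, and those of paths generated by isotopies preserving $L$ are exactly the forms $d\gamma$ with $\gamma\in\Omega^1(M)$,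 $\iota^*\gamma=0$. This gives isomorphisms $$T_{[(\omega,L)]}(\mathcal D_{\mathcal U'}(\omega,L)/\!\sim)\cong H^2(\mathcal C(\iota^*)),\qquad T_{[\omega]}(\mathrm{Def}_L(\omega)/\!\sim)\cong H^2(M,L).$$ (2) Every $\beta\in\Omega^1(L)$ has an extension $\widetilde\beta\in\Omega^1(M)$, $\iota^*\widetilde\beta=\beta$, and $J:H^2(\mathcal C(\iota^*))\to H^2(M,L)$, $[(\eta,\beta)]\mapsto[\eta-d\widetilde\beta]$ (for any extension $\widetilde\beta$), is a well-defined linear isomorphism. (3) The map $q$ induces a map $\overline q:\mathcal D_{\mathcal U'}(\omega,L)/\!\sim\;\to\mathrm{Def}_L(\omega)/\!\sim$. It has a unique formal linearization at $[(\omega,L)]$, i.e. a unique linear map $d\overline q:T_{[(\omega,L)]}(\mathcal D_{\mathcal U'}(\omega,L)/\!\sim)\to T_{[\omega]}(\mathrm{Def}_L(\omega)/\!\sim)$ such that for every smooth path $(\omega_t,L_t)$ as above, $q(\omega_t,L_t)$ is a smooth path in $\mathrm{Def}_L(\omega)$ starting at $\omega$ and $d\overline q$ sends the class of $(\dot\omega_0,\dot\alpha_0)$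 to the class of $\left.\frac{d}{dt}\right|_{t=0}q(\omega_t,L_t)$. (4) Under the identifications in (1), $d\overline q$ equals $J$. In particular, $d\overline q$ is a linear isomorphism. -/

import Mathlib

open Set Filter Topology Manifold
open scoped ContDiff

set_option linter.unusedSectionVars false

namespace SymplecticDeformation

section

theorem two_le_infty : (2 : WithTop ℕ∞) ≤ ∞ := by
  exact WithTop.coe_le_coe.2 le_top

variable {F G : Type*} [NormedAddCommGroup F] [NormedSpace ℝ F] [NormedAddCommGroup G] [NormedSpace ℝ G]

theorem contDiff_compCLM {k : ℕ} {n : WithTop ℕ∞} : ContDiff ℝ n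
    (fun p : (F [⋀^Fin k]→L[ℝ] ℝ) × (G →L[ℝ] F) => p.1.compContinuousLinearMap p.2) := by
  let R : ContinuousMultilinearMap ℝ (fun _ : Fin k => G) ℝ →ₗ[ℝ] (G [⋀^Fin k]→L[ℝ] ℝ) :=
    { toFun := fun f => (k.factorial : ℝ)⁻¹ • ContinuousMultilinearMap.alternatization f
      map_add' := fun f g => by simp
      map_smul' := fun c f => by
        ext v
        simp [ContinuousMultilinearMap.alternatization_apply_apply, Finset.mul_sum,
          Units.smul_def, mul_left_comm] }
  have hR : ∀ f, ‖R f‖ ≤ 1 * ‖f‖ := by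
    intro f
    refine ContinuousAlternatingMap.opNorm_le_bound _ (by positivity) fun v => ?_
    have h1 : ‖ContinuousMultilinearMap.alternatization f v‖ ≤ k.factorial * (‖f‖ * ∏ i, ‖v i‖) := by
      rw [ContinuousMultilinearMap.alternatization_apply_apply]
      refine (norm_sum_le _ _).trans ?_
      refine (Finset.sum_le_card_nsmul _ _ (‖f‖ * ∏ i, ‖v i‖) fun σ _ => ?_).trans ?_
      · have : ‖(Equiv.Perm.sign σ) • f (v ∘ σ)‖ = ‖f (v ∘ σ)‖ := by
          rcases Int.units_eq_one_or (Equiv.Perm.sign σ) with h | h <;> simp [h]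
        rw [this]
        refine (f.le_opNorm _).trans_eq ?_
        congr 1
        exact Equiv.prod_comp σ (fun i => ‖v i‖)
      · simp [Fintype.card_perm]
    have : (R f) v = (k.factorial : ℝ)⁻¹ * ContinuousMultilinearMap.alternatization f v := rfl
    rw [this, norm_mul, norm_inv, one_mul]
    have hk : (0 : ℝ) < k.factorial := by positivity
    rw [Real.norm_of_nonneg hk.le, inv_mul_le_iff₀ hk]
    exact h1
  let R' := R.mkContinuous 1 hR
  have key : (fun p : (F [⋀^Fin k]→L[ℝ] ℝ) × (G →L[ℝ] F) => p.1.compContinuousLinearMap p.2) =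
      fun p => R' ((ContinuousAlternatingMap.toContinuousMultilinearMapCLM ℝ p.1 :
        ContinuousMultilinearMap ℝ (fun _ : Fin k => F) ℝ).compContinuousLinearMap (fun _ => p.2)) := by
    funext p
    ext v
    have : ∀ σ : Equiv.Perm (Fin k), (p.1) (fun i => p.2 (v (σ i))) =
      Equiv.Perm.sign σ • p.1 (fun i => p.2 (v i)) := fun σ => 
        p.1.toAlternatingMap.map_perm (fun i => p.2 (v i)) σ
    simp [R', R, ContinuousMultilinearMap.alternatization_apply_apply, Function.comp_def, this, smul_smul,
       Fintype.card_perm]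
    field_simp
  rw [key]
  refine R'.contDiff.comp ?_
  have h : ContDiff ℝ n (fun p : (∀ _ : Fin k, G →L[ℝ] F) ×
      (ContinuousMultilinearMap ℝ (fun _ : Fin k => F) ℝ) => p.2.compContinuousLinearMap p.1) :=
    contDiff_iff_contDiffAt.2 fun q =>
      (ContinuousMultilinearMap.analyticAt_uncurry_compContinuousLinearMap (q := q)).contDiffAt
  exact h.comp ((contDiff_pi.2 fun _ => contDiff_snd).prodMk
    ((ContinuousLinearMap.contDiff _).comp contDiff_fst))
end



section Forms

variable {E : Type*} [NormedAddCommGroup E] [NormedSpace ℝ E]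
  {H : Type*} [TopologicalSpace H] (I : ModelWithCorners ℝ E H)
  (M : Type*) [TopologicalSpace M] [ChartedSpace H M]
  {E' : Type*} [NormedAddCommGroup E'] [NormedSpace ℝ E']
  {H' : Type*} [TopologicalSpace H'] (I' : ModelWithCorners ℝ E' H')
  {M' : Type*} [TopologicalSpace M'] [ChartedSpace H' M']

/-- A (not necessarily smooth) differential `k`-form on the manifold `M`: an alternating `k`-linear
form on every tangent space. -/
def RawForm (k : ℕ) : Type _ := (x : M) → TangentSpace I x [⋀^Fin k]→L[ℝ] ℝ

noncomputable instance (k : ℕ) : AddCommGroup (RawForm I M k) :=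
  inferInstanceAs (AddCommGroup ((x : M) → TangentSpace I x [⋀^Fin k]→L[ℝ] ℝ))

noncomputable instance (k : ℕ) : Module ℝ (RawForm I M k) :=
  inferInstanceAs (Module ℝ ((x : M) → TangentSpace I x [⋀^Fin k]→L[ℝ] ℝ))

variable {M}

/-- The differential of the preferred chart around `x₀`. -/
noncomputable def chartDiff (x₀ x : M) : TangentSpace I x →L[ℝ] E :=
  mfderiv I 𝓘(ℝ, E) (extChartAt I x₀) x

/-- The differential of the inverse of the preferred chart around `x₀`. -/
noncomputable def chartSymmDiff (x₀ : M) (y : E) :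
    E →L[ℝ] TangentSpace I ((extChartAt I x₀).symm y) :=
  mfderiv 𝓘(ℝ, E) I (extChartAt I x₀).symm y

/-- The expression of a form in the preferred chart around `x₀`, i.e. its pullback along the inverse
of this chart. Only its values on the target of the chart are meaningful. -/
noncomputable def chartForm {k : ℕ} (η : RawForm I M k) (x₀ : M) : E → E [⋀^Fin k]→L[ℝ] ℝ :=
  fun y => (η ((extChartAt I x₀).symm y)).compContinuousLinearMap (chartSymmDiff I x₀ y)

/-- A form is smooth if all its chart expressions are. -/
def IsSmoothForm {k : ℕ} (η : RawForm I M k) : Prop :=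
  ∀ x₀ : M, ContDiffOn ℝ ∞ (chartForm I η x₀) (extChartAt I x₀).target

/-- The exterior derivative, computed at `x` in the preferred chart around `x`. -/
noncomputable def rawD {k : ℕ} (η : RawForm I M k) : RawForm I M (k + 1) := fun x =>
  (extDeriv (chartForm I η x) (extChartAt I x x)).compContinuousLinearMap (chartDiff I x x)

variable {I I'}

/-- The pullback of a form along a map `g`. -/
noncomputable def rawPull {k : ℕ} (g : M → M') (η : RawForm I' M' k) : RawForm I M k := fun x =>
  (η (g x)).compContinuousLinearMap (mfderiv I I' g x)


theorem comp_congr {k : ℕ} (η : RawForm I M k) {p p' : M} (h : p = p')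
    (A : E' →L[ℝ] TangentSpace I p) (A' : E' →L[ℝ] TangentSpace I p')
    (hA : ∀ v, (show E from A v) = (show E from A' v)) :
    (η p).compContinuousLinearMap A = (η p').compContinuousLinearMap A' := by
  subst h
  have : A = A' := by ext v; exact hA v
  rw [this]

variable [I.Boundaryless] [I'.Boundaryless] [IsManifold I ∞ M] [IsManifold I' ∞ M']

theorem mdiff_symm (x₀ : M) {y : E} (hy : y ∈ (extChartAt I x₀).target) :
    MDifferentiableAt 𝓘(ℝ, E) I (extChartAt I x₀).symm y := by
  have : IsManifold I 1 M := IsManifold.of_le (n := ∞) (by simp)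
  have h := mdifferentiableWithinAt_extChartAt_symm (I := I) (x := x₀) hy
  rwa [I.range_eq_univ, mdifferentiableWithinAt_univ] at h

/-- A map in the preferred charts around `x₀` and `m₀`. -/
noncomputable def inCharts (I : ModelWithCorners ℝ E H) (I' : ModelWithCorners ℝ E' H') (g : M → M')
    (x₀ : M) (m₀ : M') : E → E' :=
  fun y => extChartAt I' m₀ (g ((extChartAt I x₀).symm y))

theorem chartForm_rawPull {k : ℕ} (η : RawForm I' M' k) {g : M → M'} {x₀ : M} {m₀ : M'} {z : E}
    (hg : MDifferentiableAt I I' g ((extChartAt I x₀).symm z))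
    (hgc : ∀ᶠ u in 𝓝 z, g ((extChartAt I x₀).symm u) ∈ (extChartAt I' m₀).source)
    (hz : z ∈ (extChartAt I x₀).target) :
    chartForm I (rawPull (I := I) g η) x₀ z =
      (chartForm I' η m₀ (inCharts I I' g x₀ m₀ z)).compContinuousLinearMap
        (fderiv ℝ (inCharts I I' g x₀ m₀) z) := by
  have : IsManifold I' 1 M' := IsManifold.of_le (n := ∞) (by simp)
  have hsrc := hgc.self_of_nhds
  have h1 := mdiff_symm (I := I) x₀ hz
  have h2 : MDifferentiableAt 𝓘(ℝ, E) I' (fun u => g ((extChartAt I x₀).symm u)) z :=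
    MDifferentiableAt.comp z hg h1
  have h3 : MDifferentiableAt I' 𝓘(ℝ, E') (extChartAt I' m₀) (g ((extChartAt I x₀).symm z)) :=
    mdifferentiableAt_extChartAt (by rwa [← extChartAt_source I'])
  have h4 : MDifferentiableAt 𝓘(ℝ, E) 𝓘(ℝ, E') (inCharts I I' g x₀ m₀) z :=
    MDifferentiableAt.comp z h3 h2
  have h5 := mdiff_symm (I := I') m₀ (y := inCharts I I' g x₀ m₀ z)
    ((extChartAt I' m₀).map_source hsrc)
  have hA := mfderiv_comp z h5 h4
  have hB := mfderiv_comp z hg h1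
  have hev : ((extChartAt I' m₀).symm ∘ inCharts I I' g x₀ m₀) =ᶠ[𝓝 z]
      (g ∘ (extChartAt I x₀).symm) := by
    filter_upwards [hgc] with u hu
    exact (extChartAt I' m₀).left_inv hu
  have hC := hev.mfderiv_eq (I := 𝓘(ℝ, E)) (I' := I')
  have hp : g ((extChartAt I x₀).symm z) =
      (extChartAt I' m₀).symm (inCharts I I' g x₀ m₀ z) :=
    ((extChartAt I' m₀).left_inv hsrc).symm
  let B₁ : E →L[ℝ] TangentSpace I ((extChartAt I x₀).symm z) :=
    mfderiv 𝓘(ℝ, E) I (extChartAt I x₀).symm z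
  let B₂ : E →L[ℝ] TangentSpace I' (g ((extChartAt I x₀).symm z)) :=
    (mfderiv I I' g ((extChartAt I x₀).symm z)).comp B₁
  let C₁ : E' →L[ℝ] TangentSpace I' ((extChartAt I' m₀).symm (inCharts I I' g x₀ m₀ z)) :=
    mfderiv 𝓘(ℝ, E') I' (extChartAt I' m₀).symm (inCharts I I' g x₀ m₀ z)
  let C₂ : E →L[ℝ] TangentSpace I' ((extChartAt I' m₀).symm (inCharts I I' g x₀ m₀ z)) :=
    C₁.comp (fderiv ℝ (inCharts I I' g x₀ m₀) z)
  refine comp_congr η hp B₂ C₂ fun v => ?_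
  have hB' := DFunLike.congr_fun hB v
  have hA' := DFunLike.congr_fun hA v
  rw [mfderiv_eq_fderiv] at hA'
  have hC' := DFunLike.congr_fun hC v
  exact (hB'.symm.trans hC'.symm).trans hA'

theorem contDiffAt_inCharts {g : M → M'} (hg : ContMDiff I I' ∞ g) {x₀ : M} {m₀ : M'} {z : E}
    (hsrc : g ((extChartAt I x₀).symm z) ∈ (extChartAt I' m₀).source)
    (hz : z ∈ (extChartAt I x₀).target) : ContDiffAt ℝ ∞ (inCharts I I' g x₀ m₀) z := by
  have h1 : ContMDiffAt 𝓘(ℝ, E) I ∞ (extChartAt I x₀).symm z :=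
    (contMDiffOn_extChartAt_symm x₀).contMDiffAt ((isOpen_extChartAt_target x₀).mem_nhds hz)
  have h3 : ContMDiffAt I' 𝓘(ℝ, E') ∞ (extChartAt I' m₀) (g ((extChartAt I x₀).symm z)) :=
    contMDiffAt_extChartAt' (by rwa [← extChartAt_source I'])
  exact (ContMDiffAt.comp z h3 ((hg _).comp z h1)).contDiffAt

theorem eventually_mem_source {g : M → M'} (hg : Continuous g) {x₀ : M} {m₀ : M'} {z : E}
    (hsrc : g ((extChartAt I x₀).symm z) ∈ (extChartAt I' m₀).source)
    (hz : z ∈ (extChartAt I x₀).target) :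
    ∀ᶠ u in 𝓝 z, g ((extChartAt I x₀).symm u) ∈ (extChartAt I' m₀).source := by
  have hc : ContinuousAt (fun u => g ((extChartAt I x₀).symm u)) z :=
    hg.continuousAt.comp ((continuousOn_extChartAt_symm x₀).continuousAt
      ((isOpen_extChartAt_target x₀).mem_nhds hz))
  exact hc.eventually ((isOpen_extChartAt_source m₀).mem_nhds hsrc)

theorem eventually_chartForm_rawPull {k : ℕ} (η : RawForm I' M' k) {g : M → M'}
    (hg : ContMDiff I I' ∞ g) {x₀ : M} {m₀ : M'} {z : E}
    (hsrc : g ((extChartAt I x₀).symm z) ∈ (extChartAt I' m₀).source)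
    (hz : z ∈ (extChartAt I x₀).target) :
    chartForm I (rawPull (I := I) g η) x₀ =ᶠ[𝓝 z] fun u =>
      (chartForm I' η m₀ (inCharts I I' g x₀ m₀ u)).compContinuousLinearMap
        (fderiv ℝ (inCharts I I' g x₀ m₀) u) := by
  filter_upwards [eventually_eventually_nhds.2 (eventually_mem_source hg.continuous hsrc hz),
    (isOpen_extChartAt_target x₀).mem_nhds hz] with u hu hut
  exact chartForm_rawPull η ((hg _).mdifferentiableAt (by simp)) hu hut

theorem IsSmoothForm.contDiffAt {k : ℕ} {η : RawForm I M k} (h : IsSmoothForm I η) {x₀ : M} {z : E}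
    (hz : z ∈ (extChartAt I x₀).target) : ContDiffAt ℝ ∞ (chartForm I η x₀) z :=
  (h x₀).contDiffAt ((isOpen_extChartAt_target x₀).mem_nhds hz)

/-- Pullbacks of smooth forms along smooth maps are smooth. -/
theorem IsSmoothForm.rawPull {k : ℕ} {η : RawForm I' M' k} (h : IsSmoothForm I' η) {g : M → M'}
    (hg : ContMDiff I I' ∞ g) : IsSmoothForm I (rawPull (I := I) g η) := by
  intro x₀ z hz
  apply ContDiffAt.contDiffWithinAt
  have hsrc := mem_extChartAt_source (I := I') (g ((extChartAt I x₀).symm z))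
  have hτ := contDiffAt_inCharts hg hsrc hz
  refine ContDiffAt.congr_of_eventuallyEq ?_ (eventually_chartForm_rawPull η hg hsrc hz)
  have h1 : ContDiffAt ℝ ∞ (chartForm I' η (g ((extChartAt I x₀).symm z)))
      (inCharts I I' g x₀ (g ((extChartAt I x₀).symm z)) z) :=
    h.contDiffAt ((extChartAt I' _).map_source hsrc)
  exact contDiff_compCLM.contDiffAt.comp z
    ((h1.comp z hτ).prodMk (hτ.fderiv_right (m := ∞) (by simp)))

theorem rawPull_id {k : ℕ} (η : RawForm I M k) : SymplecticDeformation.rawPull (I := I) id η = η := by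
  funext x
  unfold SymplecticDeformation.rawPull
  ext v
  simp [mfderiv_id]

/-- In any preferred chart, the exterior derivative of a smooth form is given by the exterior
derivative of its chart expression. -/
theorem chartForm_rawD {k : ℕ} {η : RawForm I M k} (h : IsSmoothForm I η) {x₀ : M} {z : E}
    (hz : z ∈ (extChartAt I x₀).target) :
    chartForm I (rawD I η) x₀ z = extDeriv (chartForm I η x₀) z := by
  have : IsManifold I 1 M := IsManifold.of_le (n := ∞) (by simp)
  set x := (extChartAt I x₀).symm z with hx
  have hsrc : (id ((extChartAt I x₀).symm z) : M) ∈ (extChartAt I x).source :=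
    mem_extChartAt_source (I := I) x
  have hτ := contDiffAt_inCharts (I := I) contMDiff_id hsrc hz
  have hev := eventually_chartForm_rawPull (I := I) η contMDiff_id hsrc hz
  rw [rawPull_id] at hev
  rw [hev.extDeriv_eq, extDeriv_pullback (r := ∞)]
  · have h3 : MDifferentiableAt I 𝓘(ℝ, E) (extChartAt I x) x :=
      mdifferentiableAt_extChartAt (by rw [← extChartAt_source I]; exact hsrc)
    have hA := mfderiv_comp z h3 (mdiff_symm (I := I) x₀ hz)
    ext v
    have hA' : ∀ v, _ := fun v => DFunLike.congr_fun hA v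
    have e : ∀ v, fderiv ℝ (inCharts I I id x₀ x) z v = mfderiv I 𝓘(ℝ, E) (extChartAt I x) x
        (mfderiv 𝓘(ℝ, E) I (extChartAt I x₀).symm z v) := by
      intro v
      rw [← mfderiv_eq_fderiv]
      exact hA' v
    simp only [ContinuousAlternatingMap.compContinuousLinearMap_apply, Function.comp_def, e]
    rfl
  · exact (h.contDiffAt ((extChartAt I x).map_source hsrc)).differentiableAt (by simp)
  · exact hτ
  · simpa using two_le_infty

/-- The exterior derivative of a smooth form is smooth. -/
theorem IsSmoothForm.rawD {k : ℕ} {η : RawForm I M k} (h : IsSmoothForm I η) :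
    IsSmoothForm I (rawD I η) := by
  intro x₀ z hz
  apply ContDiffAt.contDiffWithinAt
  have hev : chartForm I (SymplecticDeformation.rawD I η) x₀ =ᶠ[𝓝 z]
      extDeriv (chartForm I η x₀) := by
    filter_upwards [(isOpen_extChartAt_target x₀).mem_nhds hz] with u hu
    exact chartForm_rawD h hu
  refine ContDiffAt.congr_of_eventuallyEq ?_ hev
  exact (ContinuousAlternatingMap.alternatizeUncurryFinCLM ℝ E ℝ).contDiff.contDiffAt.comp z
    ((h.contDiffAt hz).fderiv_right (m := ∞) (by simp))

/-- The space `Ω^k(M)` of smooth `k`-forms. -/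
def Om (I : ModelWithCorners ℝ E H) (M : Type*) [TopologicalSpace M] [ChartedSpace H M] (k : ℕ) :
    Submodule ℝ (RawForm I M k) where
  carrier := {η | IsSmoothForm I η}
  zero_mem' := fun _ => contDiffOn_const (c := (0 : E [⋀^Fin k]→L[ℝ] ℝ))
  add_mem' := fun ha hb x₀ => (ha x₀).add (hb x₀)
  smul_mem' := fun c _ ha x₀ => (ha x₀).const_smul c

/-- The exterior derivative `d : Ω^k(M) → Ω^(k+1)(M)`. -/
noncomputable def d (I : ModelWithCorners ℝ E H) (M : Type*) [TopologicalSpace M] [ChartedSpace H M]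
    [I.Boundaryless] [IsManifold I ∞ M] (k : ℕ) : Om I M k →ₗ[ℝ] Om I M (k + 1) where
  toFun η := ⟨rawD I η.1, IsSmoothForm.rawD η.2⟩
  map_add' a b := by
    refine Subtype.ext (funext fun x => ?_)
    have hx := mem_extChartAt_target (I := I) x
    have ha := (IsSmoothForm.contDiffAt a.2 hx).differentiableAt (by simp)
    have hb := (IsSmoothForm.contDiffAt b.2 hx).differentiableAt (by simp)
    have h : extDeriv (chartForm I (a + b).1 x) (extChartAt I x x) =
      extDeriv (chartForm I a.1 x) (extChartAt I x x) +
        extDeriv (chartForm I b.1 x) (extChartAt I x x) := extDeriv_add ha hb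
    simp only [rawD, h]
    rfl
  map_smul' c a := by
    refine Subtype.ext (funext fun x => ?_)
    have h : extDeriv (chartForm I (c • a).1 x) (extChartAt I x x) =
      c • extDeriv (chartForm I a.1 x) (extChartAt I x x) := 
      extDeriv_smul c (chartForm I a.1 x)
    simp only [rawD, h]
    rfl

/-- The pullback `g^* : Ω^k(M') → Ω^k(M)` along a smooth map `g : M → M'`. -/
noncomputable def pull {g : M → M'} (hg : ContMDiff I I' ∞ g) (k : ℕ) :
    Om I' M' k →ₗ[ℝ] Om I M k where
  toFun η := ⟨rawPull g η.1, IsSmoothForm.rawPull η.2 hg⟩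
  map_add' _ _ := rfl
  map_smul' _ _ := rfl

/-- `d ∘ d = 0`. -/
theorem d_d {k : ℕ} (η : Om I M k) : d I M (k + 1) (d I M k η) = 0 := by
  refine Subtype.ext (funext fun x => ?_)
  have hx := mem_extChartAt_target (I := I) x
  have hev : chartForm I (rawD I η.1) x =ᶠ[𝓝 (extChartAt I x x)]
      extDeriv (chartForm I η.1 x) := by
    filter_upwards [(isOpen_extChartAt_target x).mem_nhds hx] with u hu
    exact chartForm_rawD η.2 hu
  have h0 := extDeriv_extDeriv_apply (r := ∞) (IsSmoothForm.contDiffAt η.2 hx)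
    (by simpa using two_le_infty)
  have h1 : extDeriv (chartForm I (rawD I η.1) x) (extChartAt I x x) = 0 := by
    rw [hev.extDeriv_eq, h0]
  change rawD I (rawD I η.1) x = 0
  rw [rawD, h1]
  rfl

/-- The exterior derivative commutes with pullbacks. -/
theorem pull_d {g : M → M'} (hg : ContMDiff I I' ∞ g) {k : ℕ} (η : Om I' M' k) :
    pull hg (k + 1) (d I' M' k η) = d I M k (pull hg k η) := by
  have : IsManifold I 1 M := IsManifold.of_le (n := ∞) (by simp)
  have : IsManifold I' 1 M' := IsManifold.of_le (n := ∞) (by simp)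
  refine Subtype.ext (funext fun x => ?_)
  have hz := mem_extChartAt_target (I := I) x
  have hx : (extChartAt I x).symm (extChartAt I x x) = x := extChartAt_to_inv x
  have hs' := mem_extChartAt_source (I := I') (g x)
  have hsrc : g ((extChartAt I x).symm (extChartAt I x x)) ∈ (extChartAt I' (g x)).source := by
    rw [hx]; exact hs'
  have hτ := contDiffAt_inCharts hg hsrc hz
  have hpt : inCharts I I' g x (g x) (extChartAt I x x) = extChartAt I' (g x) (g x) := by
    rw [inCharts, hx]
  have h1 : extDeriv (chartForm I (rawPull (I := I) g η.1) x) (extChartAt I x x) =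
      (extDeriv (chartForm I' η.1 (g x)) (extChartAt I' (g x) (g x))).compContinuousLinearMap
        (fderiv ℝ (inCharts I I' g x (g x)) (extChartAt I x x)) := by
    rw [(eventually_chartForm_rawPull η.1 hg hsrc hz).extDeriv_eq, extDeriv_pullback (r := ∞), hpt]
    · rw [hpt]
      exact (IsSmoothForm.contDiffAt η.2 (mem_extChartAt_target (g x))).differentiableAt (by simp)
    · exact hτ
    · simpa using two_le_infty
  have hφ : MDifferentiableAt I 𝓘(ℝ, E) (extChartAt I x) x :=
    mdifferentiableAt_extChartAt (by rw [← extChartAt_source I]; exact mem_extChartAt_source x)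
  have hφ' : MDifferentiableAt I' 𝓘(ℝ, E') (extChartAt I' (g x)) (g x) :=
    mdifferentiableAt_extChartAt (by rw [← extChartAt_source I']; exact hs')
  have hA := mfderiv_comp x (hτ.contMDiffAt.mdifferentiableAt (by simp)) hφ
  have hB := mfderiv_comp x hφ' ((hg x).mdifferentiableAt (by simp))
  have hev : (inCharts I I' g x (g x) ∘ extChartAt I x) =ᶠ[𝓝 x] (extChartAt I' (g x) ∘ g) := by
    filter_upwards [(isOpen_extChartAt_source x).mem_nhds (mem_extChartAt_source (I := I) x)]
      with u hu
    simp only [Function.comp_apply, inCharts]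
    rw [(extChartAt I x).left_inv hu]
  have hC := hev.mfderiv_eq (I := I) (I' := 𝓘(ℝ, E'))
  have e : ∀ v, chartDiff I' (g x) (g x) (mfderiv I I' g x v) =
      fderiv ℝ (inCharts I I' g x (g x)) (extChartAt I x x) (chartDiff I x x v) := by
    intro v
    rw [mfderiv_eq_fderiv] at hA
    exact (DFunLike.congr_fun hB v).symm.trans
      ((DFunLike.congr_fun hC v).symm.trans (DFunLike.congr_fun hA v))
  change rawPull (I := I) g (rawD I' η.1) x = rawD I (rawPull (I := I) g η.1) x
  rw [rawD, h1]
  ext v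
  simp only [rawPull, rawD, ContinuousAlternatingMap.compContinuousLinearMap_apply,
    Function.comp_def, e]

end Forms

section Complexes

variable {E : Type*} [NormedAddCommGroup E] [NormedSpace ℝ E]
  {H : Type*} [TopologicalSpace H] {I : ModelWithCorners ℝ E H} [I.Boundaryless]
  {M : Type*} [TopologicalSpace M] [ChartedSpace H M] [IsManifold I ∞ M]
  {F : Type*} [NormedAddCommGroup F] [NormedSpace ℝ F]
  {K : Type*} [TopologicalSpace K] {J : ModelWithCorners ℝ F K} [J.Boundaryless]
  {L : Type*} [TopologicalSpace L] [ChartedSpace K L] [IsManifold J ∞ L]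

/-- The quotient `Z / (Z ∩ B)` of two subspaces of a vector space. -/
abbrev SubQuot {A : Type*} [AddCommGroup A] [Module ℝ A] (Z B : Submodule ℝ A) : Type _ :=
  Z ⧸ B.submoduleOf Z

/-- The class in `Z / (Z ∩ B)` of an element of `Z`. -/
abbrev cls {A : Type*} [AddCommGroup A] [Module ℝ A] {Z : Submodule ℝ A} (B : Submodule ℝ A)
    (a : A) (ha : a ∈ Z) : SubQuot Z B :=
  Submodule.Quotient.mk ⟨a, ha⟩

/-- The differential `(a, b) ↦ (da, ι^*a - db)` of the mapping cone of `ι^* : Ω(M) → Ω(L)`,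
from degree `k + 1` to degree `k + 2`. -/
noncomputable def coneD {ι : L → M} (hι : ContMDiff J I ∞ ι) (k : ℕ) :
    (Om I M (k + 1) × Om J L k) →ₗ[ℝ] (Om I M (k + 2) × Om J L (k + 1)) where
  toFun z := (d I M (k + 1) z.1, pull hι (k + 1) z.1 - d J L k z.2)
  map_add' z w := by
    refine Prod.ext (map_add _ _ _) ?_
    simp only [Prod.fst_add, Prod.snd_add, map_add]
    abel
  map_smul' c z := by
    refine Prod.ext (map_smul _ _ _) ?_
    simp only [Prod.smul_fst, Prod.smul_snd, map_smul, smul_sub, RingHom.id_apply]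

theorem coneD_coneD {ι : L → M} (hι : ContMDiff J I ∞ ι) (k : ℕ) (z : Om I M (k + 1) × Om J L k) :
    coneD hι (k + 1) (coneD hι k z) = 0 := by
  refine Prod.ext (d_d z.1) ?_
  change pull hι (k + 2) (d I M (k + 1) z.1) - d J L (k + 1) (pull hι (k + 1) z.1 - d J L k z.2) = 0
  rw [map_sub, d_d, pull_d, sub_zero, sub_self]

/-- The `2`-cocycles of the mapping cone of `ι^*`. -/
noncomputable def coneZ {ι : L → M} (hι : ContMDiff J I ∞ ι) : Submodule ℝ (Om I M 2 × Om J L 1) :=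
  LinearMap.ker (coneD hι 1)

/-- The `2`-coboundaries of the mapping cone of `ι^*`. -/
noncomputable def coneB {ι : L → M} (hι : ContMDiff J I ∞ ι) : Submodule ℝ (Om I M 2 × Om J L 1) :=
  LinearMap.range (coneD hι 0)

/-- The relative `k`-forms, i.e. those whose pullback to `L` vanishes. -/
noncomputable def relForms {ι : L → M} (hι : ContMDiff J I ∞ ι) (k : ℕ) : Submodule ℝ (Om I M k) :=
  LinearMap.ker (pull hι k)

/-- The `2`-cocycles of the relative de Rham complex. -/
noncomputable def relZ {ι : L → M} (hι : ContMDiff J I ∞ ι) : Submodule ℝ (Om I M 2) :=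
  relForms hι 2 ⊓ LinearMap.ker (d I M 2)

/-- The `2`-coboundaries of the relative de Rham complex. -/
noncomputable def relB {ι : L → M} (hι : ContMDiff J I ∞ ι) : Submodule ℝ (Om I M 2) :=
  (relForms hι 1).map (d I M 1)

/-- The second cohomology of the mapping cone of `ι^*`. -/
abbrev H2Cone {ι : L → M} (hι : ContMDiff J I ∞ ι) : Type _ :=
  SubQuot (A := Om I M 2 × Om J L 1) (coneZ hι) (coneB hι)

/-- The second relative de Rham cohomology `H²(M, L)`. -/
abbrev H2Rel {ι : L → M} (hι : ContMDiff J I ∞ ι) : Type _ :=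
  SubQuot (A := Om I M 2) (relZ hι) (relB hι)

end Complexes

section Cotangent

variable {F : Type*} [NormedAddCommGroup F] [NormedSpace ℝ F]
  {K : Type*} [TopologicalSpace K] (J : ModelWithCorners ℝ F K)
  (L : Type*) [TopologicalSpace L] [ChartedSpace K L] [IsManifold J ∞ L]

/-- The cotangent bundle `T^*L`. -/
abbrev CotangentBundle : Type _ :=
  Bundle.TotalSpace (F →L[ℝ] ℝ) (fun x : L => TangentSpace J x →L[ℝ] Bundle.Trivial L ℝ x)

/-- The model with corners of the manifold `T^*L`. -/
noncomputable abbrev cotangentModel : ModelWithCorners ℝ (F × (F →L[ℝ] ℝ)) (ModelProd K (F →L[ℝ] ℝ)) :=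
  J.prod 𝓘(ℝ, F →L[ℝ] ℝ)

/-- The tautological `1`-form `θ` on `T^*L`: `θ_p(v) = p(dπ(v))`, where `π : T^*L → L` is the
projection. -/
noncomputable def tautForm : RawForm (cotangentModel J) (CotangentBundle J L) 1 := fun p =>
  ContinuousAlternatingMap.ofSubsingleton ℝ (TangentSpace (cotangentModel J) p) ℝ 0
    ((show TangentSpace J p.1 →L[ℝ] ℝ from p.2).comp
      (mfderiv (cotangentModel J) J (fun p' : CotangentBundle J L => p'.1) p))

/-- The canonical symplectic form `ω_can = -dθ` on `T^*L`, i.e. `∑ dxᵢ ∧ dyᵢ` in cotangent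
coordinates. -/
noncomputable def canForm : RawForm (cotangentModel J) (CotangentBundle J L) 2 :=
  -rawD (cotangentModel J) (tautForm J L)

variable {J L}

/-- The value at `x` of a `1`-form on `L`, as a covector. -/
noncomputable def toCovector (σ : Om J L 1) (x : L) : TangentSpace J x →L[ℝ] ℝ :=
  (ContinuousAlternatingMap.ofSubsingleton ℝ (TangentSpace J x) ℝ 0).symm (σ.1 x)

/-- The section of `T^*L` given by a `1`-form on `L`. -/
noncomputable def toSection (σ : Om J L 1) (x : L) : CotangentBundle J L := ⟨x, toCovector σ x⟩

/-- The zero section of `T^*L`. -/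
noncomputable def zeroSection (x : L) : CotangentBundle J L := ⟨x, 0⟩

/-- The vertical, fibrewise constant vector field `X_σ` on `T^*L` given by a `1`-form `σ` on `L`: its
value at a covector `p` over `x` is the velocity of the curve `s ↦ p + s σ(x)` at `s = 0`. -/
noncomputable def vertField (σ : Om J L 1) (p : CotangentBundle J L) :
    TangentSpace (cotangentModel J) p :=
  mfderiv 𝓘(ℝ, ℝ) (cotangentModel J)
    (fun s : ℝ => (⟨p.1, p.2 + s • toCovector σ p.1⟩ : CotangentBundle J L)) 0 (1 : ℝ)

end Cotangent

section Symplectic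

variable {E : Type*} [NormedAddCommGroup E] [NormedSpace ℝ E]
  {H : Type*} [TopologicalSpace H] {I : ModelWithCorners ℝ E H} [I.Boundaryless]
  {M : Type*} [TopologicalSpace M] [ChartedSpace H M] [IsManifold I ∞ M]
  {F : Type*} [NormedAddCommGroup F] [NormedSpace ℝ F]
  {K : Type*} [TopologicalSpace K] {J : ModelWithCorners ℝ F K} [J.Boundaryless]
  {L : Type*} [TopologicalSpace L] [ChartedSpace K L] [IsManifold J ∞ L]

/-- A smooth `2`-form is symplectic if it is closed and nondegenerate. -/
def IsSymplectic (η : Om I M 2) : Prop :=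
  d I M 2 η = 0 ∧
    ∀ (x : M) (v : TangentSpace I x), (∀ w : TangentSpace I x, η.1 x ![v, w] = 0) → v = 0

variable (I) in
/-- The time-one flow of a vector field: `x` is sent to `γ 1`, where `γ` is the integral curve with
`γ 0 = x` (and to `x` if there is no such curve). -/
noncomputable def timeOneFlow (X : (x : M) → TangentSpace I x) (x : M) : M :=
  open Classical in
  if h : ∃ γ : ℝ → M, γ 0 = x ∧ IsMIntegralCurve (I := I) γ X then h.choose 1 else x

/-- The auxiliary data of the construction, for an embedding `ι : L → M` and a `2`-form `ω₀` on `M`: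
a symplectomorphism `ψ : V → U` from a neighbourhood `V` of the zero section in `T^*L` onto a
neighbourhood `U` of `L` in `M` that restricts to the identity on `L`; a smaller, fibrewise convex
neighbourhood `V'` of the zero section, with `U' = ψ(V')`; and a smooth function `f` on `M` that is
`1` on the closure of `U'` and has support in `U`. -/
structure WeinsteinData (ι : L → M) (ω₀ : Om I M 2) where
  /-- the map `ψ`, with source `V` and target `U` -/
  ψ : OpenPartialHomeomorph (CotangentBundle J L) M
  contMDiffOn_ψ : ContMDiffOn (cotangentModel J) I ∞ ψ ψ.source
  contMDiffOn_ψ_symm : ContMDiffOn I (cotangentModel J) ∞ ψ.symm ψ.target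
  zero_mem_source : ∀ x : L, (zeroSection x : CotangentBundle J L) ∈ ψ.source
  ψ_zero : ∀ x : L, ψ (zeroSection x) = ι x
  ψ_symplectic : ∀ p ∈ ψ.source, rawPull (I := cotangentModel J) ψ ω₀.1 p = canForm J L p
  /-- the smaller neighbourhood `V'` -/
  V' : Set (CotangentBundle J L)
  isOpen_V' : IsOpen V'
  zero_mem_V' : ∀ x : L, (zeroSection x : CotangentBundle J L) ∈ V'
  convex_V' : ∀ x : L, Convex ℝ {p : TangentSpace J x →L[ℝ] ℝ | (⟨x, p⟩ : CotangentBundle J L) ∈ V'}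
  closure_V' : closure V' ⊆ ψ.source
  closure_U' : closure (ψ '' V') ⊆ ψ.target
  /-- the cut-off function -/
  f : M → ℝ
  contMDiff_f : ContMDiff I 𝓘(ℝ, ℝ) ∞ f
  f_eq_one : ∀ y ∈ closure (ψ '' V'), f y = 1
  tsupport_f : tsupport f ⊆ ψ.target

namespace WeinsteinData

variable {ι : L → M} {ω₀ : Om I M 2} (W : WeinsteinData (J := J) ι ω₀)

/-- The smooth sections of `T^*L` with values in `V'`. -/
def sections : Set (Om J L 1) := {σ | ∀ x, toSection σ x ∈ W.V'}

/-- The image `ψ(σ(L))`, as a subset of `M`. -/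
def graph (σ : Om J L 1) : Set M := range fun x => W.ψ (toSection σ x)

/-- The space of pairs `(ω', L')` where `ω'` is a symplectic form on `M`, and `L'` is of the form
`ψ(σ(L))` for a section `σ` with values in `V'` and is Lagrangian for `ω'`. -/
def pairs : Set (Om I M 2 × Set M) :=
  {p | IsSymplectic p.1 ∧ ∃ σ ∈ W.sections, p.2 = W.graph σ ∧
    rawPull (I := J) (fun x => W.ψ (toSection σ x)) p.1.1 = 0}

/-- The section of `T^*L` that corresponds to a submanifold `L' = ψ(σ(L))`. -/
noncomputable def sectionOf (L' : Set M) : Om J L 1 :=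
  open Classical in
  if h : ∃ σ ∈ W.sections, L' = W.graph σ then h.choose else 0

/-- The vector field `f · ψ_* X_σ` on `M`, where `σ` is the section that corresponds to `L'`. -/
noncomputable def field (L' : Set M) (y : M) : TangentSpace I y :=
  open Classical in
  if y ∈ W.ψ.target then
    (W.f y • mfderiv (cotangentModel J) I W.ψ (W.ψ.symm y)
      (vertField (W.sectionOf L') (W.ψ.symm y)) : E)
  else 0

/-- The diffeomorphism `φ_{L'}`, the time-one flow of `f · ψ_* X_σ`. -/
noncomputable def φ (L' : Set M) : M → M := timeOneFlow I (W.field L')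

/-- The map `q : (ω', L') ↦ (φ_{L'})^* ω'`. -/
noncomputable def q (p : Om I M 2 × Set M) : RawForm I M 2 := rawPull (I := I) (W.φ p.2) p.1.1

end WeinsteinData

variable (I) in
/-- `ρ` is (a smooth extension to all times of) an isotopy `(ρ_t)`, `0 ≤ t ≤ ε`, of `M`. -/
structure IsIsotopy (ε : ℝ) (ρ : ℝ → M → M) : Prop where
  contMDiff : ContMDiff (𝓘(ℝ, ℝ).prod I) I ∞ (fun p : ℝ × M => ρ p.1 p.2)
  zero : ρ 0 = id
  diffeo : ∀ t ∈ Icc 0 ε, ∃ Φ : Diffeomorph I I M M ∞, (Φ : M → M) = ρ t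

/-- The space of symplectic forms on `M` for which `L` is Lagrangian. -/
def lagForms {ι : L → M} (hι : ContMDiff J I ∞ ι) : Set (Om I M 2) :=
  {η | IsSymplectic η ∧ pull hι 2 η = 0}

/-- Equivalence of symplectic forms for which `L` is Lagrangian: `ω' ∼ ω''` if `(ρ_1)^* ω'' = ω'` for an
isotopy `(ρ_t)`, `0 ≤ t ≤ 1`, with `ρ_t(L) = L` for all `t`. -/
def lagRel {ι : L → M} (hι : ContMDiff J I ∞ ι) (η η' : lagForms hι) : Prop :=
  ∃ ρ : ℝ → M → M, IsIsotopy I 1 ρ ∧ rawPull (I := I) (ρ 1) η'.1.1 = η.1.1 ∧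
    ∀ t ∈ Icc (0 : ℝ) 1, ρ t '' range ι = range ι

/-- The moduli space of symplectic forms for which `L` is Lagrangian. -/
def LagModuli {ι : L → M} (hι : ContMDiff J I ∞ ι) : Type _ := Quot (lagRel hι)

namespace WeinsteinData

variable {ι : L → M} {ω₀ : Om I M 2} (W : WeinsteinData (J := J) ι ω₀)

/-- Equivalence of pairs: `(ω', L') ∼ (ω'', L'')` if there is an isotopy `(ρ_t)`, `0 ≤ t ≤ 1`, with
`ρ_1(L') = L''` and `(ρ_1)^* ω'' = ω'`, such that every `ρ_t(L')` is of the form `ψ(σ(L))` for a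
section `σ` with values in `V'`. -/
def pairRel (p p' : W.pairs) : Prop :=
  ∃ ρ : ℝ → M → M, IsIsotopy I 1 ρ ∧ ρ 1 '' p.1.2 = p'.1.2 ∧
    rawPull (I := I) (ρ 1) p'.1.1.1 = p.1.1.1 ∧
    ∀ t ∈ Icc (0 : ℝ) 1, ∃ σ ∈ W.sections, ρ t '' p.1.2 = W.graph σ

/-- The local moduli space of pairs. -/
def PairModuli : Type _ := Quot W.pairRel

/-- `Q` is the map of moduli spaces induced by `q`; in particular, `q` maps pairs to symplectic forms
for which `L` is Lagrangian. -/
def IsInducedByQ (hι : ContMDiff J I ∞ ι) (Q : W.PairModuli → LagModuli hι) : Prop :=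
  ∀ p : W.pairs, ∃ η : lagForms hι, η.1.1 = W.q p.1 ∧ Q (Quot.mk _ p) = Quot.mk _ η

end WeinsteinData

/-- A one-parameter family of smooth forms depends smoothly on the parameter. A smooth path of forms
on `[0, ε]` is always given below by such a family, i.e. together with an extension to all times;
conditions on the path are only imposed for times in `[0, ε]`. -/
def IsSmoothFamily {k : ℕ} (η : ℝ → Om I M k) : Prop :=
  ∀ x₀ : M, ContDiffOn ℝ ∞ (fun p : ℝ × E => chartForm I (η p.1).1 x₀ p.2)
    (univ ×ˢ (extChartAt I x₀).target)

/-- `v` is the derivative at `t = 0` of the family `η`. -/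
def IsVelocity {k : ℕ} (η : ℝ → Om I M k) (v : Om I M k) : Prop :=
  ∀ (x : M) (u : Fin k → TangentSpace I x), HasDerivAt (fun t => (η t).1 x u) (v.1 x u) 0

/-- `ω_t`, `0 ≤ t ≤ ε`, is a smooth path in the space of symplectic forms for which `L` is
Lagrangian, and it starts at `ω₀`. -/
structure IsLagPath {ι : L → M} (hι : ContMDiff J I ∞ ι) (ω₀ : Om I M 2) (ε : ℝ) (η : ℝ → Om I M 2) :
    Prop where
  pos : 0 < ε
  smooth : IsSmoothFamily η
  mem : ∀ t ∈ Icc 0 ε, η t ∈ lagForms hι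
  zero : η 0 = ω₀

/-- The first order deformations coming from smooth paths in the space `lagForms`. -/
def lagVelocities {ι : L → M} (hι : ContMDiff J I ∞ ι) (ω₀ : Om I M 2) : Set (Om I M 2) :=
  {v | ∃ ε η, IsLagPath hι ω₀ ε η ∧ IsVelocity η v}

/-- The first order deformations coming from smooth paths in the space `lagForms` that are generated
by an isotopy `(ρ_t)` preserving `L`, i.e. `ρ_t(L) = L` and `(ρ_t)^* ω_t = ω₀`. -/
def trivialLagVelocities {ι : L → M} (hι : ContMDiff J I ∞ ι) (ω₀ : Om I M 2) : Set (Om I M 2) :=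
  {v | ∃ ε η, IsLagPath hι ω₀ ε η ∧ IsVelocity η v ∧ ∃ ρ : ℝ → M → M, IsIsotopy I ε ρ ∧
    ∀ t ∈ Icc 0 ε, ρ t '' range ι = range ι ∧ rawPull (I := I) (ρ t) (η t).1 = ω₀.1}

/-- The formal tangent space at `[ω₀]` of the moduli space `LagModuli`: first order deformations modulo
those coming from isotopies. -/
abbrev LagTangent {ι : L → M} (hι : ContMDiff J I ∞ ι) (ω₀ : Om I M 2) : Type _ :=
  SubQuot (A := Om I M 2) (Submodule.span ℝ (lagVelocities hι ω₀))
    (Submodule.span ℝ (trivialLagVelocities hι ω₀))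

namespace WeinsteinData

variable {ι : L → M} {ω₀ : Om I M 2} (W : WeinsteinData (J := J) ι ω₀)

/-- `(ω_t, L_t)`, `0 ≤ t ≤ ε`, with `L_t = ψ(α_t(L))` is a smooth path in the space of pairs, and it
starts at `(ω₀, L)`. -/
structure IsPairPath (ε : ℝ) (η : ℝ → Om I M 2) (α : ℝ → Om J L 1) : Prop where
  pos : 0 < ε
  smooth_form : IsSmoothFamily η
  smooth_section : IsSmoothFamily α
  mem_sections : ∀ t ∈ Icc 0 ε, α t ∈ W.sections
  mem_pairs : ∀ t ∈ Icc 0 ε, (η t, W.graph (α t)) ∈ W.pairs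
  form_zero : η 0 = ω₀
  graph_zero : W.graph (α 0) = range ι

/-- The first order deformations coming from smooth paths of pairs. -/
def pairVelocities : Set (Om I M 2 × Om J L 1) :=
  {v | ∃ ε η α, W.IsPairPath ε η α ∧ IsVelocity η v.1 ∧ IsVelocity α v.2}

/-- The first order deformations coming from smooth paths `(ω_t, L_t)` of pairs that are generated by
an isotopy `(ρ_t)`, i.e. `ρ_t(L) = L_t` and `(ρ_t)^* ω_t = ω₀`. -/
def trivialPairVelocities : Set (Om I M 2 × Om J L 1) :=
  {v | ∃ ε η α, W.IsPairPath ε η α ∧ IsVelocity η v.1 ∧ IsVelocity α v.2 ∧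
    ∃ ρ : ℝ → M → M, IsIsotopy I ε ρ ∧
      ∀ t ∈ Icc 0 ε, ρ t '' range ι = W.graph (α t) ∧ rawPull (I := I) (ρ t) (η t).1 = ω₀.1}

/-- The formal tangent space at `[(ω₀, L)]` of the moduli space `PairModuli`: first order deformations
modulo those coming from isotopies. -/
abbrev PairTangent : Type _ :=
  SubQuot (A := Om I M 2 × Om J L 1) (Submodule.span ℝ W.pairVelocities)
    (Submodule.span ℝ W.trivialPairVelocities)

/-- `T` is the formal linearization at `[(ω₀, L)]` of the map `Q` of moduli spaces induced by `q`: for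
each smooth path `(ω_t, L_t)` of pairs starting at `(ω₀, L)`, the forms `q(ω_t, L_t)`, which represent
`Q [(ω_t, L_t)]`, make up a smooth path in `lagForms` starting at `ω₀`, and `T` sends the class of the
derivative of the first path at `t = 0` to the class of the derivative of the second. -/
def IsFormalLinearization (hι : ContMDiff J I ∞ ι) (Q : W.PairModuli → LagModuli hι)
    (T : W.PairTangent →ₗ[ℝ] LagTangent hι ω₀) : Prop :=
  ∀ (ε : ℝ) (η : ℝ → Om I M 2) (α : ℝ → Om J L 1) (hp : W.IsPairPath ε η α),
    ∃ (ζ : ℝ → Om I M 2) (hζ : IsLagPath hι ω₀ ε ζ),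
      (∀ (t : ℝ) (ht : t ∈ Icc 0 ε), (ζ t).1 = W.q (η t, W.graph (α t)) ∧
        Q (Quot.mk _ ⟨(η t, W.graph (α t)), hp.mem_pairs t ht⟩) =
          Quot.mk _ ⟨ζ t, hζ.mem t ht⟩) ∧
      ∃ (v : Om I M 2 × Om J L 1) (w : Om I M 2)
        (hv : v ∈ Submodule.span ℝ W.pairVelocities)
        (hw : w ∈ Submodule.span ℝ (lagVelocities hι ω₀)),
        IsVelocity η v.1 ∧ IsVelocity α v.2 ∧ IsVelocity ζ w ∧ T (cls _ v hv) = cls _ w hw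

end WeinsteinData

end Symplectic

end SymplecticDeformation

open SymplecticDeformation

namespace SymplecticDeformation

section ProductForms

variable {E : Type*} [NormedAddCommGroup E] [NormedSpace ℝ E]
  {H : Type*} [TopologicalSpace H] {I : ModelWithCorners ℝ E H} [I.Boundaryless]
  {M : Type*} [TopologicalSpace M] [ChartedSpace H M] [IsManifold I ∞ M]
  {E' : Type*} [NormedAddCommGroup E'] [NormedSpace ℝ E']
  {H' : Type*} [TopologicalSpace H'] {I' : ModelWithCorners ℝ E' H'} [I'.Boundaryless]
  {M' : Type*} [TopologicalSpace M'] [ChartedSpace H' M'] [IsManifold I' ∞ M']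
  {E'' : Type*} [NormedAddCommGroup E''] [NormedSpace ℝ E'']
  {H'' : Type*} [TopologicalSpace H''] {I'' : ModelWithCorners ℝ E'' H''} [I''.Boundaryless]
  {M'' : Type*} [TopologicalSpace M''] [ChartedSpace H'' M''] [IsManifold I'' ∞ M'']

theorem rawPull_comp_apply {k : ℕ} (η : RawForm I'' M'' k) {h : M' → M''} {g : M → M'} {x : M}
    (hh : MDifferentiableAt I' I'' h (g x)) (hg : MDifferentiableAt I I' g x) :
    rawPull (I := I) (I' := I'') (h ∘ g) η x = rawPull (I := I) g (rawPull (I := I') h η) x := by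
  have h : mfderiv I I'' (h ∘ g) x = _ := mfderiv_comp x hh hg
  unfold rawPull
  rw [h]
  rfl

theorem rawPull_comp {k : ℕ} (η : RawForm I'' M'' k) {h : M' → M''} {g : M → M'}
    (hh : ContMDiff I' I'' ∞ h) (hg : ContMDiff I I' ∞ g) :
    rawPull (I := I) (I' := I'') (h ∘ g) η = rawPull (I := I) g (rawPull (I := I') h η) :=
  funext fun _ => rawPull_comp_apply η ((hh _).mdifferentiableAt (by simp))
    ((hg _).mdifferentiableAt (by simp))

theorem rawPull_congr {k : ℕ} (η : RawForm I' M' k) {g g' : M → M'} {x : M} (h : g =ᶠ[𝓝 x] g') :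
    rawPull (I := I) g η x = rawPull (I := I) g' η x := by
  exact comp_congr (E' := E) η h.self_of_nhds (mfderiv I I' g x : E →L[ℝ] TangentSpace I' (g x))
    (mfderiv I I' g' x : E →L[ℝ] TangentSpace I' (g' x))
    fun v => DFunLike.congr_fun (h.mfderiv_eq (I := I) (I' := I')) v

theorem pull_comp {k : ℕ} (η : Om I'' M'' k) {h : M' → M''} {g : M → M'}
    (hh : ContMDiff I' I'' ∞ h) (hg : ContMDiff I I' ∞ g) (hc : ContMDiff I I'' ∞ (h ∘ g)) :
    pull hc k η = pull hg k (pull hh k η) :=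
  Subtype.ext (rawPull_comp η.1 hh hg)

theorem pull_eq_self {k : ℕ} (η : Om I M k) {g : M → M} (hg : ContMDiff I I ∞ g) (h : g = id) :
    pull hg k η = η := by
  subst h
  exact Subtype.ext (rawPull_id η.1)

theorem chartSymmDiff_chartDiff {x₀ x : M} (hx : x ∈ (extChartAt I x₀).source)
    (v : TangentSpace I x) :
    (show E from chartSymmDiff I x₀ (extChartAt I x₀ x) (chartDiff I x₀ x v)) = v := by
  have : IsManifold I 1 M := IsManifold.of_le (n := ∞) (by simp)
  have h1 := mdiff_symm (I := I) x₀ ((extChartAt I x₀).map_source hx)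
  have h2 : MDifferentiableAt I 𝓘(ℝ, E) (extChartAt I x₀) x :=
    mdifferentiableAt_extChartAt (by rwa [← extChartAt_source I])
  have hA := mfderiv_comp x h1 h2
  have hev : ((extChartAt I x₀).symm ∘ extChartAt I x₀) =ᶠ[𝓝 x] id := by
    filter_upwards [(isOpen_extChartAt_source x₀).mem_nhds hx] with u hu
    exact (extChartAt I x₀).left_inv hu
  have hB := hev.mfderiv_eq (I := I) (I' := I)
  have := (DFunLike.congr_fun hA v).symm.trans (DFunLike.congr_fun hB v)
  rw [mfderiv_id] at this
  exact this

/-- A form is recovered from its expression in the preferred chart. -/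
theorem apply_eq_chartForm {k : ℕ} (η : RawForm I M k) (x : M) (u : Fin k → TangentSpace I x) :
    η x u = chartForm I η x (extChartAt I x x) (fun i => chartDiff I x x (u i)) := by
  have h := comp_congr η (extChartAt_to_inv (I := I) x).symm (ContinuousLinearMap.id ℝ E)
    ((chartSymmDiff I x (extChartAt I x x)).comp (chartDiff I x x : E →L[ℝ] E))
    fun v => (chartSymmDiff_chartDiff (mem_extChartAt_source x) v).symm
  exact DFunLike.congr_fun h u

theorem rawForm_ext {k : ℕ} {η η' : RawForm I M k} (h : ∀ x u, η x u = η' x u) : η = η' :=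
  funext fun x => ContinuousAlternatingMap.ext (h x)

theorem om_ext {k : ℕ} {η η' : Om I M k} (h : ∀ x u, η.1 x u = η'.1 x u) : η = η' :=
  Subtype.ext (rawForm_ext h)

theorem extChartAt_prod_symm_apply (t₀ t : ℝ) (x₀ : M) (y : E) :
    (extChartAt (𝓘(ℝ, ℝ).prod I) ((t₀, x₀) : ℝ × M)).symm (t, y) = (t, (extChartAt I x₀).symm y) := by
  rw [extChartAt_prod]; rfl

theorem mem_extChartAt_prod_target {t₀ t : ℝ} {x₀ : M} {y : E} :
    ((t, y) : ℝ × E) ∈ (extChartAt (𝓘(ℝ, ℝ).prod I) ((t₀, x₀) : ℝ × M)).target ↔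
      y ∈ (extChartAt I x₀).target := by
  rw [extChartAt_prod, extChartAt_model_space_eq_id]; simp

theorem chartSymmDiff_prod (t₀ t : ℝ) (x₀ : M) {y : E} (hy : y ∈ (extChartAt I x₀).target)
    (a : ℝ) (v : E) :
    (show ℝ × E from chartSymmDiff (𝓘(ℝ, ℝ).prod I) ((t₀, x₀) : ℝ × M) (t, y) (a, v)) =
      (a, chartSymmDiff I x₀ y v) := by
  have h0 : ((extChartAt (𝓘(ℝ, ℝ).prod I) ((t₀, x₀) : ℝ × M)).symm : ℝ × E → ℝ × M) =
      fun p => (p.1, (extChartAt I x₀).symm p.2) := by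
    funext p; exact extChartAt_prod_symm_apply t₀ p.1 x₀ p.2
  have h1 : HasMFDerivAt 𝓘(ℝ, ℝ × E) 𝓘(ℝ, ℝ) (fun p : ℝ × E => p.1) (t, y)
      (ContinuousLinearMap.fst ℝ ℝ E) := hasFDerivAt_fst.hasMFDerivAt
  have h2 : HasMFDerivAt 𝓘(ℝ, ℝ × E) 𝓘(ℝ, E) (fun p : ℝ × E => p.2) (t, y)
      (ContinuousLinearMap.snd ℝ ℝ E) := hasFDerivAt_snd.hasMFDerivAt
  have h3 := (mdiff_symm (I := I) x₀ hy).hasMFDerivAt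
  have h4 := h1.prodMk (HasMFDerivAt.comp (t, y) h3 h2)
  have h5 := h4.mfderiv
  rw [chartSymmDiff, h0]
  exact DFunLike.congr_fun h5 ((a, v) : ℝ × E)

theorem chartForm_prod_apply {k : ℕ} (Ω : RawForm (𝓘(ℝ, ℝ).prod I) (ℝ × M) k) (t₀ t : ℝ) (x₀ : M)
    {y : E} (hy : y ∈ (extChartAt I x₀).target) (u : Fin k → ℝ × E) :
    chartForm (𝓘(ℝ, ℝ).prod I) Ω (t₀, x₀) (t, y) u =
      Ω (t, (extChartAt I x₀).symm y)
        (fun i => ((u i).1, chartSymmDiff I x₀ y (u i).2) : Fin k → ℝ × E) := by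
  let C : ℝ × E →L[ℝ] ℝ × E :=
    (ContinuousLinearMap.fst ℝ ℝ E).prod
      ((chartSymmDiff I x₀ y : E →L[ℝ] E).comp (ContinuousLinearMap.snd ℝ ℝ E))
  have h := comp_congr Ω (extChartAt_prod_symm_apply t₀ t x₀ y)
    (chartSymmDiff (𝓘(ℝ, ℝ).prod I) ((t₀, x₀) : ℝ × M) (t, y)) C
    fun v => chartSymmDiff_prod t₀ t x₀ hy v.1 v.2
  exact DFunLike.congr_fun h u

/-- The inclusion of `M` in `ℝ × M` at time `t`. -/
def slice (M : Type*) (t : ℝ) (x : M) : ℝ × M := (t, x)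

variable (I M) in
theorem contMDiff_slice (t : ℝ) : ContMDiff I (𝓘(ℝ, ℝ).prod I) ∞ (slice M t) :=
  contMDiff_const.prodMk contMDiff_id

theorem mfderiv_slice (t : ℝ) (x : M) (v : TangentSpace I x) :
    (show ℝ × E from mfderiv I (𝓘(ℝ, ℝ).prod I) (slice M t) x v) = (0, v) :=
  DFunLike.congr_fun (mfderiv_prod_right (I := 𝓘(ℝ, ℝ)) (I' := I) (x₀ := t) (y₀ := x)) v

theorem pull_slice_apply {k : ℕ} (Ω : Om (𝓘(ℝ, ℝ).prod I) (ℝ × M) k) (t : ℝ) (x : M)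
    (u : Fin k → TangentSpace I x) :
    (pull (contMDiff_slice I M t) k Ω).1 x u =
      Ω.1 (t, x) (fun i => ((0 : ℝ), (show E from u i)) : Fin k → ℝ × E) := by
  change Ω.1 (t, x) (fun i => mfderiv I (𝓘(ℝ, ℝ).prod I) (slice M t) x (u i)) = _
  congr 1
  funext i
  exact mfderiv_slice t x (u i)

theorem chartForm_pull_slice {k : ℕ} (Ω : Om (𝓘(ℝ, ℝ).prod I) (ℝ × M) k) (t₀ t : ℝ) (x₀ : M)
    {y : E} (hy : y ∈ (extChartAt I x₀).target) :
    chartForm I (pull (contMDiff_slice I M t) k Ω).1 x₀ y =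
      (chartForm (𝓘(ℝ, ℝ).prod I) Ω.1 (t₀, x₀) (t, y)).compContinuousLinearMap
        (ContinuousLinearMap.inr ℝ ℝ E) := by
  ext u
  refine (pull_slice_apply Ω t _ _).trans ?_
  rw [ContinuousAlternatingMap.compContinuousLinearMap_apply, chartForm_prod_apply _ _ _ _ hy]
  rfl

theorem IsSmoothForm.contDiffOn_prod {k : ℕ} {Ω : RawForm (𝓘(ℝ, ℝ).prod I) (ℝ × M) k}
    (h : IsSmoothForm (𝓘(ℝ, ℝ).prod I) Ω) (x₀ : M) :
    ContDiffOn ℝ ∞ (chartForm (𝓘(ℝ, ℝ).prod I) Ω (0, x₀)) (univ ×ˢ (extChartAt I x₀).target) :=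
  (h (0, x₀)).mono fun _ hp => mem_extChartAt_prod_target.2 hp.2

theorem chartForm_prod_base {k : ℕ} (Ω : RawForm (𝓘(ℝ, ℝ).prod I) (ℝ × M) k) (t₀ t₁ : ℝ) (x₀ : M)
    {p : ℝ × E} (hy : p.2 ∈ (extChartAt I x₀).target) :
    chartForm (𝓘(ℝ, ℝ).prod I) Ω (t₀, x₀) p = chartForm (𝓘(ℝ, ℝ).prod I) Ω (t₁, x₀) p := by
  obtain ⟨t, y⟩ := p
  ext u
  rw [chartForm_prod_apply _ _ _ _ hy, chartForm_prod_apply _ _ _ _ hy]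

theorem isSmoothForm_prod_iff {k : ℕ} {Ω : RawForm (𝓘(ℝ, ℝ).prod I) (ℝ × M) k} :
    IsSmoothForm (𝓘(ℝ, ℝ).prod I) Ω ↔ ∀ x₀ : M,
      ContDiffOn ℝ ∞ (chartForm (𝓘(ℝ, ℝ).prod I) Ω (0, x₀)) (univ ×ˢ (extChartAt I x₀).target) := by
  refine ⟨fun h x₀ => h.contDiffOn_prod x₀, fun h => ?_⟩
  rintro ⟨t₀, x₀⟩
  refine ((h x₀).congr fun _ hp => chartForm_prod_base Ω t₀ 0 x₀ hp.2).mono fun _ hp => ?_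
  exact ⟨mem_univ _, mem_extChartAt_prod_target.1 hp⟩

/-- The slices of a smooth form on `ℝ × M` are a smooth family. -/
theorem isSmoothFamily_slice {k : ℕ} (Ω : Om (𝓘(ℝ, ℝ).prod I) (ℝ × M) k) :
    IsSmoothFamily fun t => pull (contMDiff_slice I M t) k Ω := by
  intro x₀
  refine ContDiffOn.congr (f := fun p => ContinuousAlternatingMap.compContinuousLinearMapCLM
      (ContinuousLinearMap.inr ℝ ℝ E) (chartForm (𝓘(ℝ, ℝ).prod I) Ω.1 (0, x₀) p)) ?_
    fun p hp => chartForm_pull_slice Ω 0 p.1 x₀ hp.2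
  exact (ContinuousLinearMap.contDiff _).comp_contDiffOn (IsSmoothForm.contDiffOn_prod Ω.2 x₀)

/-- The form on `ℝ × M` whose contraction with `∂/∂t` is zero and whose slices are a given family. -/
noncomputable def rawTotal {k : ℕ} (η : ℝ → Om I M k) : RawForm (𝓘(ℝ, ℝ).prod I) (ℝ × M) k := fun p =>
  ((η p.1).1 p.2).compContinuousLinearMap (ContinuousLinearMap.snd ℝ ℝ E)

theorem isSmoothForm_rawTotal {k : ℕ} {η : ℝ → Om I M k} (hη : IsSmoothFamily η) :
    IsSmoothForm (𝓘(ℝ, ℝ).prod I) (rawTotal η) := by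
  refine isSmoothForm_prod_iff.2 fun x₀ => ?_
  refine ContDiffOn.congr (f := fun p => ContinuousAlternatingMap.compContinuousLinearMapCLM
      (ContinuousLinearMap.snd ℝ ℝ E) (chartForm I (η p.1).1 x₀ p.2)) ?_ fun p hp => ?_
  · exact (ContinuousLinearMap.contDiff _).comp_contDiffOn (hη x₀)
  · obtain ⟨t, y⟩ := p
    ext u
    rw [chartForm_prod_apply _ _ _ _ hp.2]
    rfl

/-- `rawTotal` of a smooth family, as a smooth form. -/
noncomputable def total {k : ℕ} {η : ℝ → Om I M k} (hη : IsSmoothFamily η) :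
    Om (𝓘(ℝ, ℝ).prod I) (ℝ × M) k := ⟨rawTotal η, isSmoothForm_rawTotal hη⟩

theorem pull_slice_total {k : ℕ} {η : ℝ → Om I M k} (hη : IsSmoothFamily η) (t : ℝ) :
    pull (contMDiff_slice I M t) k (total hη) = η t := by
  refine om_ext fun x u => ?_
  rw [pull_slice_apply]
  rfl

/-- Contraction of a form on `ℝ × M` with `∂/∂t`, restricted to time `t`. -/
noncomputable def rawContr {k : ℕ} (Ω : RawForm (𝓘(ℝ, ℝ).prod I) (ℝ × M) (k + 1)) (t : ℝ) :
    RawForm I M k := fun x =>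
  (ContinuousAlternatingMap.curryLeft
      (show (ℝ × E) [⋀^Fin (k + 1)]→L[ℝ] ℝ from Ω (t, x)) ((1 : ℝ), (0 : E))).compContinuousLinearMap
    (ContinuousLinearMap.inr ℝ ℝ E)

theorem rawContr_apply {k : ℕ} (Ω : RawForm (𝓘(ℝ, ℝ).prod I) (ℝ × M) (k + 1)) (t : ℝ) (x : M)
    (u : Fin k → TangentSpace I x) :
    rawContr Ω t x u = Ω (t, x)
      (Fin.cons ((1 : ℝ), (0 : E)) fun i => ((0 : ℝ), (show E from u i)) : Fin (k + 1) → ℝ × E) := rfl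

variable (E) in
/-- Contraction with the first basis vector of `ℝ × E`, followed by restriction to `E`. -/
noncomputable def contrCLM (k : ℕ) : (ℝ × E) [⋀^Fin (k + 1)]→L[ℝ] ℝ →L[ℝ] E [⋀^Fin k]→L[ℝ] ℝ :=
  (ContinuousAlternatingMap.compContinuousLinearMapCLM (ContinuousLinearMap.inr ℝ ℝ E)).comp
    ((ContinuousLinearMap.apply ℝ ((ℝ × E) [⋀^Fin k]→L[ℝ] ℝ) ((1 : ℝ), (0 : E))).comp
      ContinuousAlternatingMap.curryLeftLI.toContinuousLinearMap)

theorem contrCLM_apply (k : ℕ) (θ : (ℝ × E) [⋀^Fin (k + 1)]→L[ℝ] ℝ) (u : Fin k → E) :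
    contrCLM E k θ u =
      θ (Fin.cons ((1 : ℝ), (0 : E)) fun i => ((0 : ℝ), u i) : Fin (k + 1) → ℝ × E) := rfl

theorem chartForm_rawContr {k : ℕ} (Ω : RawForm (𝓘(ℝ, ℝ).prod I) (ℝ × M) (k + 1)) (t₀ t : ℝ) (x₀ : M)
    {y : E} (hy : y ∈ (extChartAt I x₀).target) :
    chartForm I (rawContr Ω t) x₀ y =
      contrCLM E k (chartForm (𝓘(ℝ, ℝ).prod I) Ω (t₀, x₀) (t, y)) := by
  ext u
  rw [contrCLM_apply, chartForm_prod_apply _ _ _ _ hy]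
  refine (rawContr_apply Ω t _ _).trans ?_
  congr 1
  funext i
  refine Fin.cases ?_ (fun j => ?_) i
  · simp only [Fin.cons_zero, map_zero]
    rfl
  · simp only [Fin.cons_succ]
    rfl

theorem isSmoothForm_rawContr {k : ℕ} {Ω : RawForm (𝓘(ℝ, ℝ).prod I) (ℝ × M) (k + 1)}
    (h : IsSmoothForm (𝓘(ℝ, ℝ).prod I) Ω) (t : ℝ) : IsSmoothForm I (rawContr Ω t) := by
  intro x₀
  refine ContDiffOn.congr (f := fun y => contrCLM E k
    (chartForm (𝓘(ℝ, ℝ).prod I) Ω (0, x₀) (t, y))) ?_ fun y hy => chartForm_rawContr Ω 0 t x₀ hy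
  exact (ContinuousLinearMap.contDiff _).comp_contDiffOn ((h.contDiffOn_prod x₀).comp
    (contDiff_prodMk_right t).contDiffOn fun y hy => ⟨mem_univ _, hy⟩)

/-- Contraction of a smooth form on `ℝ × M` with `∂/∂t`, restricted to time `t`. -/
noncomputable def contr {k : ℕ} (t : ℝ) (Ω : Om (𝓘(ℝ, ℝ).prod I) (ℝ × M) (k + 1)) : Om I M k :=
  ⟨rawContr Ω.1 t, isSmoothForm_rawContr Ω.2 t⟩

end ProductForms

end SymplecticDeformation

namespace SymplecticDeformation

section Velocity

variable {E : Type*} [NormedAddCommGroup E] [NormedSpace ℝ E]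
  {H : Type*} [TopologicalSpace H] {I : ModelWithCorners ℝ E H} [I.Boundaryless]
  {M : Type*} [TopologicalSpace M] [ChartedSpace H M] [IsManifold I ∞ M]
  {E' : Type*} [NormedAddCommGroup E'] [NormedSpace ℝ E']
  {H' : Type*} [TopologicalSpace H'] {I' : ModelWithCorners ℝ E' H'} [I'.Boundaryless]
  {N : Type*} [TopologicalSpace N] [ChartedSpace H' N] [IsManifold I' ∞ N]

theorem removeNth_succ_cons {α : Type*} {k : ℕ} (j : Fin (k + 1)) (a : α) (w : Fin (k + 1) → α) :
    j.succ.removeNth (Fin.cons a w : Fin (k + 2) → α) = Fin.cons a (j.removeNth w) := by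
  funext i
  refine Fin.cases ?_ (fun i => ?_) i
  · simp [Fin.removeNth]
  · simp [Fin.removeNth, Fin.succ_succAbove_succ]

/-- Cartan's formula for the vector field `∂/∂t` on `ℝ × E`. -/
theorem hasDerivAt_slice_extDeriv {k : ℕ} {θ : ℝ × E → (ℝ × E) [⋀^Fin (k + 1)]→L[ℝ] ℝ} {t : ℝ}
    {y : E} (hθ : DifferentiableAt ℝ θ (t, y)) (u : Fin (k + 1) → E) :
    HasDerivAt (fun s => θ (s, y) (fun i => ((0 : ℝ), u i)))
      (contrCLM E (k + 1) (extDeriv θ (t, y)) u +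
        extDeriv (fun y' => contrCLM E k (θ (t, y'))) y u) t := by
  have hev : ∀ w : Fin (k + 1) → ℝ × E, DifferentiableAt ℝ (fun p => θ p w) (t, y) := fun w =>
    (ContinuousAlternatingMap.apply ℝ (ℝ × E) ℝ w).differentiableAt.comp _ hθ
  have hc : HasFDerivAt (fun y' : E => (t, y')) (ContinuousLinearMap.inr ℝ ℝ E) y :=
    hasFDerivAt_prodMk_right t y
  have hs : HasDerivAt (fun s : ℝ => (s, y)) ((1 : ℝ), (0 : E)) t :=
    (hasDerivAt_id t).prodMk (hasDerivAt_const t y)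
  have h1 := (hev fun i => ((0 : ℝ), u i)).hasFDerivAt.comp_hasDerivAt t hs
  have hd : DifferentiableAt ℝ (fun y' => contrCLM E k (θ (t, y'))) y :=
    (contrCLM E k).differentiableAt.comp y (hθ.comp y hc.differentiableAt)
  have h2 : ∀ j : Fin (k + 1), fderiv ℝ (fun y' => contrCLM E k (θ (t, y')) (j.removeNth u)) y (u j) =
      fderiv ℝ (fun p => θ p (Fin.cons ((1 : ℝ), (0 : E))
        (j.removeNth fun i => ((0 : ℝ), u i)) : Fin (k + 1) → ℝ × E)) (t, y) (0, u j) := by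
    intro j
    have := (hev (Fin.cons ((1 : ℝ), (0 : E))
        (j.removeNth fun i => ((0 : ℝ), u i)) : Fin (k + 1) → ℝ × E)).hasFDerivAt.comp y hc
    have h3 := DFunLike.congr_fun this.fderiv (u j)
    exact h3
  refine HasDerivAt.congr_deriv h1 (Eq.symm ?_)
  rw [contrCLM_apply, extDeriv_apply hθ, extDeriv_apply hd, Fin.sum_univ_succ]
  simp only [h2, removeNth_succ_cons, Fin.cons_succ, Fin.cons_zero, Fin.val_zero, pow_zero, one_smul,
    Fin.val_succ, pow_succ, mul_neg, mul_one, neg_smul, Finset.sum_neg_distrib, neg_add_cancel_right,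
    Fin.removeNth_zero, Fin.tail_cons]

/-- Cartan's formula for the vector field `∂/∂t` on `ℝ × M`. -/
theorem hasDerivAt_pull_slice {k : ℕ} (Ω : Om (𝓘(ℝ, ℝ).prod I) (ℝ × M) (k + 1)) (t : ℝ) (x : M)
    (u : Fin (k + 1) → TangentSpace I x) :
    HasDerivAt (fun s => (pull (contMDiff_slice I M s) (k + 1) Ω).1 x u)
      ((contr t (d (𝓘(ℝ, ℝ).prod I) (ℝ × M) (k + 1) Ω)).1 x u + (d I M k (contr t Ω)).1 x u) t := by
  have hy := mem_extChartAt_target (I := I) x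
  have hty : (t, extChartAt I x x) ∈ (extChartAt (𝓘(ℝ, ℝ).prod I) ((t, x) : ℝ × M)).target :=
    mem_extChartAt_prod_target.2 hy
  have h := hasDerivAt_slice_extDeriv
    ((IsSmoothForm.contDiffAt Ω.2 hty).differentiableAt (by simp)) fun i => chartDiff I x x (u i)
  have h1 : ∀ s, (pull (contMDiff_slice I M s) (k + 1) Ω).1 x u =
      chartForm (𝓘(ℝ, ℝ).prod I) Ω.1 (t, x) (s, extChartAt I x x)
        (fun i => ((0 : ℝ), chartDiff I x x (u i))) := by
    intro s
    rw [apply_eq_chartForm, chartForm_pull_slice Ω t s x hy]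
    rfl
  have h2 : (contr t (d (𝓘(ℝ, ℝ).prod I) (ℝ × M) (k + 1) Ω)).1 x u =
      contrCLM E (k + 1) (extDeriv (chartForm (𝓘(ℝ, ℝ).prod I) Ω.1 (t, x)) (t, extChartAt I x x))
        fun i => chartDiff I x x (u i) := by
    rw [apply_eq_chartForm, ← chartForm_rawD Ω.2 hty]
    exact DFunLike.congr_fun (chartForm_rawContr _ t t x hy) _
  have h3 : (d I M k (contr t Ω)).1 x u =
      extDeriv (fun y' => contrCLM E k (chartForm (𝓘(ℝ, ℝ).prod I) Ω.1 (t, x) (t, y')))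
        (extChartAt I x x) fun i => chartDiff I x x (u i) := by
    rw [apply_eq_chartForm]
    refine DFunLike.congr_fun ((chartForm_rawD (contr t Ω).2 hy).trans ?_) _
    refine Filter.EventuallyEq.extDeriv_eq ?_
    filter_upwards [(isOpen_extChartAt_target x).mem_nhds hy] with y' hy'
    exact chartForm_rawContr _ t t x hy'
  simp only [h1, h2, h3]
  exact h

theorem contr_total {k : ℕ} {η : ℝ → Om I M (k + 1)} (hη : IsSmoothFamily η) (t : ℝ) :
    contr t (total hη) = 0 := by
  refine om_ext fun x u => ?_
  exact ContinuousAlternatingMap.map_coord_zero (ι := Fin (k + 1)) ((η t).1 x) 0 rfl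

/-- The derivative of a smooth family of forms at `t = 0`. -/
noncomputable def velocity {k : ℕ} {η : ℝ → Om I M (k + 1)} (hη : IsSmoothFamily η) : Om I M (k + 1) :=
  contr 0 (d (𝓘(ℝ, ℝ).prod I) (ℝ × M) (k + 1) (total hη))

theorem isVelocity_slice {k : ℕ} (Ω : Om (𝓘(ℝ, ℝ).prod I) (ℝ × M) (k + 1)) :
    IsVelocity (fun t => pull (contMDiff_slice I M t) (k + 1) Ω)
      (contr 0 (d (𝓘(ℝ, ℝ).prod I) (ℝ × M) (k + 1) Ω) + d I M k (contr 0 Ω)) :=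
  fun x u => hasDerivAt_pull_slice Ω 0 x u

theorem isVelocity_velocity {k : ℕ} {η : ℝ → Om I M (k + 1)} (hη : IsSmoothFamily η) :
    IsVelocity η (velocity hη) := by
  have h := isVelocity_slice (total hη)
  simp only [pull_slice_total, contr_total, map_zero, add_zero] at h
  exact h

/-- A velocity only depends on the restriction of the family to nonnegative times. -/
theorem IsVelocity.unique_of_eqOn {k : ℕ} {η η' : ℝ → Om I M k} {v v' : Om I M k} {ε : ℝ}
    (hε : 0 < ε) (h : IsVelocity η v) (h' : IsVelocity η' v') (he : ∀ t ∈ Icc 0 ε, η t = η' t) :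
    v = v' := by
  refine om_ext fun x u => ?_
  have h1 := (h x u).hasDerivWithinAt (s := Icc 0 ε)
  have h2 := (h' x u).hasDerivWithinAt (s := Icc 0 ε)
  have h3 : HasDerivWithinAt (fun t => (η t).1 x u) (v'.1 x u) (Icc 0 ε) 0 :=
    h2.congr (fun t ht => by rw [he t ht]) (by rw [he 0 ⟨le_rfl, hε.le⟩])
  exact ((uniqueDiffOn_Icc hε) 0 ⟨le_rfl, hε.le⟩).eq_deriv _ h1 h3

theorem IsVelocity.unique {k : ℕ} {η : ℝ → Om I M k} {v v' : Om I M k}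
    (h : IsVelocity η v) (h' : IsVelocity η v') : v = v' :=
  h.unique_of_eqOn one_pos h' fun _ _ => rfl

theorem IsVelocity.eq_zero_of_const {k : ℕ} {η : ℝ → Om I M k} {v c : Om I M k} {ε : ℝ}
    (hε : 0 < ε) (h : IsVelocity η v) (he : ∀ t ∈ Icc 0 ε, η t = c) : v = 0 :=
  h.unique_of_eqOn (η' := fun _ => c) hε (fun _ _ => hasDerivAt_const _ _) he

theorem isVelocity_affine {k : ℕ} (a v : Om I M k) : IsVelocity (fun t : ℝ => a + t • v) v := by
  intro x u
  have h := ((hasDerivAt_id (0 : ℝ)).mul_const (v.1 x u)).const_add (a.1 x u)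
  rw [one_mul] at h
  exact h

theorem isVelocity_smul {k : ℕ} (v : Om I M k) : IsVelocity (fun t : ℝ => t • v) v := by
  have h := isVelocity_affine 0 v
  simpa only [zero_add] using h

theorem isSmoothFamily_const {k : ℕ} (a : Om I M k) : IsSmoothFamily fun _ : ℝ => a :=
  fun x₀ => (a.2 x₀).comp contDiff_snd.contDiffOn fun _ hp => hp.2

theorem isSmoothFamily_affine {k : ℕ} (a v : Om I M k) : IsSmoothFamily fun t : ℝ => a + t • v :=
  fun x₀ => (isSmoothFamily_const a x₀).add
    ((contDiff_fst.contDiffOn).smul (isSmoothFamily_const v x₀))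

theorem isSmoothFamily_smul {k : ℕ} (v : Om I M k) : IsSmoothFamily fun t : ℝ => t • v :=
  fun x₀ => (contDiff_fst.contDiffOn).smul (isSmoothFamily_const v x₀)

theorem IsVelocity.pull {k : ℕ} {η : ℝ → Om I M k} {v : Om I M k} (h : IsVelocity η v) {g : N → M}
    (hg : ContMDiff I' I ∞ g) :
    IsVelocity (fun t => SymplecticDeformation.pull hg k (η t)) (SymplecticDeformation.pull hg k v) :=
  fun x u => h (g x) fun i => mfderiv I' I g x (u i)

theorem IsVelocity.d {k : ℕ} {η : ℝ → Om I M (k + 1)} (hη : IsSmoothFamily η) {v : Om I M (k + 1)}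
    (h : IsVelocity η v) :
    IsVelocity (fun t => SymplecticDeformation.d I M (k + 1) (η t))
      (SymplecticDeformation.d I M (k + 1) v) := by
  have h1 := isVelocity_slice (SymplecticDeformation.d (𝓘(ℝ, ℝ).prod I) (ℝ × M) (k + 1) (total hη))
  have h2 : contr 0 (0 : Om (𝓘(ℝ, ℝ).prod I) (ℝ × M) (k + 1 + 1 + 1)) = 0 := om_ext fun x u => rfl
  simp only [pull_d, pull_slice_total, d_d, h2, zero_add] at h1
  rw [h.unique (isVelocity_velocity hη)]
  exact h1

/-- The map `(t, x) ↦ (t, φ(t, x))`. -/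
def timeMap (φ : ℝ × N → M) (p : ℝ × N) : ℝ × M := (p.1, φ p)

theorem contMDiff_timeMap {φ : ℝ × N → M} (hφ : ContMDiff (𝓘(ℝ, ℝ).prod I') I ∞ φ) :
    ContMDiff (𝓘(ℝ, ℝ).prod I') (𝓘(ℝ, ℝ).prod I) ∞ (timeMap φ) :=
  contMDiff_fst.prodMk hφ

theorem contMDiff_at_time {φ : ℝ × N → M} (hφ : ContMDiff (𝓘(ℝ, ℝ).prod I') I ∞ φ) (t : ℝ) :
    ContMDiff I' I ∞ fun x => φ (t, x) :=
  hφ.comp (contMDiff_slice I' N t)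

theorem mfderiv_timeMap {φ : ℝ × N → M} {p : ℝ × N}
    (hφ : MDifferentiableAt (𝓘(ℝ, ℝ).prod I') I φ p) (v : ℝ × E') :
    (show ℝ × E from mfderiv (𝓘(ℝ, ℝ).prod I') (𝓘(ℝ, ℝ).prod I) (timeMap φ) p v) =
      (v.1, mfderiv (𝓘(ℝ, ℝ).prod I') I φ p v) := by
  have h1 : HasMFDerivAt (𝓘(ℝ, ℝ).prod I') 𝓘(ℝ, ℝ) (fun p : ℝ × N => p.1) p
      (ContinuousLinearMap.fst ℝ ℝ E') := hasMFDerivAt_fst p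
  exact DFunLike.congr_fun (h1.prodMk hφ.hasMFDerivAt).mfderiv v

theorem mfderiv_at_time {φ : ℝ × N → M} {t : ℝ} {x : N}
    (hφ : MDifferentiableAt (𝓘(ℝ, ℝ).prod I') I φ (t, x)) (v : TangentSpace I' x) :
    mfderiv I' I (fun x => φ (t, x)) x v =
      mfderiv (𝓘(ℝ, ℝ).prod I') I φ (t, x) (((0 : ℝ), v) : ℝ × E') := by
  have h := mfderiv_comp x (g := φ) (f := slice N t) hφ
    ((contMDiff_slice I' N t x).mdifferentiableAt (by simp))
  refine (DFunLike.congr_fun h v).trans ?_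
  exact congrArg (mfderiv (𝓘(ℝ, ℝ).prod I') I φ (t, x)) (mfderiv_slice t x v)

theorem pull_slice_pull_timeMap {k : ℕ} {φ : ℝ × N → M} (hφ : ContMDiff (𝓘(ℝ, ℝ).prod I') I ∞ φ)
    {η : ℝ → Om I M k} (hη : IsSmoothFamily η) (t : ℝ) :
    pull (contMDiff_slice I' N t) k (pull (contMDiff_timeMap hφ) k (total hη)) =
      pull (contMDiff_at_time hφ t) k (η t) := by
  rw [← pull_slice_total hη t,
    ← pull_comp _ (contMDiff_timeMap hφ) (contMDiff_slice I' N t)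
      ((contMDiff_timeMap hφ).comp (contMDiff_slice I' N t)),
    ← pull_comp _ (contMDiff_slice I M t) (contMDiff_at_time hφ t)
      ((contMDiff_slice I M t).comp (contMDiff_at_time hφ t))]
  rfl

theorem IsSmoothFamily.pull_time {k : ℕ} {φ : ℝ × N → M} (hφ : ContMDiff (𝓘(ℝ, ℝ).prod I') I ∞ φ)
    {η : ℝ → Om I M k} (hη : IsSmoothFamily η) :
    IsSmoothFamily fun t => pull (contMDiff_at_time hφ t) k (η t) := by
  have h := isSmoothFamily_slice (pull (contMDiff_timeMap hφ) k (total hη))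
  simpa only [pull_slice_pull_timeMap hφ hη] using h

theorem contr_pull_timeMap {k : ℕ} {φ : ℝ × N → M} (hφ : ContMDiff (𝓘(ℝ, ℝ).prod I') I ∞ φ)
    (Ω : Om (𝓘(ℝ, ℝ).prod I) (ℝ × M) (k + 1)) (t : ℝ) :
    contr t (pull (contMDiff_timeMap hφ) (k + 1) Ω) =
      pull (contMDiff_at_time hφ t) k (contr t Ω) +
        contr t (pull hφ (k + 1) (pull (contMDiff_slice I M t) (k + 1) Ω)) := by
  refine om_ext fun x u => ?_
  have hd := (hφ (t, x)).mdifferentiableAt (by simp)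
  let Z : E := mfderiv (𝓘(ℝ, ℝ).prod I') I φ (t, x) (((1 : ℝ), (0 : E')) : ℝ × E')
  let w : Fin k → E := fun i => mfderiv (𝓘(ℝ, ℝ).prod I') I φ (t, x) (((0 : ℝ), u i) : ℝ × E')
  let θ : (ℝ × E) [⋀^Fin (k + 1)]→L[ℝ] ℝ := Ω.1 (t, φ (t, x))
  have h1 : (contr t (pull (contMDiff_timeMap hφ) (k + 1) Ω)).1 x u =
      θ (Fin.cons ((1 : ℝ), Z) fun i => ((0 : ℝ), w i)) := by
    refine congrArg θ (funext fun i => ?_)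
    refine Fin.cases ?_ (fun j => ?_) i
    · exact mfderiv_timeMap hd _
    · exact mfderiv_timeMap hd _
  have h2 : (pull (contMDiff_at_time hφ t) k (contr t Ω)).1 x u =
      θ (Fin.cons ((1 : ℝ), (0 : E)) fun i => ((0 : ℝ), w i)) := by
    refine congrArg θ (funext fun i => ?_)
    refine Fin.cases rfl (fun j => ?_) i
    exact Prod.ext rfl (mfderiv_at_time hd _)
  have h3 : (contr t (pull hφ (k + 1) (pull (contMDiff_slice I M t) (k + 1) Ω))).1 x u =
      θ (Fin.cons ((0 : ℝ), Z) fun i => ((0 : ℝ), w i)) := by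
    refine congrArg θ (funext fun i => ?_)
    refine Fin.cases ?_ (fun j => ?_) i
    · exact mfderiv_slice t _ _
    · exact mfderiv_slice t _ _
  change _ = (pull (contMDiff_at_time hφ t) k (contr t Ω)).1 x u +
    (contr t (pull hφ (k + 1) (pull (contMDiff_slice I M t) (k + 1) Ω))).1 x u
  rw [h1, h2, h3, ← ContinuousAlternatingMap.cons_add]
  simp

/-- The derivative of `φ_t^* η_t` at `t = 0` if `η_0` is closed. -/
theorem IsVelocity.pull_time {k : ℕ} {φ : ℝ × N → M} (hφ : ContMDiff (𝓘(ℝ, ℝ).prod I') I ∞ φ)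
    {η : ℝ → Om I M (k + 1)} (hη : IsSmoothFamily η) {v : Om I M (k + 1)} (hv : IsVelocity η v)
    (hd : SymplecticDeformation.d I M (k + 1) (η 0) = 0) :
    IsVelocity (fun t => SymplecticDeformation.pull (contMDiff_at_time hφ t) (k + 1) (η t))
      (SymplecticDeformation.pull (contMDiff_at_time hφ 0) (k + 1) v +
        SymplecticDeformation.d I' N k
          (contr 0 (SymplecticDeformation.pull hφ (k + 1) (η 0)))) := by
  have h := isVelocity_slice (SymplecticDeformation.pull (contMDiff_timeMap hφ) (k + 1) (total hη))
  have h0 : contr 0 (0 : Om (𝓘(ℝ, ℝ).prod I') (ℝ × N) (k + 1 + 1)) = 0 := om_ext fun x u => rfl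
  rw [← pull_d, contr_pull_timeMap hφ, contr_pull_timeMap hφ, pull_d, pull_slice_total, hd, contr_total,
    map_zero, map_zero, zero_add, h0, add_zero] at h
  simp only [pull_slice_pull_timeMap hφ hη] at h
  rw [hv.unique (isVelocity_velocity hη)]
  exact h

end Velocity

end SymplecticDeformation

namespace SymplecticDeformation

section Nemytskii

universe u

variable {K : Type*} [TopologicalSpace K] [CompactSpace K]
  {E F : Type u} [NormedAddCommGroup E] [NormedSpace ℝ E] [NormedAddCommGroup F] [NormedSpace ℝ F]

/-- Postcomposition with a continuous map. -/
def postcomp (K : Type*) [TopologicalSpace K] {v : E → F} (hv : Continuous v) (w : C(K, E)) : C(K, F) :=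
  ⟨fun s => v (w s), hv.comp w.continuous⟩

/-- Pointwise application of continuous functions of operators to continuous functions of vectors. -/
noncomputable def pointwiseApply (K : Type*) [TopologicalSpace K] [CompactSpace K] (E F : Type*)
    [NormedAddCommGroup E] [NormedSpace ℝ E] [NormedAddCommGroup F] [NormedSpace ℝ F] :
    C(K, E →L[ℝ] F) →L[ℝ] C(K, E) →L[ℝ] C(K, F) :=
  LinearMap.mkContinuous₂
    (LinearMap.mk₂ ℝ (fun (A : C(K, E →L[ℝ] F)) (w : C(K, E)) =>
        (⟨fun s => A s (w s), A.continuous.clm_apply w.continuous⟩ : C(K, F)))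
      (fun _ _ _ => rfl) (fun _ _ _ => rfl) (fun A w w' => by ext; simp) (fun c A w => by ext; simp))
    1 fun A w => by
      rw [one_mul]
      refine (ContinuousMap.norm_le _ (by positivity)).2 fun s => ?_
      exact ((A s).le_opNorm _).trans
        (mul_le_mul (A.norm_coe_le_norm s) (w.norm_coe_le_norm s) (norm_nonneg _) (norm_nonneg A))

theorem hasFDerivAt_postcomp {v : E → F} (hv : ContDiff ℝ 1 v) (w : C(K, E)) :
    HasFDerivAt (postcomp K hv.continuous)
      (pointwiseApply K E F (postcomp K (hv.continuous_fderiv one_ne_zero) w)) w := by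
  rw [hasFDerivAt_iff_isLittleO_nhds_zero, Asymptotics.isLittleO_iff]
  intro c hc
  have hK : IsCompact (range w) := isCompact_range w.continuous
  have h1 := hK.uniformContinuousAt_of_continuousAt (fderiv ℝ v)
    (fun x _ => (hv.continuous_fderiv one_ne_zero).continuousAt) (Metric.dist_mem_uniformity hc)
  obtain ⟨δ, hδ, h2⟩ := Metric.mem_uniformity_dist.1 h1
  filter_upwards [Metric.ball_mem_nhds (0 : C(K, E)) hδ] with h hh
  rw [mem_ball_zero_iff] at hh
  refine (ContinuousMap.norm_le _ (by positivity)).2 fun s => ?_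
  have h3 : ‖v (w s + h s) - v (w s) - fderiv ℝ v (w s) (w s + h s - w s)‖ ≤
      c * ‖w s + h s - w s‖ := by
    refine (convex_ball (w s) δ).norm_image_sub_le_of_norm_fderiv_le' (𝕜 := ℝ)
      (fun x _ => (hv.differentiable one_ne_zero) x) (fun x hx => ?_) (Metric.mem_ball_self hδ) ?_
    · have := h2 (a := w s) (b := x) (by rwa [dist_comm]) ⟨s, rfl⟩
      rw [← dist_eq_norm, dist_comm]
      exact le_of_lt this
    · rw [Metric.mem_ball, dist_eq_norm, add_sub_cancel_left]
      exact (h.norm_coe_le_norm s).trans_lt hh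
  rw [add_sub_cancel_left] at h3
  exact h3.trans (mul_le_mul_of_nonneg_left (h.norm_coe_le_norm s) hc.le)

theorem contDiff_postcomp_nat (n : ℕ) : ∀ {F : Type u} [NormedAddCommGroup F] [NormedSpace ℝ F]
    {v : E → F} (hv : ContDiff ℝ ∞ v), ContDiff ℝ n (postcomp K hv.continuous) := by
  induction n with
  | zero =>
    intro F _ _ v hv
    have h1 : ContDiff ℝ 1 v := hv.of_le (by exact_mod_cast le_top)
    refine contDiff_zero.2 (continuous_iff_continuousAt.2 fun w => ?_)
    exact (hasFDerivAt_postcomp h1 w).continuousAt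
  | succ n ih =>
    intro F _ _ v hv
    have h1 : ContDiff ℝ 1 v := hv.of_le (by exact_mod_cast le_top)
    have h2 : ContDiff ℝ ∞ (fderiv ℝ v) := hv.fderiv_right (m := ∞) (by simp)
    refine contDiff_succ_iff_hasFDerivAt.2 ⟨_, ?_, fun w => hasFDerivAt_postcomp h1 w⟩
    exact (pointwiseApply K E F).contDiff.comp (ih h2)

theorem contDiff_postcomp {v : E → F} (hv : ContDiff ℝ ∞ v) :
    ContDiff ℝ ∞ (postcomp K hv.continuous) :=
  contDiff_infty.2 fun n => contDiff_postcomp_nat n hv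

end Nemytskii

section LocalFlow

universe u

variable {E : Type u} [NormedAddCommGroup E] [NormedSpace ℝ E] [CompleteSpace E]

/-- The interval on which local integral curves are constructed. -/
abbrev flowIcc : Set ℝ := Icc (-2 : ℝ) 2

theorem flowIcc_le : (-2 : ℝ) ≤ 2 := by norm_num

/-- Extension of a function on the interval to a function on the real line. -/
noncomputable def extendIcc (w : C(flowIcc, E)) (s : ℝ) : E := w (projIcc (-2) 2 flowIcc_le s)

theorem continuous_extendIcc (w : C(flowIcc, E)) : Continuous (extendIcc w) :=
  w.continuous.comp continuous_projIcc

theorem norm_extendIcc_le (w : C(flowIcc, E)) (s : ℝ) : ‖extendIcc w s‖ ≤ ‖w‖ := w.norm_coe_le_norm _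

/-- The primitive that vanishes at `0`. -/
noncomputable def primitiveIcc : C(flowIcc, E) →L[ℝ] C(flowIcc, E) :=
  LinearMap.mkContinuous
    { toFun := fun w => ⟨fun s => ∫ τ in (0 : ℝ)..s, extendIcc w τ,
        (intervalIntegral.continuous_primitive
          (fun a b => (continuous_extendIcc w).intervalIntegrable a b) 0).comp continuous_subtype_val⟩
      map_add' := fun w w' => by
        ext s
        exact intervalIntegral.integral_add ((continuous_extendIcc w).intervalIntegrable _ _)
          ((continuous_extendIcc w').intervalIntegrable _ _)
      map_smul' := fun c w => by
        ext s
        exact intervalIntegral.integral_smul c _ } 2 fun w => by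
      refine (ContinuousMap.norm_le _ (by positivity)).2 fun s => ?_
      refine (intervalIntegral.norm_integral_le_of_norm_le_const
        fun τ _ => norm_extendIcc_le w τ).trans ?_
      rw [mul_comm, sub_zero]
      exact mul_le_mul_of_nonneg_right (abs_le.2 s.2) (norm_nonneg _)

/-- Constant functions on the interval. -/
noncomputable def constIcc : E →L[ℝ] C(flowIcc, E) :=
  LinearMap.mkContinuous
    { toFun := fun y => ContinuousMap.const _ y
      map_add' := fun _ _ => rfl
      map_smul' := fun _ _ => rfl } 1 fun y => by
      refine (ContinuousMap.norm_le _ (by positivity)).2 fun s => ?_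
      rw [one_mul]
      exact le_rfl

/-- The map whose local inverse yields the solutions of `w' = h v(w)`, `w 0 = y`. -/
noncomputable def flowMap {v : E → E} (hv : Continuous v) (p : ℝ × E × C(flowIcc, E)) :
    ℝ × E × C(flowIcc, E) :=
  (p.1, p.2.1, p.2.2 - constIcc p.2.1 - p.1 • primitiveIcc (postcomp flowIcc hv p.2.2))

theorem contDiff_flowMap {v : E → E} (hv : ContDiff ℝ ∞ v) : ContDiff ℝ ∞ (flowMap hv.continuous) := by
  have h1 : ContDiff ℝ ∞ fun p : ℝ × E × C(flowIcc, E) => p.2.2 := contDiff_snd.comp contDiff_snd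
  have h2 : ContDiff ℝ ∞ fun p : ℝ × E × C(flowIcc, E) => p.2.1 := contDiff_fst.comp contDiff_snd
  exact contDiff_fst.prodMk (h2.prodMk ((h1.sub ((constIcc (E := E)).contDiff.comp h2)).sub
    (contDiff_fst.smul ((primitiveIcc (E := E)).contDiff.comp ((contDiff_postcomp hv).comp h1)))))

/-- The shear transformation `(h, y, w) ↦ (h, y, w + const y + h c)`. -/
noncomputable def shear (a : ℝ) (c : C(flowIcc, E)) :
    (ℝ × E × C(flowIcc, E)) →L[ℝ] (ℝ × E × C(flowIcc, E)) :=
  (ContinuousLinearMap.fst ℝ ℝ _).prod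
    (((ContinuousLinearMap.fst ℝ E _).comp (ContinuousLinearMap.snd ℝ ℝ _)).prod
      ((ContinuousLinearMap.snd ℝ E _).comp (ContinuousLinearMap.snd ℝ ℝ _) +
        a • (constIcc.comp ((ContinuousLinearMap.fst ℝ E _).comp (ContinuousLinearMap.snd ℝ ℝ _)) +
          (ContinuousLinearMap.fst ℝ ℝ _).smulRight c)))

theorem shear_apply (a : ℝ) (c : C(flowIcc, E)) (p : ℝ × E × C(flowIcc, E)) :
    shear a c p = (p.1, p.2.1, p.2.2 + a • (constIcc p.2.1 + p.1 • c)) := rfl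

/-- The derivative of `flowMap` at the constant solutions. -/
noncomputable def shearEquiv (c : C(flowIcc, E)) :
    (ℝ × E × C(flowIcc, E)) ≃L[ℝ] (ℝ × E × C(flowIcc, E)) :=
  ContinuousLinearEquiv.equivOfInverse (shear (-1) c) (shear 1 c)
    (fun p => Prod.ext rfl (Prod.ext rfl (by simp [shear_apply]; abel)))
    (fun p => Prod.ext rfl (Prod.ext rfl (by simp [shear_apply]; abel)))

theorem hasFDerivAt_flowMap {v : E → E} (hv : ContDiff ℝ ∞ v) (y₀ : E) :
    HasFDerivAt (flowMap hv.continuous)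
      (shearEquiv (primitiveIcc (postcomp flowIcc hv.continuous (constIcc y₀))) :
        (ℝ × E × C(flowIcc, E)) →L[ℝ] (ℝ × E × C(flowIcc, E))) (0, y₀, constIcc y₀) := by
  have h1 : HasFDerivAt (fun p : ℝ × E × C(flowIcc, E) => p.2.2)
    ((ContinuousLinearMap.snd ℝ E C(flowIcc, E)).comp (ContinuousLinearMap.snd ℝ ℝ _)) (0, y₀, constIcc y₀) :=
    ((ContinuousLinearMap.snd ℝ E C(flowIcc, E)).comp (ContinuousLinearMap.snd ℝ ℝ _)).hasFDerivAt
  have h2 : HasFDerivAt (fun p : ℝ × E × C(flowIcc, E) => p.2.1)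
    ((ContinuousLinearMap.fst ℝ E C(flowIcc, E)).comp (ContinuousLinearMap.snd ℝ ℝ _))
      (0, y₀, constIcc y₀) :=
    ((ContinuousLinearMap.fst ℝ E C(flowIcc, E)).comp (ContinuousLinearMap.snd ℝ ℝ _)).hasFDerivAt
  have h3 : HasFDerivAt (fun p : ℝ × E × C(flowIcc, E) => p.1)
    (ContinuousLinearMap.fst ℝ ℝ _) (0, y₀, constIcc y₀) := hasFDerivAt_fst
  have h4 : DifferentiableAt ℝ (fun p : ℝ × E × C(flowIcc, E) =>
      primitiveIcc (postcomp flowIcc hv.continuous p.2.2)) (0, y₀, constIcc y₀) :=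
    ((primitiveIcc.contDiff.comp ((contDiff_postcomp hv).comp
      (contDiff_snd.comp contDiff_snd))).differentiable (by simp)) _
  have h5 := h3.prodMk (h2.prodMk ((h1.sub (constIcc.hasFDerivAt.comp _ h2)).sub
    (h3.smul h4.hasFDerivAt)))
  refine h5.congr_fderiv ?_
  refine ContinuousLinearMap.ext fun p => ?_
  refine Prod.ext rfl (Prod.ext rfl ?_)
  simp [shearEquiv, shear_apply, sub_eq_add_neg, add_assoc]

theorem hasDerivAt_of_flowMap_eq {v : E → E} (hv : Continuous v) {h : ℝ} {y : E} {w : C(flowIcc, E)}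
    (he : flowMap hv (h, y, w) = (h, y, 0)) :
    extendIcc w 0 = y ∧
      ∀ s ∈ Ioo (-2 : ℝ) 2, HasDerivAt (extendIcc w) (h • v (extendIcc w s)) s := by
  have h1 : w - constIcc y - h • primitiveIcc (postcomp flowIcc hv w) = 0 :=
    congrArg (fun p => p.2.2) he
  have h2 : ∀ s ∈ flowIcc, extendIcc w s = y + h • ∫ τ in (0 : ℝ)..s, v (extendIcc w τ) := by
    intro s hs
    have h3 : w ⟨s, hs⟩ - y - h • (∫ τ in (0 : ℝ)..s, v (extendIcc w τ)) = 0 :=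
      DFunLike.congr_fun h1 ⟨s, hs⟩
    rw [extendIcc, projIcc_of_mem _ hs, ← sub_eq_zero, ← h3]
    abel
  refine ⟨?_, fun s hs => ?_⟩
  · rw [h2 0 (by norm_num [flowIcc])]
    simp
  · have hc : Continuous fun τ => v (extendIcc w τ) := hv.comp (continuous_extendIcc w)
    have h4 := ((intervalIntegral.integral_hasDerivAt_right (hc.intervalIntegrable 0 s)
      (hc.stronglyMeasurableAtFilter _ _) hc.continuousAt).const_smul h).const_add y
    refine h4.congr_of_eventuallyEq ?_
    filter_upwards [Icc_mem_nhds hs.1 hs.2] with s' hs'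
    exact h2 s' hs'

/-- Local integral curves of a smooth vector field depend smoothly on time and the initial value. -/
theorem exists_smooth_local_flow {v : E → E} (hv : ContDiff ℝ ∞ v) (y₀ : E) :
    ∃ γ : ℝ × E → ℝ → E, ContDiffAt ℝ ∞ (fun p => γ p 1) (0, y₀) ∧
      ∀ W ∈ 𝓝 y₀, ∀ᶠ p in 𝓝 ((0 : ℝ), y₀), γ p 0 = p.2 ∧
        ∀ s ∈ Ioo (-2 : ℝ) 2, HasDerivAt (γ p) (p.1 • v (γ p s)) s ∧ γ p s ∈ W := by
  let a : ℝ × E × C(flowIcc, E) := (0, y₀, constIcc y₀)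
  have ha : flowMap hv.continuous a = (0, y₀, 0) := by
    simp [flowMap, a]
  have hf : ContDiffAt ℝ ∞ (flowMap hv.continuous) a := (contDiff_flowMap hv).contDiffAt
  have hf' := hasFDerivAt_flowMap hv y₀
  have hs := hf.hasStrictFDerivAt' hf' (by simp)
  let g := hf.localInverse hf' (by simp)
  have hg : ContDiffAt ℝ ∞ g (flowMap hv.continuous a) := hf.to_localInverse hf' (by simp)
  have hga : g (flowMap hv.continuous a) = a := hf.localInverse_apply_image hf' (by simp)
  have hr : ∀ᶠ z in 𝓝 (flowMap hv.continuous a), flowMap hv.continuous (g z) = z :=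
    hs.eventually_right_inverse
  rw [ha] at hg hr hga
  let j : ℝ × E → ℝ × E × C(flowIcc, E) := fun p => (p.1, p.2, 0)
  have hj : ContDiff ℝ ∞ j := contDiff_fst.prodMk (contDiff_snd.prodMk contDiff_const)
  have hw : ContDiffAt ℝ ∞ (fun p => (g (j p)).2.2) (0, y₀) :=
    (contDiff_snd.comp contDiff_snd).contDiffAt.comp _ (ContDiffAt.comp (0, y₀) hg hj.contDiffAt)
  refine ⟨fun p => extendIcc (g (j p)).2.2, ?_, fun W hW => ?_⟩
  · let ev : C(flowIcc, E) →L[ℝ] E := ContinuousMap.evalCLM ℝ (projIcc (-2) 2 flowIcc_le 1)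
    exact ev.contDiff.contDiffAt.comp _ hw
  · obtain ⟨δ, hδ, hW⟩ := Metric.mem_nhds_iff.1 hW
    have hjc : Tendsto j (𝓝 (0, y₀)) (𝓝 (0, y₀, 0)) := hj.continuous.tendsto _
    have hwc : ∀ᶠ p in 𝓝 ((0 : ℝ), y₀), (g (j p)).2.2 ∈ Metric.ball (constIcc y₀) δ := by
      refine hw.continuousAt.eventually (Metric.isOpen_ball.mem_nhds ?_)
      change (g (0, y₀, 0)).2.2 ∈ _
      rw [hga]
      exact Metric.mem_ball_self hδ
    filter_upwards [hjc.eventually hr, hwc] with p hp hpw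
    have e1 : (g (j p)).1 = p.1 := congrArg (fun z => z.1) hp
    have e2 : (g (j p)).2.1 = p.2 := congrArg (fun z => z.2.1) hp
    have e3 : flowMap hv.continuous (p.1, p.2, (g (j p)).2.2) = (p.1, p.2, 0) := by
      rw [show (p.1, p.2, (g (j p)).2.2) = g (j p) from Prod.ext e1.symm (Prod.ext e2.symm rfl)]
      exact hp
    obtain ⟨h0, h1⟩ := hasDerivAt_of_flowMap_eq hv.continuous e3
    refine ⟨h0, fun s hs => ⟨h1 s hs, hW ?_⟩⟩
    rw [Metric.mem_ball] at hpw ⊢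
    exact (ContinuousMap.dist_apply_le_dist (projIcc (-2) 2 flowIcc_le s)).trans_lt hpw

end LocalFlow

end SymplecticDeformation

namespace SymplecticDeformation

section Flow

variable {E : Type*} [NormedAddCommGroup E] [NormedSpace ℝ E] 
  {H : Type*} [TopologicalSpace H] {I : ModelWithCorners ℝ E H} [I.Boundaryless]
  {N : Type*} [TopologicalSpace N] [ChartedSpace H N] [IsManifold I ∞ N]
  {E' : Type*} [NormedAddCommGroup E'] [NormedSpace ℝ E']
  {H' : Type*} [TopologicalSpace H'] {I' : ModelWithCorners ℝ E' H'}
  {P : Type*} [TopologicalSpace P] [ChartedSpace H' P]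

variable (I) in
/-- A vector field is smooth. -/
def IsSmoothField (V : (x : N) → TangentSpace I x) : Prop :=
  ContMDiff I I.tangent ∞ fun x => (⟨x, V x⟩ : TangentBundle I N)

theorem trivializationAt_tangent_snd {x₀ x : N} (hx : x ∈ (extChartAt I x₀).source)
    (v : TangentSpace I x) :
    (trivializationAt E (TangentSpace I) x₀ (⟨x, v⟩ : TangentBundle I N)).2 = chartDiff I x₀ x v := by
  rw [extChartAt_source] at hx
  have h := TangentBundle.continuousLinearMapAt_trivializationAt (I := I) hx
  have h1 := DFunLike.congr_fun h v
  rw [Bundle.Trivialization.continuousLinearMapAt_apply, Bundle.Trivialization.linearMapAt_apply,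
    if_pos (by simpa using hx)] at h1
  exact h1

/-- A vector field along a map is smooth if it is so in charts. -/
theorem contMDiffAt_tangentBundle_iff {n : WithTop ℕ∞} {f : P → N} {X : (p : P) → TangentSpace I (f p)}
    {p₀ : P} :
    ContMDiffAt I' I.tangent n (fun p => (⟨f p, X p⟩ : TangentBundle I N)) p₀ ↔
      ContMDiffAt I' I n f p₀ ∧
        ContMDiffAt I' 𝓘(ℝ, E) n (fun p => (chartDiff I (f p₀) (f p) (X p) : E)) p₀ := by
  rw [Bundle.contMDiffAt_totalSpace]
  refine and_congr_right fun hf => ?_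
  refine Filter.EventuallyEq.contMDiffAt_iff ?_
  filter_upwards [hf.continuousAt.eventually (extChartAt_source_mem_nhds (I := I) (f p₀))] with p hp
  exact trivializationAt_tangent_snd hp _

/-- The expression of a vector field in the preferred chart around `x₀`. -/
noncomputable def chartField (V : (x : N) → TangentSpace I x) (x₀ : N) (y : E) : E :=
  chartDiff I x₀ ((extChartAt I x₀).symm y) (V ((extChartAt I x₀).symm y))

theorem IsSmoothField.contDiffAt_chartField {V : (x : N) → TangentSpace I x} (hV : IsSmoothField I V)
    (x₀ : N) {y : E} (hy : y ∈ (extChartAt I x₀).target) : ContDiffAt ℝ ∞ (chartField V x₀) y := by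
  have hx : (extChartAt I x₀).symm y ∈ (extChartAt I x₀).source := (extChartAt I x₀).map_target hy
  have h1 := ((trivializationAt E (TangentSpace I) x₀).contMDiffAt_section_iff
    (by simpa using hx)).1 (hV ((extChartAt I x₀).symm y))
  have h2 : ContMDiffAt 𝓘(ℝ, E) I ∞ (extChartAt I x₀).symm y :=
    (contMDiffOn_extChartAt_symm x₀).contMDiffAt ((isOpen_extChartAt_target x₀).mem_nhds hy)
  have h3 := (ContMDiffAt.comp y h1 h2).contDiffAt
  refine h3.congr_of_eventuallyEq ?_
  filter_upwards [(isOpen_extChartAt_target x₀).mem_nhds hy] with z hz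
  exact (trivializationAt_tangent_snd ((extChartAt I x₀).map_target hz) _).symm

theorem isMIntegralCurveOn_of_chart {V : (x : N) → TangentSpace I x} {x₀ : N} {c : ℝ → E} {h : ℝ}
    {s : Set ℝ} (ht : ∀ t ∈ s, c t ∈ (extChartAt I x₀).target)
    (hc : ∀ t ∈ s, HasDerivAt c (h • chartField V x₀ (c t)) t) :
    IsMIntegralCurveOn (fun t => (extChartAt I x₀).symm (c t)) (h • V) s := by
  intro t hts
  have h1 := (mdiff_symm (I := I) x₀ (ht t hts)).hasMFDerivAt
  have h2 := HasMFDerivAt.comp t h1 (hc t hts).hasFDerivAt.hasMFDerivAt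
  refine (h2.congr_mfderiv (ContinuousLinearMap.ext fun a => ?_)).hasMFDerivWithinAt
  have h3 := chartSymmDiff_chartDiff ((extChartAt I x₀).map_target (ht t hts))
    (V ((extChartAt I x₀).symm (c t)))
  rw [(extChartAt I x₀).right_inv (ht t hts)] at h3
  let A : E →L[ℝ] E := chartSymmDiff I x₀ (c t)
  have h4 : A (chartField V x₀ (c t)) = V ((extChartAt I x₀).symm (c t)) := h3
  have h5 : ∀ a : ℝ, A (a • (h • chartField V x₀ (c t))) =
      a • (h • (show E from V ((extChartAt I x₀).symm (c t)))) := fun a => by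
    rw [map_smul, map_smul, h4]
  exact h5 a

variable [FiniteDimensional ℝ E]

theorem exists_smooth_local_flow_manifold {V : (x : N) → TangentSpace I x} (hV : IsSmoothField I V)
    (x₀ : N) : ∃ G : ℝ × N → N, ContMDiffAt (𝓘(ℝ, ℝ).prod I) I ∞ G (0, x₀) ∧
      ∀ᶠ p in 𝓝 ((0 : ℝ), x₀), ∃ c : ℝ → N, c 0 = p.2 ∧ c 1 = G p ∧
        IsMIntegralCurveOn c (p.1 • V) (Ioo (-2) 2) := by
  have : CompleteSpace E := FiniteDimensional.complete ℝ E
  have hy₀ := mem_extChartAt_target (I := I) x₀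
  set e := extChartAt I x₀
  obtain ⟨χ, hχ⟩ : ∃ χ : ContDiffBump (e x₀), tsupport χ ⊆ e.target := by
    obtain ⟨r, hr, hb⟩ := Metric.nhds_basis_closedBall.mem_iff.1
      ((isOpen_extChartAt_target (I := I) x₀).mem_nhds hy₀)
    refine ⟨⟨r / 2, r, by positivity, by linarith⟩, ?_⟩
    rw [ContDiffBump.tsupport_eq]
    exact hb
  let v : E → E := fun y => χ y • chartField V x₀ y
  have hv : ContDiff ℝ ∞ v := by
    refine contMDiff_iff_contDiff.1 (contMDiff_of_tsupport fun y hy => ?_)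
    have hy' : y ∈ e.target := hχ (tsupport_smul_subset_left (χ : E → ℝ) _ hy)
    exact (χ.contDiff.contDiffAt.smul (hV.contDiffAt_chartField x₀ hy')).contMDiffAt
  obtain ⟨γ, hγ, hW⟩ := exists_smooth_local_flow hv (e x₀)
  let W : Set E := {y | χ y = 1} ∩ e.target
  have hWn : W ∈ 𝓝 (e x₀) :=
    inter_mem χ.eventuallyEq_one ((isOpen_extChartAt_target (I := I) x₀).mem_nhds hy₀)
  have h1 : ContMDiffAt (𝓘(ℝ, ℝ).prod I) 𝓘(ℝ, ℝ × E) ∞ (fun p : ℝ × N => (p.1, e p.2)) (0, x₀) := by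
    have : ContMDiffAt (𝓘(ℝ, ℝ).prod I) 𝓘(ℝ, E) ∞ (fun p : ℝ × N => e p.2) (0, x₀) :=
      ContMDiffAt.comp (0, x₀) (contMDiffAt_extChartAt (I := I) (x := x₀)) contMDiffAt_snd
    exact contMDiffAt_fst.prodMk_space this
  have hev := h1.continuousAt.eventually (hW W hWn)
  have hsrc : ∀ᶠ p in 𝓝 ((0 : ℝ), x₀), p.2 ∈ e.source :=
    (continuousAt_snd (p := ((0 : ℝ), x₀))).eventually (extChartAt_source_mem_nhds (I := I) x₀)
  refine ⟨fun p => e.symm (γ (p.1, e p.2) 1), ?_, ?_⟩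
  · have h0 := (hev.self_of_nhds).2 1 (by norm_num)
    have h2 : ContMDiffAt 𝓘(ℝ, E) I ∞ e.symm (γ (0, e x₀) 1) :=
      (contMDiffOn_extChartAt_symm x₀).contMDiffAt
        ((isOpen_extChartAt_target (I := I) x₀).mem_nhds h0.2.2)
    exact ContMDiffAt.comp (0, x₀) h2 (ContMDiffAt.comp (0, x₀) hγ.contMDiffAt h1)
  · filter_upwards [hev, hsrc] with p hp hps
    refine ⟨fun t => e.symm (γ (p.1, e p.2) t), ?_, rfl, ?_⟩
    · exact (congrArg e.symm hp.1).trans (e.left_inv hps)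
    · refine isMIntegralCurveOn_of_chart (fun t ht => (hp.2 t ht).2.2) fun t ht => ?_
      have h3 := (hp.2 t ht).1
      have h4 : v (γ (p.1, e p.2) t) = chartField V x₀ (γ (p.1, e p.2) t) := by
        have : χ (γ (p.1, e p.2) t) = 1 := (hp.2 t ht).2.1
        simp only [v, this, one_smul]
      rwa [h4] at h3

variable [T2Space N]

theorem IsSmoothField.one {V : (x : N) → TangentSpace I x} (hV : IsSmoothField I V) :
    ContMDiff I I.tangent 1 fun x => (⟨x, V x⟩ : TangentBundle I N) :=
  hV.of_le (by simp)

theorem IsSmoothField.const_smul {V : (x : N) → TangentSpace I x} (hV : IsSmoothField I V) (a : ℝ) :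
    IsSmoothField I (a • V) :=
  ContMDiff.const_smul_section hV

/-- Vector fields on compact manifolds are complete. -/
theorem exists_isMIntegralCurve_of_compactSpace [CompactSpace N] {V : (x : N) → TangentSpace I x}
    (hV : IsSmoothField I V) (x : N) : ∃ γ : ℝ → N, γ 0 = x ∧ IsMIntegralCurve γ V := by
  have hloc : ∀ x₀ : N, ∃ ε > 0, ∀ᶠ x in 𝓝 x₀, ∃ γ : ℝ → N, γ 0 = x ∧
      IsMIntegralCurveOn γ V (Ioo (-ε) ε) := by
    intro x₀
    obtain ⟨G, -, hG⟩ := exists_smooth_local_flow_manifold hV x₀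
    rw [nhds_prod_eq] at hG
    obtain ⟨p, hp, q, hq, hpq⟩ := eventually_prod_iff.1 hG
    obtain ⟨δ, hδ, hδp⟩ := Metric.eventually_nhds_iff.1 hp
    refine ⟨δ / 2, half_pos hδ, hq.mono fun x hx => ?_⟩
    obtain ⟨c, h0, -, hc⟩ := hpq (x := δ / 2) (hδp (by simp [abs_of_pos hδ]; linarith)) hx
    refine ⟨c ∘ (· * (δ / 2)⁻¹), by simp [h0], ?_⟩
    have h1 := hc.comp_mul (δ / 2)⁻¹
    rw [smul_smul, inv_mul_cancel₀ (half_pos hδ).ne', one_smul] at h1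
    refine h1.mono fun t ht => ?_
    have h2 : (0 : ℝ) < (δ / 2)⁻¹ := by positivity
    have h3 : (δ / 2) * (δ / 2)⁻¹ = 1 := mul_inv_cancel₀ (half_pos hδ).ne'
    constructor <;> nlinarith [ht.1, ht.2]
  choose ε hε hev using hloc
  obtain ⟨s, -, hs⟩ := isCompact_univ.elim_nhds_subcover
    (fun x₀ => {x | ∃ γ : ℝ → N, γ 0 = x ∧ IsMIntegralCurveOn γ V (Ioo (-(ε x₀)) (ε x₀))})
    fun x₀ _ => hev x₀
  obtain ⟨δ, hδ, hδs⟩ : ∃ δ > 0, ∀ x ∈ s, δ ≤ ε x := by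
    have := s.finite_toSet
    obtain ⟨δ, h1, h2⟩ := ((Filter.eventually_all_finset s).2 fun x _ =>
      (eventually_le_nhds (hε x) : ∀ᶠ δ in 𝓝 (0 : ℝ), δ ≤ ε x) |>.filter_mono
        (nhdsWithin_le_nhds (s := Ioi 0))).and self_mem_nhdsWithin |>.exists
    exact ⟨δ, h2, h1⟩
  refine exists_isMIntegralCurve_of_isMIntegralCurveOn hV.one hδ (fun x => ?_) x
  obtain ⟨x₀, hx₀, γ, h0, hγ⟩ := by simpa using hs (mem_univ x)
  exact ⟨γ, h0, hγ.mono (Ioo_subset_Ioo (neg_le_neg (hδs x₀ hx₀)) (hδs x₀ hx₀))⟩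

/-- The flow of a complete smooth vector field is smooth. -/
theorem exists_smooth_flow {V : (x : N) → TangentSpace I x} (hV : IsSmoothField I V)
    (hc : ∀ x, ∃ γ : ℝ → N, γ 0 = x ∧ IsMIntegralCurve γ V) :
    ∃ Fl : ℝ × N → N, ContMDiff (𝓘(ℝ, ℝ).prod I) I ∞ Fl ∧ (∀ x, Fl (0, x) = x) ∧
      (∀ x, IsMIntegralCurve (fun t => Fl (t, x)) V) ∧
      ∀ s t x, Fl (s + t, x) = Fl (s, Fl (t, x)) := by
  choose γ h0 hγ using hc
  let Fl : ℝ × N → N := fun p => γ p.2 p.1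
  have hadd : ∀ s t x, Fl (s + t, x) = Fl (s, Fl (t, x)) := by
    intro s t x
    have h1 := (hγ x).comp_add t
    have h2 := isMIntegralCurve_Ioo_eq_of_contMDiff_boundaryless (t₀ := 0) hV.one h1 (hγ (γ x t))
      (by simp [h0])
    exact congrFun h2 s
  have hloc : ∀ x₀, ContMDiffAt (𝓘(ℝ, ℝ).prod I) I ∞ Fl (0, x₀) := by
    intro x₀
    obtain ⟨G, hG, hev⟩ := exists_smooth_local_flow_manifold hV x₀
    refine hG.congr_of_eventuallyEq ?_
    filter_upwards [hev] with p ⟨c, hc0, hc1, hc⟩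
    have h1 := ((hγ p.2).comp_mul p.1).isMIntegralCurveOn (Ioo (-2) 2)
    have h2 := isMIntegralCurveOn_Ioo_eqOn_of_contMDiff_boundaryless (t₀ := 0) (by norm_num)
      (hV.const_smul p.1).one h1 hc (by simp [h0, hc0])
    have h3 := h2 (show (1 : ℝ) ∈ Ioo (-2 : ℝ) 2 by norm_num)
    rw [hc1] at h3
    simpa using h3
  refine ⟨Fl, ?_, h0, hγ, hadd⟩
  refine contMDiff_infty.2 fun n => ?_
  have hfix : ∀ x₀ : N, ∀ t, ContMDiffAt I I n (fun x => Fl (t, x)) x₀ := by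
    intro x₀
    have key : ∀ t₀ : ℝ, ∃ δ > 0, ∀ t' ∈ Metric.ball t₀ δ, ∀ t'' ∈ Metric.ball t₀ δ,
        ContMDiffAt I I n (fun x => Fl (t', x)) x₀ → ContMDiffAt I I n (fun x => Fl (t'', x)) x₀ := by
      intro t₀
      have h1 : ∀ᶠ q in 𝓝 ((0 : ℝ), Fl (t₀, x₀)), ContMDiffAt (𝓘(ℝ, ℝ).prod I) I n Fl q :=
        (contMDiffAt_iff_contMDiffAt_nhds (by simp)).1
          ((hloc (Fl (t₀, x₀))).of_le (by exact_mod_cast le_top))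
      rw [nhds_prod_eq] at h1
      obtain ⟨p, hp, q, hq, hpq⟩ := eventually_prod_iff.1 h1
      obtain ⟨δ, hδ, hδp⟩ := Metric.eventually_nhds_iff.1 hp
      have h2 : ∀ᶠ t in 𝓝 t₀, q (Fl (t, x₀)) := (hγ x₀).continuous.continuousAt.eventually hq
      obtain ⟨δ', hδ', hδq⟩ := Metric.eventually_nhds_iff.1 h2
      refine ⟨min (δ / 2) δ', by positivity, fun t' ht' t'' ht'' hs => ?_⟩
      rw [Metric.mem_ball, lt_min_iff] at ht' ht''
      have h3 : dist (t'' - t') 0 < δ := by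
        rw [dist_zero_right, ← dist_eq_norm]
        calc dist t'' t' ≤ dist t'' t₀ + dist t' t₀ := dist_triangle_right _ _ _
          _ < δ := by linarith [ht'.1, ht''.1]
      have h4 : ContMDiffAt (𝓘(ℝ, ℝ).prod I) I n Fl (t'' - t', Fl (t', x₀)) :=
        hpq (hδp h3) (hδq ht'.2)
      have h5 : (fun x => Fl (t'', x)) = fun x => Fl (t'' - t', Fl (t', x)) := by
        funext x
        rw [← hadd, sub_add_cancel]
      rw [h5]
      exact ContMDiffAt.comp x₀ h4 (contMDiffAt_const.prodMk hs)
    have hclopen : IsClopen {t : ℝ | ContMDiffAt I I n (fun x => Fl (t, x)) x₀} := by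
      constructor
      · rw [← isOpen_compl_iff, Metric.isOpen_iff]
        intro t₀ ht₀
        obtain ⟨δ, hδ, h⟩ := key t₀
        exact ⟨δ, hδ, fun t' ht' hs => ht₀ (h t' ht' t₀ (Metric.mem_ball_self hδ) hs)⟩
      · rw [Metric.isOpen_iff]
        intro t₀ ht₀
        obtain ⟨δ, hδ, h⟩ := key t₀
        exact ⟨δ, hδ, fun t' ht' => h t₀ (Metric.mem_ball_self hδ) t' ht' ht₀⟩
    have h0' : ContMDiffAt I I n (fun x => Fl (0, x)) x₀ := by
      have : (fun x => Fl (0, x)) = id := funext h0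
      rw [this]
      exact contMDiffAt_id
    have h6 := hclopen.eq_univ ⟨0, h0'⟩
    exact fun t => h6.symm.subset (mem_univ t)
  rintro ⟨t, x⟩
  have h1 : Fl = fun p => Fl (p.1 - t, Fl (t, p.2)) := by
    funext p
    rw [← hadd, sub_add_cancel]
  have h2 : ContMDiffAt (𝓘(ℝ, ℝ).prod I) I n Fl (t - t, Fl (t, x)) := by
    rw [sub_self]
    exact (hloc _).of_le (by exact_mod_cast le_top)
  rw [h1]
  refine ContMDiffAt.comp (t, x) (g := Fl) (f := fun p : ℝ × N => (p.1 - t, Fl (t, p.2))) h2 ?_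
  exact (contMDiffAt_fst.sub contMDiffAt_const).prodMk
    (ContMDiffAt.comp (t, x) (hfix x t) contMDiffAt_snd)

end Flow

end SymplecticDeformation

namespace SymplecticDeformation

section FamilyFlow

variable {E : Type*} [NormedAddCommGroup E] [NormedSpace ℝ E] [FiniteDimensional ℝ E]
  {H : Type*} [TopologicalSpace H] {I : ModelWithCorners ℝ E H} [I.Boundaryless]
  {M : Type*} [TopologicalSpace M] [ChartedSpace H M] [IsManifold I ∞ M] [T2Space M] [CompactSpace M]

variable (I) in
/-- A family of vector fields is smooth. -/
def IsSmoothFieldFamily (V : (p : ℝ × M) → TangentSpace I p.2) : Prop :=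
  ContMDiff (𝓘(ℝ, ℝ).prod I) I.tangent ∞ fun p : ℝ × M => (⟨p.2, V p⟩ : TangentBundle I M)

omit [FiniteDimensional ℝ E] [T2Space M] [CompactSpace M] in
theorem IsSmoothFieldFamily.isSmoothField {V : (p : ℝ × M) → TangentSpace I p.2}
    (hV : IsSmoothFieldFamily I V) (t : ℝ) : IsSmoothField I fun x => V (t, x) :=
  hV.comp (contMDiff_slice I M t)

omit [FiniteDimensional ℝ E] [T2Space M] [CompactSpace M] in
theorem IsSmoothFieldFamily.lift {V : (p : ℝ × M) → TangentSpace I p.2}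
    (hV : IsSmoothFieldFamily I V) :
    IsSmoothField (𝓘(ℝ, ℝ).prod I) (N := ℝ × M)
      (fun p => (show TangentSpace (𝓘(ℝ, ℝ).prod I) p from (((0 : ℝ), (show E from V p)) : ℝ × E))) := by
  have h0 : ContMDiff (𝓘(ℝ, ℝ).prod I) 𝓘(ℝ, ℝ).tangent ∞
      fun p : ℝ × M => (⟨p.1, (0 : ℝ)⟩ : TangentBundle 𝓘(ℝ, ℝ) ℝ) :=
    (Bundle.contMDiff_zeroSection ℝ (TangentSpace 𝓘(ℝ, ℝ) : ℝ → Type)).comp contMDiff_fst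
  exact contMDiff_equivTangentBundleProd_symm.comp (h0.prodMk hV)

/-- A smooth family of vector fields on a compact manifold has a smooth family of flows. -/
theorem exists_smooth_flow_family {V : (p : ℝ × M) → TangentSpace I p.2}
    (hV : IsSmoothFieldFamily I V) :
    ∃ F : ℝ × ℝ × M → M, ContMDiff (𝓘(ℝ, ℝ).prod (𝓘(ℝ, ℝ).prod I)) I ∞ F ∧
      (∀ t x, F (0, t, x) = x) ∧
      (∀ t x, IsMIntegralCurve (fun s => F (s, t, x)) (fun y => V (t, y))) ∧
      ∀ s s' t x, F (s + s', t, x) = F (s, t, F (s', t, x)) := by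
  have hl := hV.lift
  have hcurve : ∀ (t : ℝ) (γ : ℝ → M), IsMIntegralCurve γ (fun y => V (t, y)) →
      IsMIntegralCurve (I := 𝓘(ℝ, ℝ).prod I) (fun s => (t, γ s)) (fun p =>
        (show TangentSpace (𝓘(ℝ, ℝ).prod I) p from (((0 : ℝ), (show E from V p)) : ℝ × E))) := by
    intro t γ hγ s
    have h1 : HasMFDerivAt 𝓘(ℝ, ℝ) 𝓘(ℝ, ℝ) (fun _ : ℝ => t) s (0 : ℝ →L[ℝ] ℝ) := hasMFDerivAt_const t s
    refine (h1.prodMk (hγ s)).congr_mfderiv ?_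
    refine ContinuousLinearMap.ext fun a => Prod.ext ?_ rfl
    exact (smul_zero (show ℝ from a)).symm
  have hcomp : ∀ p : ℝ × M, ∃ γ : ℝ → ℝ × M, γ 0 = p ∧ IsMIntegralCurve (I := 𝓘(ℝ, ℝ).prod I) γ (fun p =>
        (show TangentSpace (𝓘(ℝ, ℝ).prod I) p from (((0 : ℝ), (show E from V p)) : ℝ × E))) := by
    rintro ⟨t, x⟩
    obtain ⟨γ, h0, hγ⟩ := exists_isMIntegralCurve_of_compactSpace (hV.isSmoothField t) x
    exact ⟨fun s => (t, γ s), congrArg (Prod.mk t) h0, hcurve t γ hγ⟩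
  obtain ⟨Fl, hs, h0, hγ, hadd⟩ := exists_smooth_flow hl hcomp
  have key : ∀ t x, ∃ γ : ℝ → M, IsMIntegralCurve γ (fun y => V (t, y)) ∧
      ∀ s, Fl (s, t, x) = (t, γ s) := by
    intro t x
    obtain ⟨γ, h0', hγ'⟩ := exists_isMIntegralCurve_of_compactSpace (hV.isSmoothField t) x
    refine ⟨γ, hγ', fun s => ?_⟩
    exact congrFun (isMIntegralCurve_Ioo_eq_of_contMDiff_boundaryless (t₀ := 0) hl.one (hγ (t, x))
      (hcurve t γ hγ') (by simp only [h0, h0'])) s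
  have hfst : ∀ s t x, Fl (s, t, x) = (t, (Fl (s, t, x)).2) := by
    intro s t x
    obtain ⟨γ, -, h⟩ := key t x
    rw [h s]
  refine ⟨fun q => (Fl q).2, contMDiff_snd.comp hs, fun t x => by simp only [h0], fun t x => ?_,
    fun s s' t x => ?_⟩
  · obtain ⟨γ, hγ', h⟩ := key t x
    simpa only [h] using hγ'
  · change (Fl (s + s', t, x)).2 = (Fl (s, t, (Fl (s', t, x)).2)).2
    rw [hadd, ← hfst]

end FamilyFlow

section FieldAlong

variable {E : Type*} [NormedAddCommGroup E] [NormedSpace ℝ E]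
  {H : Type*} [TopologicalSpace H] {I : ModelWithCorners ℝ E H} [I.Boundaryless]
  {M : Type*} [TopologicalSpace M] [ChartedSpace H M] [IsManifold I ∞ M]
  {E' : Type*} [NormedAddCommGroup E'] [NormedSpace ℝ E']
  {H' : Type*} [TopologicalSpace H'] {I' : ModelWithCorners ℝ E' H'} [I'.Boundaryless]
  {P : Type*} [TopologicalSpace P] [ChartedSpace H' P] [IsManifold I' ∞ P]

theorem mfderiv_time {K : ℝ × P → M} {s : ℝ} {p : P}
    (hK : MDifferentiableAt (𝓘(ℝ, ℝ).prod I') I K (s, p)) :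
    (show E from mfderiv 𝓘(ℝ, ℝ) I (fun s : ℝ => K (s, p)) s (1 : ℝ)) =
      mfderiv (𝓘(ℝ, ℝ).prod I') I K (s, p) (((1 : ℝ), (0 : E')) : ℝ × E') := by
  have h2 : HasMFDerivAt 𝓘(ℝ, ℝ) (𝓘(ℝ, ℝ).prod I') (fun s : ℝ => (s, p)) s
      ((ContinuousLinearMap.id ℝ ℝ).prod (0 : ℝ →L[ℝ] E')) :=
    (hasMFDerivAt_id s).prodMk (hasMFDerivAt_const p s)
  exact DFunLike.congr_fun (hK.hasMFDerivAt.comp s h2).mfderiv (1 : ℝ)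

/-- The derivative at `s = 0` of a smooth map in `s` and further variables. -/
theorem contMDiffAt_deriv_param {K : ℝ × P → M} {p₀ : P}
    (hK : ∀ᶠ p in 𝓝 p₀, ContMDiffAt (𝓘(ℝ, ℝ).prod I') I ∞ K (0, p)) :
    ContMDiffAt I' I.tangent ∞ (fun p =>
      (⟨K (0, p), mfderiv (𝓘(ℝ, ℝ).prod I') I K (0, p) (((1 : ℝ), (0 : E')) : ℝ × E')⟩ :
        TangentBundle I M)) p₀ := by
  have h0 := hK.self_of_nhds
  have hj : ContMDiff I' (𝓘(ℝ, ℝ).prod I') ∞ (fun p : P => ((0 : ℝ), p)) := contMDiff_slice I' P 0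
  have hb : ContMDiffAt I' I ∞ (fun p => K (0, p)) p₀ := ContMDiffAt.comp p₀ h0 hj.contMDiffAt
  refine contMDiffAt_tangentBundle_iff.2 ⟨hb, ?_⟩
  have h1 := ContMDiffAt.mfderiv_apply (m := ∞) (n := ∞) (x₀ := p₀) (I := 𝓘(ℝ, ℝ)) (I' := I)
    (f := fun (p : P) (s : ℝ) => K (s, p)) (g := fun _ => (0 : ℝ)) (g₁ := id) (g₂ := fun _ => (1 : ℝ))
    (J := I') (J' := I')
    (ContMDiffAt.comp (p₀, (0 : ℝ)) h0 (contMDiffAt_snd.prodMk contMDiffAt_fst)) contMDiffAt_const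
    contMDiffAt_id contMDiffAt_const (by simp)
  refine h1.congr_of_eventuallyEq ?_
  filter_upwards [hb.continuousAt.eventually (extChartAt_source_mem_nhds (I := I) (K (0, p₀))), hK]
    with p hp hKp
  rw [inTangentCoordinates_eq_mfderiv_comp (by simp) (by rwa [← extChartAt_source I])]
  have hid : mfderivWithin 𝓘(ℝ, ℝ) 𝓘(ℝ, ℝ) (extChartAt 𝓘(ℝ, ℝ) (0 : ℝ)).symm (range 𝓘(ℝ, ℝ))
      (extChartAt 𝓘(ℝ, ℝ) (0 : ℝ) 0) = ContinuousLinearMap.id ℝ ℝ := by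
    rw [extChartAt_model_space_eq_id, ModelWithCorners.range_eq_univ, mfderivWithin_univ]
    exact mfderiv_id
  rw [hid]
  exact congrArg (chartDiff I (K (0, p₀)) (K (0, p))) (mfderiv_time (hKp.mdifferentiableAt (by simp))).symm

end FieldAlong

end SymplecticDeformation

namespace SymplecticDeformation

section Cotangent

variable {F : Type*} [NormedAddCommGroup F] [NormedSpace ℝ F]
  {K : Type*} [TopologicalSpace K] {J : ModelWithCorners ℝ F K} [J.Boundaryless]
  {L : Type*} [TopologicalSpace L] [ChartedSpace K L] [IsManifold J ∞ L]
  {E' : Type*} [NormedAddCommGroup E'] [NormedSpace ℝ E']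
  {H' : Type*} [TopologicalSpace H'] {I' : ModelWithCorners ℝ E' H'}
  {P : Type*} [TopologicalSpace P] [ChartedSpace H' P]

/-- The coordinate expression of a covector in the preferred chart around `x₀`. -/
noncomputable def covCoord (x₀ : L) (p : CotangentBundle J L) : F →L[ℝ] ℝ :=
  (show F →L[ℝ] ℝ from p.2).comp
    (show F →L[ℝ] F from chartSymmDiff J x₀ (extChartAt J x₀ p.1))

theorem trivializationAt_cotangent_snd {x₀ : L} {p : CotangentBundle J L}
    (hp : p.1 ∈ (extChartAt J x₀).source) :
    (trivializationAt (F →L[ℝ] ℝ) (fun x : L => TangentSpace J x →L[ℝ] Bundle.Trivial L ℝ x) x₀ p).2 =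
      covCoord x₀ p := by
  rw [extChartAt_source] at hp
  have h := TangentBundle.symmL_trivializationAt (I := J) hp
  rw [J.range_eq_univ, mfderivWithin_univ] at h
  rw [hom_trivializationAt_apply]
  refine ContinuousLinearMap.ext fun v => ?_
  have h1 := congrArg (show TangentSpace J p.1 →L[ℝ] ℝ from p.2) (DFunLike.congr_fun h v)
  refine Eq.trans ?_ h1
  simp only [ContinuousLinearMap.inCoordinates, ContinuousLinearMap.comp_apply]
  simp

theorem contMDiffAt_cotangent_iff_of_mem (x₀ : L) {f : P → CotangentBundle J L} {p₀ : P}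
    (h : (f p₀).1 ∈ (extChartAt J x₀).source) :
    ContMDiffAt I' (cotangentModel J) ∞ f p₀ ↔
      ContMDiffAt I' J ∞ (fun p => (f p).1) p₀ ∧
        ContMDiffAt I' 𝓘(ℝ, F →L[ℝ] ℝ) ∞ (fun p => covCoord x₀ (f p)) p₀ := by
  rw [Bundle.Trivialization.contMDiffAt_iff (e := trivializationAt (F →L[ℝ] ℝ)
    (fun x : L => TangentSpace J x →L[ℝ] Bundle.Trivial L ℝ x) x₀)]
  · refine and_congr_right fun hf => ?_
    refine Filter.EventuallyEq.contMDiffAt_iff ?_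
    filter_upwards [hf.continuousAt.eventually ((isOpen_extChartAt_source x₀).mem_nhds h)] with p hp
    exact trivializationAt_cotangent_snd hp
  · rw [Bundle.Trivialization.mem_source]
    rw [extChartAt_source] at h
    simpa using h

theorem contMDiffAt_cotangent_iff {f : P → CotangentBundle J L} {p₀ : P} :
    ContMDiffAt I' (cotangentModel J) ∞ f p₀ ↔
      ContMDiffAt I' J ∞ (fun p => (f p).1) p₀ ∧
        ContMDiffAt I' 𝓘(ℝ, F →L[ℝ] ℝ) ∞ (fun p => covCoord (f p₀).1 (f p)) p₀ :=
  contMDiffAt_cotangent_iff_of_mem _ (mem_extChartAt_source _)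

theorem contMDiff_cotangent_proj :
    ContMDiff (cotangentModel J) J ∞ fun p : CotangentBundle J L => p.1 :=
  Bundle.contMDiff_proj _

/-- Fibrewise linear combinations of smooth maps to `T^*L` are smooth. -/
theorem contMDiffAt_cotangent_add_smul {f : P → CotangentBundle J L} {s : P → ℝ}
    {c : (p : P) → TangentSpace J (f p).1 →L[ℝ] ℝ} {p₀ : P}
    (hf : ContMDiffAt I' (cotangentModel J) ∞ f p₀) (hs : ContMDiffAt I' 𝓘(ℝ, ℝ) ∞ s p₀)
    (hc : ContMDiffAt I' (cotangentModel J) ∞ (fun p => (⟨(f p).1, c p⟩ : CotangentBundle J L)) p₀) :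
    ContMDiffAt I' (cotangentModel J) ∞
      (fun p => (⟨(f p).1, (f p).2 + s p • c p⟩ : CotangentBundle J L)) p₀ := by
  have h1 := contMDiffAt_cotangent_iff.1 hf
  exact contMDiffAt_cotangent_iff.2 ⟨h1.1, h1.2.add (hs.smul (contMDiffAt_cotangent_iff.1 hc).2)⟩

theorem toCovector_apply (σ : Om J L 1) (x : L) (v : TangentSpace J x) :
    toCovector σ x v = σ.1 x fun _ => v := rfl

variable (F) in
/-- The identification of alternating `1`-forms and linear functionals. -/
noncomputable def oneFormCLE : (F [⋀^Fin 1]→L[ℝ] ℝ) ≃L[ℝ] (F →L[ℝ] ℝ) :=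
  (ContinuousAlternatingMap.ofSubsingletonLIE (𝕜 := ℝ) (E := F) (F := ℝ) (0 : Fin 1)).symm.toContinuousLinearEquiv

theorem covCoord_toSection (σ : Om J L 1) {x₀ x : L} (hx : x ∈ (extChartAt J x₀).source) :
    covCoord x₀ (toSection σ x) = oneFormCLE F (chartForm J σ.1 x₀ (extChartAt J x₀ x)) := by
  have h := comp_congr σ.1 ((extChartAt J x₀).left_inv hx).symm
    (show F →L[ℝ] F from chartSymmDiff J x₀ (extChartAt J x₀ x))
    (show F →L[ℝ] F from chartSymmDiff J x₀ (extChartAt J x₀ x)) fun v => rfl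
  exact ContinuousLinearMap.ext fun v => (DFunLike.congr_fun h fun _ => v :)

theorem contMDiff_toSection_family {α : ℝ → Om J L 1} (hα : IsSmoothFamily α) :
    ContMDiff (𝓘(ℝ, ℝ).prod J) (cotangentModel J) ∞ fun p : ℝ × L => toSection (α p.1) p.2 := by
  rintro ⟨t₀, x₀⟩
  refine contMDiffAt_cotangent_iff.2 ⟨contMDiffAt_snd, ?_⟩
  have hc : ContMDiffAt (𝓘(ℝ, ℝ).prod J) 𝓘(ℝ, ℝ × F) ∞
      (fun p : ℝ × L => (p.1, extChartAt J x₀ p.2)) (t₀, x₀) :=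
    contMDiffAt_fst.prodMk_space (ContMDiffAt.comp (t₀, x₀) contMDiffAt_extChartAt contMDiffAt_snd)
  have h1 : ContDiffAt ℝ ∞ (fun p : ℝ × F => oneFormCLE F (chartForm J (α p.1).1 x₀ p.2))
      (t₀, extChartAt J x₀ x₀) :=
    (oneFormCLE F).contDiff.contDiffAt.comp _ ((hα x₀).contDiffAt
      ((isOpen_univ.prod (isOpen_extChartAt_target x₀)).mem_nhds ⟨mem_univ _, mem_extChartAt_target x₀⟩))
  refine (ContMDiffAt.comp (t₀, x₀) h1.contMDiffAt hc).congr_of_eventuallyEq ?_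
  filter_upwards [continuous_snd.continuousAt.eventually
    (extChartAt_source_mem_nhds (I := J) (x := (t₀, x₀).2))] with p hp
  exact covCoord_toSection (α p.1) hp

theorem contMDiff_toSection (σ : Om J L 1) : ContMDiff J (cotangentModel J) ∞ (toSection σ) :=
  (contMDiff_toSection_family (isSmoothFamily_const σ)).comp (contMDiff_slice J L 0)

theorem contMDiffAt_symm_family {x₀ : L} {t : ℝ} {y : F} (hy : y ∈ (extChartAt J x₀).target) :
    ContMDiffAt 𝓘(ℝ, ℝ × F) (𝓘(ℝ, ℝ).prod J) ∞
      (fun p : ℝ × F => (p.1, (extChartAt J x₀).symm p.2)) (t, y) := by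
  refine contDiff_fst.contDiffAt.contMDiffAt.prodMk ?_
  have h2 : ContMDiffAt 𝓘(ℝ, F) J ∞ (extChartAt J x₀).symm y :=
    (contMDiffOn_extChartAt_symm x₀).contMDiffAt ((isOpen_extChartAt_target x₀).mem_nhds hy)
  exact ContMDiffAt.comp (t, y) h2 contDiff_snd.contDiffAt.contMDiffAt

theorem contDiffOn_chartForm_of_section {c : (p : ℝ × L) → TangentSpace J p.2 →L[ℝ] ℝ}
    (hS : ContMDiff (𝓘(ℝ, ℝ).prod J) (cotangentModel J) ∞
      fun p : ℝ × L => (⟨p.2, c p⟩ : CotangentBundle J L)) (x₀ : L) :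
    ContDiffOn ℝ ∞ (fun p : ℝ × F => chartForm J (fun x =>
      ContinuousAlternatingMap.ofSubsingleton ℝ (TangentSpace J x) ℝ (0 : Fin 1) (c (p.1, x))) x₀ p.2)
      (univ ×ˢ (extChartAt J x₀).target) := by
  rintro ⟨t, y⟩ ⟨-, hy⟩
  apply ContDiffAt.contDiffWithinAt
  have hSs := ContMDiffAt.comp (t, y) (hS _) (contMDiffAt_symm_family hy)
  have h3 := ((contMDiffAt_cotangent_iff_of_mem x₀ ((extChartAt J x₀).map_target hy)).1 hSs).2.contDiffAt
  have h4 := ((oneFormCLE F).symm.contDiff (n := ∞)).contDiffAt.comp (t, y) h3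
  refine h4.congr_of_eventuallyEq ?_
  filter_upwards [(isOpen_univ.prod (isOpen_extChartAt_target (I := J) x₀)).mem_nhds
    (show (t, y) ∈ _ from ⟨mem_univ _, hy⟩)] with p hp
  refine ((oneFormCLE F).symm_apply_eq.2 ?_).symm
  have h5 : (show F →L[ℝ] F from chartSymmDiff J x₀ (extChartAt J x₀ ((extChartAt J x₀).symm p.2))) =
      chartSymmDiff J x₀ p.2 :=
    congrArg (fun z => (show F →L[ℝ] F from chartSymmDiff J x₀ z)) ((extChartAt J x₀).right_inv hp.2)
  exact congrArg (fun A => (show F →L[ℝ] ℝ from c (p.1, (extChartAt J x₀).symm p.2)).comp A) h5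

/-- A smooth family of sections of `T^*L` comes from a smooth family of `1`-forms. -/
theorem exists_family_of_section {S : ℝ × L → CotangentBundle J L}
    (hS : ContMDiff (𝓘(ℝ, ℝ).prod J) (cotangentModel J) ∞ S) (hproj : ∀ p, (S p).1 = p.2) :
    ∃ α : ℝ → Om J L 1, IsSmoothFamily α ∧ ∀ t x, toSection (α t) x = S (t, x) := by
  have hc : ∀ p, ∃ c : TangentSpace J p.2 →L[ℝ] ℝ, S p = (⟨p.2, c⟩ : CotangentBundle J L) := by
    intro p
    rw [← hproj p]
    exact ⟨(S p).2, rfl⟩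
  choose c hc using hc
  have hS' : S = fun p => (⟨p.2, c p⟩ : CotangentBundle J L) := funext hc
  rw [hS'] at hS
  have hη := contDiffOn_chartForm_of_section hS
  let α : ℝ → Om J L 1 := fun t => ⟨fun x =>
      ContinuousAlternatingMap.ofSubsingleton ℝ (TangentSpace J x) ℝ (0 : Fin 1) (c (t, x)),
    fun x₀ => (hη x₀).comp (f := fun y => (t, y)) (contDiff_prodMk_right t).contDiffOn
      fun y hy => ⟨mem_univ _, hy⟩⟩
  refine ⟨α, hη, fun t x => ?_⟩
  rw [hc]
  rfl

end Cotangent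

end SymplecticDeformation

namespace SymplecticDeformation

section Taut

variable {F : Type*} [NormedAddCommGroup F] [NormedSpace ℝ F]
  {K : Type*} [TopologicalSpace K] {J : ModelWithCorners ℝ F K} [J.Boundaryless]
  {L : Type*} [TopologicalSpace L] [ChartedSpace K L] [IsManifold J ∞ L]

theorem extChartAt_cotangent_apply (p₀ p : CotangentBundle J L) :
    extChartAt (cotangentModel J) p₀ p = (extChartAt J p₀.1 p.1,
      (trivializationAt (F →L[ℝ] ℝ) (fun x : L => TangentSpace J x →L[ℝ] Bundle.Trivial L ℝ x)
        p₀.1 p).2) := by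
  rw [FiberBundle.extChartAt, PartialEquiv.coe_trans, Function.comp_apply, PartialEquiv.prod_coe]
  rfl

theorem mem_extChartAt_cotangent_source {p₀ p : CotangentBundle J L} :
    p ∈ (extChartAt (cotangentModel J) p₀).source ↔ p.1 ∈ (extChartAt J p₀.1).source := by
  rw [extChartAt_source, extChartAt_source, FiberBundle.chartedSpace_chartAt]
  simp [mfld_simps]
  exact fun h => h

theorem chartForm_tautForm {p₀ : CotangentBundle J L} {z : F × (F →L[ℝ] ℝ)}
    (hz : z ∈ (extChartAt (cotangentModel J) p₀).target) :
    chartForm (cotangentModel J) (tautForm J L) p₀ z =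
      (oneFormCLE (F × (F →L[ℝ] ℝ))).symm (z.2.comp (ContinuousLinearMap.fst ℝ F (F →L[ℝ] ℝ))) := by
  set p := (extChartAt (cotangentModel J) p₀).symm z with hp
  have hps : p ∈ (extChartAt (cotangentModel J) p₀).source := (extChartAt _ p₀).map_target hz
  have hp1 := mem_extChartAt_cotangent_source.1 hps
  have hzp : extChartAt (cotangentModel J) p₀ p = z := (extChartAt _ p₀).right_inv hz
  rw [extChartAt_cotangent_apply, trivializationAt_cotangent_snd hp1] at hzp
  have hz1 : extChartAt J p₀.1 p.1 = z.1 := congrArg Prod.fst hzp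
  have hz2 : covCoord p₀.1 p = z.2 := congrArg Prod.snd hzp
  have hsy := mdiff_symm (I := cotangentModel J) p₀ hz
  have hpr : MDifferentiableAt (cotangentModel J) J (fun p : CotangentBundle J L => p.1) p :=
    (contMDiff_cotangent_proj p).mdifferentiableAt (by simp)
  have hA := mfderiv_comp z hpr hsy
  have hev : ((fun p : CotangentBundle J L => p.1) ∘ (extChartAt (cotangentModel J) p₀).symm) =ᶠ[𝓝 z]
      ((extChartAt J p₀.1).symm ∘ Prod.fst) := by
    filter_upwards [(isOpen_extChartAt_target p₀).mem_nhds hz] with u hu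
    have h1 := (extChartAt (cotangentModel J) p₀).map_target hu
    have h2 := (extChartAt (cotangentModel J) p₀).right_inv hu
    rw [extChartAt_cotangent_apply] at h2
    have h3 : extChartAt J p₀.1 ((extChartAt (cotangentModel J) p₀).symm u).1 = u.1 :=
      congrArg Prod.fst h2
    simp only [Function.comp_apply]
    rw [← h3, (extChartAt J p₀.1).left_inv (mem_extChartAt_cotangent_source.1 h1)]
  have hy : z.1 ∈ (extChartAt J p₀.1).target := hz1 ▸ (extChartAt J p₀.1).map_source hp1
  have hB := mfderiv_comp z (mdiff_symm (I := J) p₀.1 hy)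
    (hasFDerivAt_fst (𝕜 := ℝ) (p := z)).hasMFDerivAt.mdifferentiableAt
  have hC := hev.mfderiv_eq (I := 𝓘(ℝ, F × (F →L[ℝ] ℝ))) (I' := J)
  have hfst : mfderiv 𝓘(ℝ, F × (F →L[ℝ] ℝ)) 𝓘(ℝ, F) Prod.fst z =
    ContinuousLinearMap.fst ℝ F (F →L[ℝ] ℝ) := (hasFDerivAt_fst (𝕜 := ℝ) (p := z)).hasMFDerivAt.mfderiv
  ext v
  rw [← hz2]
  have h4 : ∀ w : F × (F →L[ℝ] ℝ), (show F from mfderiv (cotangentModel J) J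
      (fun p : CotangentBundle J L => p.1) p (chartSymmDiff (cotangentModel J) p₀ z w)) =
      chartSymmDiff J p₀.1 (extChartAt J p₀.1 p.1) w.1 := by
    intro w
    have h5 := (DFunLike.congr_fun hA w).symm.trans
      ((DFunLike.congr_fun hC w).trans (DFunLike.congr_fun hB w))
    refine Eq.trans h5 ?_
    have h6 := DFunLike.congr_fun hfst w
    refine (congrArg (show F →L[ℝ] F from mfderiv 𝓘(ℝ, F) J (extChartAt J p₀.1).symm z.1) h6).trans ?_
    exact congrArg (fun y => (show F →L[ℝ] F from chartSymmDiff J p₀.1 y) w.1) hz1.symm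
  exact congrArg (show F →L[ℝ] ℝ from p.2) (h4 (v 0))

theorem contDiff_oneFormCLE_symm {G : Type*} [NormedAddCommGroup G] [NormedSpace ℝ G] {n : WithTop ℕ∞} :
    ContDiff ℝ n (oneFormCLE G).symm :=
  (oneFormCLE G).symm.contDiff

theorem isSmoothForm_tautForm : IsSmoothForm (cotangentModel J) (tautForm J L) := by
  intro p₀
  refine ContDiffOn.congr ?_ fun z hz => chartForm_tautForm hz
  exact (contDiff_oneFormCLE_symm.comp
    (contDiff_snd.clm_comp contDiff_const)).contDiffOn

theorem rawPull_toSection_tautForm {α : ℝ → Om J L 1} (hα : IsSmoothFamily α) :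
    rawPull (I := 𝓘(ℝ, ℝ).prod J) (fun p : ℝ × L => toSection (α p.1) p.2) (tautForm J L) =
      (total hα).1 := by
  refine rawForm_ext fun p u => ?_
  have hA := mfderiv_comp p (contMDiff_cotangent_proj _ |>.mdifferentiableAt (by simp))
    ((contMDiff_toSection_family hα p).mdifferentiableAt (by simp))
  have h1 : mfderiv (𝓘(ℝ, ℝ).prod J) J (fun p : ℝ × L => p.2) p = ContinuousLinearMap.snd ℝ ℝ F :=
    mfderiv_snd
  have h2 : (show F from mfderiv (cotangentModel J) J (fun p : CotangentBundle J L => p.1)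
      (toSection (α p.1) p.2) (mfderiv (𝓘(ℝ, ℝ).prod J) (cotangentModel J)
        (fun p : ℝ × L => toSection (α p.1) p.2) p (u 0))) = (show ℝ × F from u 0).2 :=
    (DFunLike.congr_fun hA (u 0)).symm.trans (DFunLike.congr_fun h1 (u 0))
  refine (congrArg (show F →L[ℝ] ℝ from toCovector (α p.1) p.2) h2).trans ?_
  refine (toCovector_apply _ _ _).trans ?_
  refine congrArg ((α p.1).1 p.2) (funext fun i => ?_)
  rw [Subsingleton.elim i 0]
  rfl

/-- The pullback of `ω_can` along a family of sections. -/
theorem rawPull_toSection_canForm {α : ℝ → Om J L 1} (hα : IsSmoothFamily α) :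
    rawPull (I := 𝓘(ℝ, ℝ).prod J) (fun p : ℝ × L => toSection (α p.1) p.2) (canForm J L) =
      -(d (𝓘(ℝ, ℝ).prod J) (ℝ × L) 1 (total hα)).1 := by
  have h := congrArg Subtype.val
    (pull_d (contMDiff_toSection_family hα) ⟨tautForm J L, isSmoothForm_tautForm⟩)
  have h1 : pull (contMDiff_toSection_family hα) 1 ⟨tautForm J L, isSmoothForm_tautForm⟩ = total hα :=
    Subtype.ext (rawPull_toSection_tautForm hα)
  rw [h1] at h
  rw [← h]
  rfl

end Taut

end SymplecticDeformation

namespace SymplecticDeformation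

section Lines

variable {F : Type*} [NormedAddCommGroup F] [NormedSpace ℝ F]
  {K : Type*} [TopologicalSpace K] {J : ModelWithCorners ℝ F K} [J.Boundaryless]
  {L : Type*} [TopologicalSpace L] [ChartedSpace K L] [IsManifold J ∞ L]

/-- The straight line through `p` in the direction of the `1`-form `σ`. -/
noncomputable def vertLine (σ : Om J L 1) (p : CotangentBundle J L) (s : ℝ) : CotangentBundle J L :=
  ⟨p.1, p.2 + s • toCovector σ p.1⟩

theorem contMDiff_vertLine (σ : Om J L 1) (p : CotangentBundle J L) :
    ContMDiff 𝓘(ℝ, ℝ) (cotangentModel J) ∞ (vertLine σ p) := fun _ =>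
  contMDiffAt_cotangent_add_smul (f := fun _ => p) (c := fun _ => toCovector σ p.1)
    contMDiffAt_const contMDiffAt_id contMDiffAt_const

theorem vertLine_zero (σ : Om J L 1) (p : CotangentBundle J L) : vertLine σ p 0 = p := by
  obtain ⟨x, v⟩ := p
  simp only [vertLine, zero_smul, add_zero]

theorem vertLine_vertLine (σ : Om J L 1) (p : CotangentBundle J L) (s u : ℝ) :
    vertLine σ (vertLine σ p s) u = vertLine σ p (s + u) := by
  refine congrArg (Bundle.TotalSpace.mk p.1) ?_
  simp only [vertLine, add_smul]
  exact add_assoc _ _ _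

theorem vertLine_zeroSection (σ : Om J L 1) (x : L) (s : ℝ) :
    vertLine σ (zeroSection x) s = ⟨x, s • toCovector σ x⟩ :=
  congrArg (Bundle.TotalSpace.mk x) (zero_add _)

theorem vertLine_zeroSection_one (σ : Om J L 1) (x : L) :
    vertLine σ (zeroSection x) 1 = toSection σ x := by
  rw [vertLine_zeroSection, one_smul]; rfl

theorem mfderiv_vertLine (σ : Om J L 1) (p : CotangentBundle J L) (s : ℝ) :
    (show F × (F →L[ℝ] ℝ) from mfderiv 𝓘(ℝ, ℝ) (cotangentModel J) (vertLine σ p) s (1 : ℝ)) =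
      vertField σ (vertLine σ p s) := by
  have h1 : vertLine σ p = vertLine σ (vertLine σ p s) ∘ fun u => u - s := by
    funext u
    rw [Function.comp_apply, vertLine_vertLine, add_sub_cancel]
  have h2 : HasMFDerivAt 𝓘(ℝ, ℝ) 𝓘(ℝ, ℝ) (fun u : ℝ => u - s) s (ContinuousLinearMap.id ℝ ℝ) :=
    ((hasFDerivAt_id s).sub_const s).hasMFDerivAt
  have h3 := HasMFDerivAt.comp s (f := fun u : ℝ => u - s)
    ((contMDiff_vertLine σ (vertLine σ p s) (s - s)).mdifferentiableAt (by simp)).hasMFDerivAt h2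
  rw [← h1] at h3
  refine (DFunLike.congr_fun h3.mfderiv (1 : ℝ)).trans ?_
  have h4 : s - s = 0 := sub_self s
  exact congrArg (fun r => (show F × (F →L[ℝ] ℝ) from
    mfderiv 𝓘(ℝ, ℝ) (cotangentModel J) (vertLine σ (vertLine σ p s)) r (1 : ℝ))) h4

theorem contMDiff_vertLine_family {α : ℝ → Om J L 1} (hα : IsSmoothFamily α) :
    ContMDiff (𝓘(ℝ, ℝ).prod (𝓘(ℝ, ℝ).prod (cotangentModel J))) (cotangentModel J) ∞
      fun q : ℝ × ℝ × CotangentBundle J L => vertLine (α q.2.1) q.2.2 q.1 := fun _ =>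
  contMDiffAt_cotangent_add_smul (f := fun q : ℝ × ℝ × CotangentBundle J L => q.2.2)
    (s := fun q => q.1) (c := fun q => toCovector (α q.2.1) q.2.2.1)
    contMDiff_snd.snd.contMDiffAt contMDiffAt_fst
    ((contMDiff_toSection_family hα).comp (contMDiff_snd.fst.prodMk
      (contMDiff_cotangent_proj.comp contMDiff_snd.snd))).contMDiffAt

end Lines

section FlowOut

variable {E : Type*} [NormedAddCommGroup E] [NormedSpace ℝ E] [FiniteDimensional ℝ E]
  {H : Type*} [TopologicalSpace H] {I : ModelWithCorners ℝ E H} [I.Boundaryless]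
  {M : Type*} [TopologicalSpace M] [ChartedSpace H M] [IsManifold I ∞ M]
  {F : Type*} [NormedAddCommGroup F] [NormedSpace ℝ F]
  {K : Type*} [TopologicalSpace K] {J : ModelWithCorners ℝ F K} [J.Boundaryless]
  {L : Type*} [TopologicalSpace L] [ChartedSpace K L] [IsManifold J ∞ L]

theorem timeOneFlow_eq [T2Space M] {V : (x : M) → TangentSpace I x} (hV : IsSmoothField I V)
    {γ : ℝ → M} (hγ : IsMIntegralCurve γ V) : timeOneFlow I V (γ 0) = γ 1 := by
  have h : ∃ γ' : ℝ → M, γ' 0 = γ 0 ∧ IsMIntegralCurve (I := I) γ' V := ⟨γ, rfl, hγ⟩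
  rw [timeOneFlow, dif_pos h]
  exact congrFun (isMIntegralCurve_Ioo_eq_of_contMDiff_boundaryless (t₀ := 0) hV.one
    h.choose_spec.2 hγ h.choose_spec.1) 1

namespace WeinsteinData

variable {ι : L → M} {ω₀ : Om I M 2} (W : WeinsteinData (J := J) ι ω₀)

/-- The vector field `f · ψ_* X_σ` on `M`. -/
noncomputable def fieldOf (σ : Om J L 1) (y : M) : TangentSpace I y :=
  open Classical in
  if y ∈ W.ψ.target then
    (W.f y • mfderiv (cotangentModel J) I W.ψ (W.ψ.symm y) (vertField σ (W.ψ.symm y)) : E)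
  else 0

theorem fieldOf_of_mem (σ : Om J L 1) {y : M} (hy : y ∈ W.ψ.target) :
    (show E from W.fieldOf σ y) = W.f y • (show E from
      mfderiv (cotangentModel J) I W.ψ (W.ψ.symm y) (vertField σ (W.ψ.symm y))) := if_pos hy

theorem fieldOf_eq_zero (σ : Om J L 1) {y : M} (hy : W.f y = 0) : W.fieldOf σ y = 0 := by
  by_cases h : y ∈ W.ψ.target
  · refine (W.fieldOf_of_mem σ h).trans ?_
    rw [hy]
    exact zero_smul ℝ _
  · exact if_neg h

theorem V'_subset : W.V' ⊆ W.ψ.source := subset_closure.trans W.closure_V'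

theorem contMDiffAt_ψ {p : CotangentBundle J L} (hp : p ∈ W.ψ.source) :
    ContMDiffAt (cotangentModel J) I ∞ W.ψ p :=
  W.contMDiffOn_ψ.contMDiffAt (W.ψ.open_source.mem_nhds hp)

theorem contMDiffAt_ψ_symm {y : M} (hy : y ∈ W.ψ.target) :
    ContMDiffAt I (cotangentModel J) ∞ W.ψ.symm y :=
  W.contMDiffOn_ψ_symm.contMDiffAt (W.ψ.open_target.mem_nhds hy)

theorem isSmoothFieldFamily_fieldOf {α : ℝ → Om J L 1} (hα : IsSmoothFamily α) :
    IsSmoothFieldFamily I fun p : ℝ × M => W.fieldOf (α p.1) p.2 := by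
  rintro ⟨t₀, y₀⟩
  by_cases hy₀ : y₀ ∈ W.ψ.target
  · let Kf : ℝ × ℝ × M → M := fun q => W.ψ (vertLine (α q.2.1) (W.ψ.symm q.2.2) q.1)
    have hev : ∀ᶠ p : ℝ × M in 𝓝 (t₀, y₀), p.2 ∈ W.ψ.target :=
      continuous_snd.continuousAt.eventually (W.ψ.open_target.mem_nhds hy₀)
    have hin : ∀ p : ℝ × M, p.2 ∈ W.ψ.target → ContMDiffAt (𝓘(ℝ, ℝ).prod (𝓘(ℝ, ℝ).prod I))
        (cotangentModel J) ∞
        (fun q : ℝ × ℝ × M => vertLine (α q.2.1) (W.ψ.symm q.2.2) q.1) (0, p) := by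
      intro p hp
      have h1 : ContMDiffAt (𝓘(ℝ, ℝ).prod (𝓘(ℝ, ℝ).prod I))
          (𝓘(ℝ, ℝ).prod (𝓘(ℝ, ℝ).prod (cotangentModel J))) ∞
          (fun q : ℝ × ℝ × M => (q.1, q.2.1, W.ψ.symm q.2.2)) (0, p) :=
        contMDiffAt_fst.prodMk (contMDiff_snd.fst.contMDiffAt.prodMk
          (ContMDiffAt.comp ((0 : ℝ), p) (W.contMDiffAt_ψ_symm hp) contMDiff_snd.snd.contMDiffAt))
      exact ContMDiffAt.comp ((0 : ℝ), p) (contMDiff_vertLine_family hα _) h1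
    have hK : ∀ p : ℝ × M, p.2 ∈ W.ψ.target →
        ContMDiffAt (𝓘(ℝ, ℝ).prod (𝓘(ℝ, ℝ).prod I)) I ∞ Kf (0, p) := by
      intro p hp
      refine ContMDiffAt.comp ((0 : ℝ), p) (W.contMDiffAt_ψ ?_) (hin p hp)
      rw [vertLine_zero]
      exact W.ψ.map_target hp
    have hK0 : ∀ p : ℝ × M, p.2 ∈ W.ψ.target → Kf (0, p) = p.2 := by
      intro p hp
      simp only [Kf, vertLine_zero]
      exact W.ψ.right_inv hp
    have h1 := contMDiffAt_deriv_param (hev.mono hK)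
    have h2 := contMDiffAt_tangentBundle_iff.1 h1
    refine contMDiffAt_tangentBundle_iff.2 ⟨contMDiffAt_snd, ?_⟩
    have h3 : ContMDiffAt (𝓘(ℝ, ℝ).prod I) 𝓘(ℝ, ℝ) ∞ (fun p : ℝ × M => W.f p.2) (t₀, y₀) :=
      (W.contMDiff_f.comp contMDiff_snd).contMDiffAt
    refine (h3.smul h2.2).congr_of_eventuallyEq ?_
    filter_upwards [hev] with p hp
    have h4 := hK p hp
    have hψ := W.contMDiffAt_ψ (W.ψ.map_target hp)
    have h5 := (hψ.mdifferentiableAt (by simp)).hasMFDerivAt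
    have h6 := ((contMDiff_vertLine (α p.1) (W.ψ.symm p.2) 0).mdifferentiableAt (by simp)).hasMFDerivAt
    have h7 : HasMFDerivAt (cotangentModel J) I W.ψ (vertLine (α p.1) (W.ψ.symm p.2) 0)
        (mfderiv (cotangentModel J) I W.ψ (W.ψ.symm p.2)) := by rwa [vertLine_zero]
    have hd := (mfderiv_time (h4.mdifferentiableAt (by simp))).symm.trans
      (DFunLike.congr_fun (HasMFDerivAt.comp (0 : ℝ) h7 h6).mfderiv (1 : ℝ))
    have h8 : (show E from W.fieldOf (α p.1) p.2) = W.f p.2 •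
        (show E from mfderiv (cotangentModel J) I W.ψ (W.ψ.symm p.2)
          (vertField (α p.1) (W.ψ.symm p.2))) := W.fieldOf_of_mem (α p.1) hp
    have h9 := h8.trans (congrArg (fun w : E => W.f p.2 • w) hd).symm
    have hcongr : ∀ {a a' b b' : M} (w : E), a = a' → b = b' →
        (show E →L[ℝ] E from chartDiff I a b) w = (show E →L[ℝ] E from chartDiff I a' b') w := by
      rintro a a' b b' w rfl rfl; rfl
    refine (congrArg (show E →L[ℝ] E from chartDiff I y₀ p.2) h9).trans ?_
    refine ((show E →L[ℝ] E from chartDiff I y₀ p.2).map_smul (W.f p.2) _).trans ?_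
    exact congrArg (W.f p.2 • ·) (hcongr _ (hK0 (t₀, y₀) hy₀).symm (hK0 p hp).symm)
  · have h0 : y₀ ∈ (tsupport W.f)ᶜ := fun h => hy₀ (W.tsupport_f h)
    have h1 : ∀ᶠ p : ℝ × M in 𝓝 (t₀, y₀), p.2 ∈ (tsupport W.f)ᶜ :=
      continuous_snd.continuousAt.eventually ((isClosed_tsupport W.f).isOpen_compl.mem_nhds h0)
    have h2 : ContMDiffAt (𝓘(ℝ, ℝ).prod I) I.tangent ∞
        (fun p : ℝ × M => (⟨p.2, 0⟩ : TangentBundle I M)) (t₀, y₀) :=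
      ((Bundle.contMDiff_zeroSection ℝ (TangentSpace I : M → Type _)).comp contMDiff_snd).contMDiffAt
    refine h2.congr_of_eventuallyEq ?_
    filter_upwards [h1] with p hp
    exact congrArg (Bundle.TotalSpace.mk p.2)
      (W.fieldOf_eq_zero (α p.1) (image_eq_zero_of_notMem_tsupport hp))

theorem toSection_injOn {σ σ' : Om J L 1} (hσ : σ ∈ W.sections) (hσ' : σ' ∈ W.sections)
    (h : W.graph σ = W.graph σ') : σ = σ' := by
  have h1 : ∀ x, toSection σ x = toSection σ' x := by
    intro x
    obtain ⟨x', hx'⟩ : W.ψ (toSection σ x) ∈ W.graph σ' := h ▸ mem_range_self x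
    have h2 := W.ψ.injOn (W.V'_subset (hσ' x')) (W.V'_subset (hσ x)) hx'
    obtain rfl : x' = x := congrArg (fun p : CotangentBundle J L => p.1) h2
    exact h2.symm
  refine om_ext fun x u => ?_
  have h3 : toCovector σ x = toCovector σ' x := by
    have := h1 x
    simpa only [toSection, Bundle.TotalSpace.mk.injEq, heq_eq_eq, true_and] using this
  have h4 : u = fun _ => u 0 := funext fun i => by rw [Subsingleton.elim i 0]
  rw [h4, ← toCovector_apply, ← toCovector_apply, h3]

theorem sectionOf_graph {σ : Om J L 1} (hσ : σ ∈ W.sections) : W.sectionOf (W.graph σ) = σ := by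
  have h : ∃ σ' ∈ W.sections, W.graph σ = W.graph σ' := ⟨σ, hσ, rfl⟩
  have h1 : W.sectionOf (W.graph σ) = h.choose := dif_pos h
  rw [h1]
  exact W.toSection_injOn h.choose_spec.1 hσ h.choose_spec.2.symm

theorem field_graph {σ : Om J L 1} (hσ : σ ∈ W.sections) : W.field (W.graph σ) = W.fieldOf σ := by
  have h : W.field (W.graph σ) = W.fieldOf (W.sectionOf (W.graph σ)) := rfl
  rw [h, W.sectionOf_graph hσ]

theorem zero_mem_sections : (0 : Om J L 1) ∈ W.sections := W.zero_mem_V'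

theorem graph_zero_eq : W.graph 0 = range ι :=
  congrArg range (funext fun x => W.ψ_zero x)

theorem vertField_zero (p : CotangentBundle J L) : vertField (0 : Om J L 1) p = 0 := by
  have h : (fun s : ℝ => (⟨p.1, p.2 + s • toCovector (0 : Om J L 1) p.1⟩ : CotangentBundle J L)) =
      fun _ => p := by
    funext s
    refine congrArg (Bundle.TotalSpace.mk p.1) ?_
    have : toCovector (0 : Om J L 1) p.1 = 0 := rfl
    rw [this, smul_zero, add_zero]
  have h1 : mfderiv 𝓘(ℝ, ℝ) (cotangentModel J) (fun _ : ℝ => p) 0 = 0 := mfderiv_const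
  unfold vertField
  rw [h]
  exact DFunLike.congr_fun h1 (1 : ℝ)

theorem fieldOf_zero (y : M) : W.fieldOf (0 : Om J L 1) y = 0 := by
  by_cases h : y ∈ W.ψ.target
  · refine (W.fieldOf_of_mem 0 h).trans ?_
    rw [vertField_zero]
    refine (congrArg (W.f y • ·) (map_zero (mfderiv (cotangentModel J) I W.ψ (W.ψ.symm y)))).trans ?_
    exact smul_zero (A := E) _
  · exact if_neg h

/-- Inside `U'`, the integral curves of `ψ_* X_σ` are images of straight lines. -/
theorem hasMFDerivAt_vertLine (σ : Om J L 1) {x : L} {s : ℝ}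
    (hs : vertLine σ (zeroSection x) s ∈ W.V') :
    HasMFDerivAt 𝓘(ℝ, ℝ) I (fun s => W.ψ (vertLine σ (zeroSection x) s)) s
      ((1 : ℝ →L[ℝ] ℝ).smulRight (W.fieldOf σ (W.ψ (vertLine σ (zeroSection x) s)))) := by
  set p := vertLine σ (zeroSection x) s with hp
  have hps := W.V'_subset hs
  have h1 := ((contMDiff_vertLine σ (zeroSection x) s).mdifferentiableAt (by simp)).hasMFDerivAt
  have h2 := ((W.contMDiffAt_ψ hps).mdifferentiableAt (by simp)).hasMFDerivAt
  refine (HasMFDerivAt.comp s h2 h1).congr_mfderiv ?_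
  refine ContinuousLinearMap.ext_ring ?_
  have h3 : (show E from W.fieldOf σ (W.ψ p)) = (show E from
      mfderiv (cotangentModel J) I W.ψ p (vertField σ p)) := by
    refine (W.fieldOf_of_mem σ (W.ψ.map_source hps)).trans ?_
    rw [W.f_eq_one _ (subset_closure (mem_image_of_mem _ hs)), W.ψ.left_inv hps]
    exact one_smul ℝ _
  have h4 := congrArg (show F × (F →L[ℝ] ℝ) →L[ℝ] E from mfderiv (cotangentModel J) I W.ψ p)
    (mfderiv_vertLine σ (zeroSection x) s)
  refine (h4.trans h3.symm).trans ?_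
  exact (one_smul ℝ (show E from W.fieldOf σ (W.ψ p))).symm

theorem vertLine_mem_V' {σ : Om J L 1} (hσ : σ ∈ W.sections) (x : L) {s : ℝ} (hs : s ∈ Icc (0 : ℝ) 1) :
    vertLine σ (zeroSection x) s ∈ W.V' := by
  have h := (W.convex_V' x) (W.zero_mem_V' x) (hσ x) (sub_nonneg.2 hs.2) hs.1 (sub_add_cancel 1 s)
  rw [vertLine_zeroSection]
  rw [smul_zero, zero_add] at h
  exact h

variable [T2Space M]

/-- The flow of `f · ψ_* X_σ` moves `L` to the graph of `σ` in time `1`. -/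
theorem integralCurve_at_one {σ : Om J L 1} (hσ : σ ∈ W.sections) (hV : IsSmoothField I (W.fieldOf σ))
    {x : L} {γ : ℝ → M} (hγ : IsMIntegralCurve γ (W.fieldOf σ)) (h0 : γ 0 = ι x) :
    γ 1 = W.ψ (toSection σ x) := by
  let S : Set ℝ := vertLine σ (zeroSection x) ⁻¹' W.V'
  have hSo : IsOpen S := W.isOpen_V'.preimage (contMDiff_vertLine σ (zeroSection x)).continuous
  have hS : Icc 0 1 ⊆ S := fun s hs => W.vertLine_mem_V' hσ x hs
  obtain ⟨δ, hδ, hδS⟩ : ∃ δ > 0, Ioo (-δ) (1 + δ) ⊆ S := by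
    obtain ⟨δ, hδ, h⟩ := isCompact_Icc.exists_thickening_subset_open hSo hS
    refine ⟨δ, hδ, fun s hs => h (Metric.mem_thickening_iff.2 ⟨max 0 (min s 1), ⟨le_max_left _ _,
      max_le zero_le_one (min_le_right _ _)⟩, ?_⟩)⟩
    rw [Real.dist_eq, abs_lt]
    have h1 := hs.1
    have h2 := hs.2
    rcases le_total s 1 with h3 | h3
    · rw [min_eq_left h3]
      rcases le_total 0 s with h4 | h4
      · rw [max_eq_right h4]; constructor <;> linarith
      · rw [max_eq_left h4]; constructor <;> linarith
    · rw [min_eq_right h3, max_eq_right zero_le_one]; constructor <;> linarith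
  have h1 : IsMIntegralCurveOn (fun s => W.ψ (vertLine σ (zeroSection x) s)) (W.fieldOf σ)
      (Ioo (-δ) (1 + δ)) := fun s hs => (W.hasMFDerivAt_vertLine σ (hδS hs)).hasMFDerivWithinAt
  have h2 := isMIntegralCurveOn_Ioo_eqOn_of_contMDiff_boundaryless (t₀ := 0)
    ⟨by linarith, by linarith⟩ hV.one (hγ.isMIntegralCurveOn _) h1
    (by rw [h0, vertLine_zero, W.ψ_zero])
  have h3 := h2 (show (1 : ℝ) ∈ Ioo (-δ) (1 + δ) from ⟨by linarith, by linarith⟩)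
  rw [h3]
  exact congrArg W.ψ (vertLine_zeroSection_one σ x)

variable [CompactSpace M]

/-- A smooth family of `1`-forms gives rise to a smooth family of diffeomorphisms of `M`. -/
theorem exists_flowOut {α : ℝ → Om J L 1} (hα : IsSmoothFamily α) :
    ∃ φ φ' : ℝ × M → M, ContMDiff (𝓘(ℝ, ℝ).prod I) I ∞ φ ∧ ContMDiff (𝓘(ℝ, ℝ).prod I) I ∞ φ' ∧
      (∀ t y, φ (t, φ' (t, y)) = y) ∧ (∀ t y, φ' (t, φ (t, y)) = y) ∧
      (∀ t, α t = 0 → ∀ y, φ (t, y) = y) ∧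
      ∀ t, α t ∈ W.sections → (∀ x, φ (t, ι x) = W.ψ (toSection (α t) x)) ∧
        W.φ (W.graph (α t)) = fun y => φ (t, y) := by
  have hV := W.isSmoothFieldFamily_fieldOf hα
  obtain ⟨Fl, hs, h0, hγ, hadd⟩ := exists_smooth_flow_family hV
  have hsl : ∀ r : ℝ, ContMDiff (𝓘(ℝ, ℝ).prod I) I ∞ fun p : ℝ × M => Fl (r, p) := fun r =>
    hs.comp (contMDiff_const.prodMk contMDiff_id)
  refine ⟨fun p => Fl (1, p), fun p => Fl (-1, p), hsl 1, hsl (-1), fun t y => ?_, fun t y => ?_,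
    fun t ht y => ?_, fun t ht => ⟨fun x => ?_, ?_⟩⟩
  · exact (hadd 1 (-1) t y).symm.trans (by rw [add_neg_cancel, h0])
  · exact (hadd (-1) 1 t y).symm.trans (by rw [neg_add_cancel, h0])
  · have h1 : IsMIntegralCurve (I := I) (fun _ : ℝ => y) (fun y => W.fieldOf (α t) y) := by
      intro s
      refine (hasMFDerivAt_const y s).congr_mfderiv ?_
      refine ContinuousLinearMap.ext_ring ?_
      have h2 : W.fieldOf (α t) y = 0 := by rw [ht]; exact W.fieldOf_zero y
      refine Eq.symm ?_
      exact (congrArg (fun w : E => (1 : ℝ) • w) h2).trans (smul_zero (A := E) (1 : ℝ))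
    exact congrFun (isMIntegralCurve_Ioo_eq_of_contMDiff_boundaryless (t₀ := 0)
      (hV.isSmoothField t).one (hγ t y) h1 (h0 t y)) 1
  · exact W.integralCurve_at_one ht (hV.isSmoothField t) (hγ t (ι x)) (h0 t (ι x))
  · funext y
    have h1 := timeOneFlow_eq (hV.isSmoothField t) (hγ t y)
    rw [WeinsteinData.φ, W.field_graph ht]
    simpa only [h0] using h1

end WeinsteinData

end FlowOut

end SymplecticDeformation

namespace SymplecticDeformation

section Diffeo

variable {E : Type*} [NormedAddCommGroup E] [NormedSpace ℝ E]
  {H : Type*} [TopologicalSpace H] {I : ModelWithCorners ℝ E H} [I.Boundaryless]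
  {M : Type*} [TopologicalSpace M] [ChartedSpace H M] [IsManifold I ∞ M]
  {F : Type*} [NormedAddCommGroup F] [NormedSpace ℝ F]
  {K : Type*} [TopologicalSpace K] {J : ModelWithCorners ℝ F K} [J.Boundaryless]
  {L : Type*} [TopologicalSpace L] [ChartedSpace K L] [IsManifold J ∞ L]

omit [I.Boundaryless] [IsManifold I ∞ M] in
theorem mfderiv_mfderiv_of_leftInverse {g g' : M → M} {x : M} (hg : MDifferentiableAt I I g x)
    (hg' : MDifferentiableAt I I g' (g x)) (h : ∀ x, g' (g x) = x) (v : TangentSpace I x) :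
    (show E from mfderiv I I g' (g x) (mfderiv I I g x v)) = v := by
  have h1 := mfderiv_comp x hg' hg
  have h2 : g' ∘ g = id := funext h
  rw [h2, mfderiv_id] at h1
  exact (DFunLike.congr_fun h1 v).symm

/-- Pullbacks of symplectic forms along diffeomorphisms are symplectic. -/
theorem IsSymplectic.pull {η : Om I M 2} (h : IsSymplectic η) {g g' : M → M} (hg : ContMDiff I I ∞ g)
    (hg' : ContMDiff I I ∞ g') (h1 : ∀ x, g (g' x) = x) (h2 : ∀ x, g' (g x) = x) :
    IsSymplectic (SymplecticDeformation.pull hg 2 η) := by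
  refine ⟨by rw [← pull_d, h.1, map_zero], fun x v hv => ?_⟩
  have d1 : ∀ x, MDifferentiableAt I I g x := fun x => (hg x).mdifferentiableAt (by simp)
  have d2 : ∀ x, MDifferentiableAt I I g' x := fun x => (hg' x).mdifferentiableAt (by simp)
  have h3 : mfderiv I I g x v = 0 := by
    refine h.2 (g x) _ fun w => ?_
    have h4 := hv (mfderiv I I g' (g x) w)
    have h5 : (show E from mfderiv I I g x (mfderiv I I g' (g x) w)) = w := by
      have h6 := mfderiv_mfderiv_of_leftInverse (d2 (g x)) (d1 _) h1 w
      have h7 : ∀ {a b : M} (u : E), a = b → (show E →L[ℝ] E from mfderiv I I g a) u =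
        (show E →L[ℝ] E from mfderiv I I g b) u := by rintro a b u rfl; rfl
      exact (h7 _ (h2 x).symm).trans h6
    refine Eq.trans ?_ h4
    refine congrArg (η.1 (g x)) (funext fun i => ?_)
    refine Fin.cases rfl (fun j => ?_) i
    rw [Subsingleton.elim j 0]
    exact h5.symm
  have h4 := mfderiv_mfderiv_of_leftInverse (d1 x) (d2 _) h2 v
  refine h4.symm.trans ?_
  exact (congrArg (mfderiv I I g' (g x)) h3).trans (map_zero _)

theorem contr_pull_prod {k : ℕ} {ι : L → M} (hι : ContMDiff J I ∞ ι)
    (Ω : Om (𝓘(ℝ, ℝ).prod I) (ℝ × M) (k + 1)) (t : ℝ) :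
    contr t (pull (contMDiff_timeMap (φ := fun p : ℝ × L => ι p.2) (hι.comp contMDiff_snd)) (k + 1) Ω) =
      pull hι k (contr t Ω) := by
  refine om_ext fun x u => ?_
  have hφ : ContMDiff (𝓘(ℝ, ℝ).prod J) I ∞ (fun p : ℝ × L => ι p.2) := hι.comp contMDiff_snd
  have hd := (hφ (t, x)).mdifferentiableAt (by simp)
  have h1 : ∀ v : ℝ × F, (show E from mfderiv (𝓘(ℝ, ℝ).prod J) I (fun p : ℝ × L => ι p.2) (t, x) v) =
      mfderiv J I ι x v.2 := by
    intro v
    have h0 : MDifferentiableAt (𝓘(ℝ, ℝ).prod J) J (fun p : ℝ × L => p.2) (t, x) :=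
      mdifferentiableAt_snd
    have h2 := mfderiv_comp (t, x) (g := ι) (f := fun p : ℝ × L => p.2)
      ((hι x).mdifferentiableAt (by simp)) h0
    have h3 : mfderiv (𝓘(ℝ, ℝ).prod J) J (fun p : ℝ × L => p.2) (t, x) =
      ContinuousLinearMap.snd ℝ ℝ F := mfderiv_snd
    refine (DFunLike.congr_fun h2 v).trans ?_
    exact congrArg (mfderiv J I ι x) (DFunLike.congr_fun h3 v)
  refine congrArg (show (ℝ × E) [⋀^Fin (k + 1)]→L[ℝ] ℝ from Ω.1 (t, ι x)) (funext fun i => ?_)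
  refine Fin.cases ?_ (fun j => ?_) i
  · refine (mfderiv_timeMap hd _).trans (Prod.ext rfl ?_)
    exact (h1 _).trans (map_zero _)
  · exact (mfderiv_timeMap hd _).trans (Prod.ext rfl (h1 _))

theorem contr_pull_restrict {k : ℕ} {ι : L → M} (hι : ContMDiff J I ∞ ι) {φ : ℝ × M → M}
    (hφ : ContMDiff (𝓘(ℝ, ℝ).prod I) I ∞ φ) {κ : ℝ × L → M} (hκ : ContMDiff (𝓘(ℝ, ℝ).prod J) I ∞ κ)
    (h : ∀ p : ℝ × L, κ p = φ (p.1, ι p.2)) (η : Om I M (k + 1)) (t : ℝ) :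
    pull hι k (contr t (pull hφ (k + 1) η)) = contr t (pull hκ (k + 1) η) := by
  rw [← contr_pull_prod, ← pull_comp _ hφ (contMDiff_timeMap (φ := fun p : ℝ × L => ι p.2)
    (hι.comp contMDiff_snd)) (hφ.comp (contMDiff_timeMap (hι.comp contMDiff_snd)))]
  congr 2
  have h1 : κ = φ ∘ timeMap (fun p : ℝ × L => ι p.2) := funext h
  subst h1
  rfl

end Diffeo

section Paths

variable {E : Type*} [NormedAddCommGroup E] [NormedSpace ℝ E] [FiniteDimensional ℝ E]
  {H : Type*} [TopologicalSpace H] {I : ModelWithCorners ℝ E H} [I.Boundaryless]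
  {M : Type*} [TopologicalSpace M] [ChartedSpace H M] [IsManifold I ∞ M] [T2Space M] [CompactSpace M]
  {F : Type*} [NormedAddCommGroup F] [NormedSpace ℝ F]
  {K : Type*} [TopologicalSpace K] {J : ModelWithCorners ℝ F K} [J.Boundaryless]
  {L : Type*} [TopologicalSpace L] [ChartedSpace K L] [IsManifold J ∞ L] [CompactSpace L]

namespace WeinsteinData

variable {ι : L → M} {ω₀ : Om I M 2} (W : WeinsteinData (J := J) ι ω₀)

theorem eventually_mem_sections {α : ℝ → Om J L 1} (hα : IsSmoothFamily α) {t₀ : ℝ}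
    (h : α t₀ ∈ W.sections) : ∀ᶠ t in 𝓝 t₀, α t ∈ W.sections := by
  have h1 := isCompact_univ.eventually_forall_of_forall_eventually (x₀ := t₀)
    (P := fun t x => toSection (α t) x ∈ W.V') fun x (_ : x ∈ (univ : Set L)) =>
      ((contMDiff_toSection_family hα).continuous.continuousAt (x := (t₀, x))).eventually
        (W.isOpen_V'.mem_nhds (h x))
  filter_upwards [h1] with t ht x using ht x (mem_univ x)

theorem contMDiff_ψ_toSection {σ : Om J L 1} (hσ : σ ∈ W.sections) :
    ContMDiff J I ∞ fun x => W.ψ (toSection σ x) := fun x =>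
  ContMDiffAt.comp x (W.contMDiffAt_ψ (W.V'_subset (hσ x))) (contMDiff_toSection σ x)

theorem contr_pull_ψ_toSection {α : ℝ → Om J L 1} (hα : IsSmoothFamily α) (h0 : α 0 ∈ W.sections)
    {κ : ℝ × L → M} (hκ : ContMDiff (𝓘(ℝ, ℝ).prod J) I ∞ κ)
    (h : ∀ t, α t ∈ W.sections → ∀ x, κ (t, x) = W.ψ (toSection (α t) x)) :
    contr 0 (pull hκ 2 ω₀) = -velocity hα := by
  refine om_ext fun x u => ?_
  have hev : κ =ᶠ[𝓝 (0, x)] W.ψ ∘ fun p : ℝ × L => toSection (α p.1) p.2 := by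
    have hc : Tendsto (fun p : ℝ × L => p.1) (𝓝 (0, x)) (𝓝 0) := continuous_fst.tendsto (0, x)
    filter_upwards [hc.eventually (W.eventually_mem_sections hα h0)] with p hp
    exact h p.1 hp p.2
  have hA := (contMDiff_toSection_family hα (0, x)).mdifferentiableAt (by simp)
  have h1 : rawPull (I := 𝓘(ℝ, ℝ).prod J) κ ω₀.1 (0, x) =
      (-(d (𝓘(ℝ, ℝ).prod J) (ℝ × L) 1 (total hα)).1) (0, x) := by
    rw [← rawPull_toSection_canForm hα, rawPull_congr _ hev]
    refine (rawPull_comp_apply _ ?_ hA).trans ?_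
    · exact (W.contMDiffAt_ψ (W.V'_subset (h0 x))).mdifferentiableAt (by simp)
    · exact congrArg (fun θ => ContinuousAlternatingMap.compContinuousLinearMap θ _)
        (W.ψ_symplectic _ (W.V'_subset (h0 x)))
  exact DFunLike.congr_fun h1 _

theorem IsPairPath.section_zero {ε : ℝ} {η : ℝ → Om I M 2} {α : ℝ → Om J L 1} {W : WeinsteinData ι ω₀}
    (hp : W.IsPairPath ε η α) : α 0 = 0 :=
  W.toSection_injOn (hp.mem_sections 0 ⟨le_rfl, hp.pos.le⟩) W.zero_mem_sections
    (hp.graph_zero.trans W.graph_zero_eq.symm)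

theorem rawPull_graph_eq_zero {η : Om I M 2} {σ : Om J L 1} (hσ : σ ∈ W.sections)
    (h : (η, W.graph σ) ∈ W.pairs) : pull (W.contMDiff_ψ_toSection hσ) 2 η = 0 := by
  obtain ⟨-, σ', hσ', h1, h2⟩ := h
  obtain rfl := W.toSection_injOn hσ hσ' h1
  exact Subtype.ext h2

/-- The image under `q` of a smooth path of pairs is a smooth path of forms for which `L` is
Lagrangian, with derivative `v + dc`, where `c` is a `1`-form with pullback `-β` to `L`. -/
theorem IsPairPath.exists_lagPath (hι : ContMDiff J I ∞ ι) {ε : ℝ} {η : ℝ → Om I M 2} {α : ℝ → Om J L 1}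
    {W : WeinsteinData ι ω₀} (hp : W.IsPairPath ε η α) :
    ∃ (φ φ' : ℝ × M → M) (hφ : ContMDiff (𝓘(ℝ, ℝ).prod I) I ∞ φ)
      (_ : ContMDiff (𝓘(ℝ, ℝ).prod I) I ∞ φ'),
      (∀ t y, φ (t, φ' (t, y)) = y) ∧ (∀ t y, φ' (t, φ (t, y)) = y) ∧ (∀ y, φ (0, y) = y) ∧
      (∀ t ∈ Icc 0 ε, ∀ x, φ (t, ι x) = W.ψ (toSection (α t) x)) ∧
      (∀ t ∈ Icc 0 ε, W.φ (W.graph (α t)) = fun y => φ (t, y)) ∧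
      IsLagPath hι ω₀ ε (fun t => pull (contMDiff_at_time hφ t) 2 (η t)) ∧
      ∀ v β, IsVelocity η v → IsVelocity α β → ∃ c : Om I M 1, pull hι 1 c = -β ∧
        IsVelocity (fun t => pull (contMDiff_at_time hφ t) 2 (η t)) (v + d I M 1 c) := by
  obtain ⟨φ, φ', hφ, hφ', h1, h2, h0, h3⟩ := W.exists_flowOut hp.smooth_section
  have h0' : ∀ y, φ (0, y) = y := h0 0 hp.section_zero
  refine ⟨φ, φ', hφ, hφ', h1, h2, h0', fun t ht => (h3 t (hp.mem_sections t ht)).1,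
    fun t ht => (h3 t (hp.mem_sections t ht)).2,
    ⟨hp.pos, hp.smooth_form.pull_time hφ, fun t ht => ⟨?_, ?_⟩, ?_⟩, fun v β hv hβ => ?_⟩
  · exact IsSymplectic.pull (hp.mem_pairs t ht).1 _ (contMDiff_at_time hφ' t) (h1 t) (h2 t)
  · have hs := hp.mem_sections t ht
    rw [← pull_comp _ (contMDiff_at_time hφ t) hι ((contMDiff_at_time hφ t).comp hι)]
    have h4 : (fun x => φ (t, x)) ∘ ι = fun x => W.ψ (toSection (α t) x) := funext (h3 t hs).1
    have h5 := W.rawPull_graph_eq_zero hs (hp.mem_pairs t ht)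
    refine Subtype.ext ?_
    refine Eq.trans ?_ (congrArg Subtype.val h5)
    change rawPull ((fun x => φ (t, x)) ∘ ι) (η t).1 = rawPull _ (η t).1
    rw [h4]
  · rw [hp.form_zero]
    exact pull_eq_self _ _ (funext h0')
  · have hκ : ContMDiff (𝓘(ℝ, ℝ).prod J) I ∞ fun p : ℝ × L => φ (p.1, ι p.2) :=
      hφ.comp (contMDiff_fst.prodMk (hι.comp contMDiff_snd))
    refine ⟨contr 0 (pull hφ 2 ω₀), ?_, ?_⟩
    · rw [contr_pull_restrict hι hφ hκ fun _ => rfl,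
        W.contr_pull_ψ_toSection hp.smooth_section (hp.mem_sections 0 ⟨le_rfl, hp.pos.le⟩) hκ
          fun t ht x => (h3 t ht).1 x, (isVelocity_velocity hp.smooth_section).unique hβ]
    · have h4 := hv.pull_time hφ hp.smooth_form (hp.mem_pairs 0 ⟨le_rfl, hp.pos.le⟩).1.1
      rw [hp.form_zero, pull_eq_self _ _ (funext h0')] at h4
      exact h4

end WeinsteinData

/-- First order deformations in `lagForms` are relative cocycles. -/
theorem lagVelocities_subset {ι : L → M} (hι : ContMDiff J I ∞ ι) {ω₀ : Om I M 2} :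
    lagVelocities hι ω₀ ⊆ relZ hι := by
  rintro v ⟨ε, η, hη, hv⟩
  refine ⟨?_, ?_⟩
  · exact (hv.pull hι).eq_zero_of_const hη.pos fun t ht => (hη.mem t ht).2
  · exact (hv.d hη.smooth).eq_zero_of_const hη.pos fun t ht => (hη.mem t ht).1.1

theorem mem_coneZ_iff {ι : L → M} (hι : ContMDiff J I ∞ ι) {v : Om I M 2} {β : Om J L 1} :
    (v, β) ∈ coneZ hι ↔ d I M 2 v = 0 ∧ pull hι 2 v = d J L 1 β := by
  refine LinearMap.mem_ker.trans ?_
  refine (Prod.mk_eq_zero).trans ?_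
  rw [sub_eq_zero]

namespace WeinsteinData

variable {ι : L → M} {ω₀ : Om I M 2} (W : WeinsteinData (J := J) ι ω₀)

theorem pairVelocities_subset (hι : ContMDiff J I ∞ ι) : W.pairVelocities ⊆ coneZ hι := by
  rintro ⟨v, β⟩ ⟨ε, η, α, hp, hv, hβ⟩
  obtain ⟨φ, φ', hφ, -, -, -, -, -, -, hl, h⟩ := hp.exists_lagPath hι
  obtain ⟨c, hc, hvc⟩ := h v β hv hβ
  have h1 := lagVelocities_subset hι ⟨ε, _, hl, hvc⟩
  refine (mem_coneZ_iff hι).2 ⟨?_, ?_⟩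
  · have h2 : d I M 2 (v + d I M 1 c) = 0 := h1.2
    rwa [map_add, d_d, add_zero] at h2
  · have h2 : pull hι 2 (v + d I M 1 c) = 0 := h1.1
    rwa [map_add, pull_d, hc, map_neg, ← sub_eq_add_neg, sub_eq_zero] at h2

end WeinsteinData

end Paths

end SymplecticDeformation

namespace SymplecticDeformation

section Trivial

variable {E : Type*} [NormedAddCommGroup E] [NormedSpace ℝ E] [FiniteDimensional ℝ E]
  {H : Type*} [TopologicalSpace H] {I : ModelWithCorners ℝ E H} [I.Boundaryless]
  {M : Type*} [TopologicalSpace M] [ChartedSpace H M] [IsManifold I ∞ M] [T2Space M] [CompactSpace M]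
  {F : Type*} [NormedAddCommGroup F] [NormedSpace ℝ F]
  {K : Type*} [TopologicalSpace K] {J : ModelWithCorners ℝ F K} [J.Boundaryless]
  {L : Type*} [TopologicalSpace L] [ChartedSpace K L] [IsManifold J ∞ L] [CompactSpace L]

namespace WeinsteinData

variable {ι : L → M} {ω₀ : Om I M 2} (W : WeinsteinData (J := J) ι ω₀)

/-- The projection onto `L` of the tubular neighbourhood. -/
noncomputable def retr (y : M) : L := (W.ψ.symm y).1

theorem ι_mem_target (x : L) : ι x ∈ W.ψ.target := by
  rw [← W.ψ_zero x]
  exact W.ψ.map_source (W.zero_mem_source x)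

theorem retr_ψ {p : CotangentBundle J L} (hp : p ∈ W.ψ.source) : W.retr (W.ψ p) = p.1 :=
  congrArg (fun p : CotangentBundle J L => p.1) (W.ψ.left_inv hp)

theorem retr_ι (x : L) : W.retr (ι x) = x := by
  rw [← W.ψ_zero x]
  exact W.retr_ψ (W.zero_mem_source x)

theorem ι_retr {y : M} (hy : y ∈ range ι) : ι (W.retr y) = y := by
  obtain ⟨x, rfl⟩ := hy
  rw [W.retr_ι]

theorem contMDiffAt_retr {y : M} (hy : y ∈ W.ψ.target) : ContMDiffAt I J ∞ W.retr y :=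
  ContMDiffAt.comp y (contMDiff_cotangent_proj _) (W.contMDiffAt_ψ_symm hy)

theorem mfderiv_retr_mfderiv_ι (hι : ContMDiff J I ∞ ι) (x : L) (v : TangentSpace J x) :
    (show F from mfderiv I J W.retr (ι x) (mfderiv J I ι x v)) = v := by
  have h1 := mfderiv_comp x ((W.contMDiffAt_retr (W.ι_mem_target x)).mdifferentiableAt (by simp))
    ((hι x).mdifferentiableAt (by simp))
  have h2 : W.retr ∘ ι = id := funext W.retr_ι
  rw [h2, mfderiv_id] at h1
  exact (DFunLike.congr_fun h1 v).symm

/-- A curve that stays in `L` for small nonnegative times is tangent to `L`. -/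
theorem exists_tangent (W : WeinsteinData (J := J) ι ω₀) (hι : ContMDiff J I ∞ ι) {κ : ℝ → M} (hκ : MDifferentiableAt 𝓘(ℝ, ℝ) I κ 0)
    {ε : ℝ} (hε : 0 < ε) (h : ∀ t ∈ Icc 0 ε, κ t ∈ range ι) {x : L} (h0 : κ 0 = ι x) :
    ∃ w : TangentSpace J x, (show E from mfderiv 𝓘(ℝ, ℝ) I κ 0 (1 : ℝ)) = mfderiv J I ι x w := by
  have hr : MDifferentiableAt I J W.retr (κ 0) := by
    rw [h0]
    exact (W.contMDiffAt_retr (W.ι_mem_target x)).mdifferentiableAt (by simp)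
  have h1 := hr.comp (0 : ℝ) hκ
  have hx : (W.retr ∘ κ) 0 = x := by rw [Function.comp_apply, h0, W.retr_ι]
  have h2 : MDifferentiableAt J I ι ((W.retr ∘ κ) 0) := (hι _).mdifferentiableAt (by simp)
  have h3 := HasMFDerivAt.comp (0 : ℝ) h2.hasMFDerivAt h1.hasMFDerivAt
  have h4 : HasMFDerivWithinAt 𝓘(ℝ, ℝ) I κ (Icc 0 ε) 0 _ :=
    h3.hasMFDerivWithinAt.congr_of_eventuallyEq
      (eventually_of_mem self_mem_nhdsWithin fun t ht => (W.ι_retr (h t ht)).symm)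
      (W.ι_retr (h 0 ⟨le_rfl, hε.le⟩)).symm
  have h5 := UniqueMDiffWithinAt.eq
    ((uniqueDiffOn_Icc hε 0 ⟨le_rfl, hε.le⟩).uniqueMDiffWithinAt) hκ.hasMFDerivAt.hasMFDerivWithinAt h4
  rw [← hx]
  exact ⟨mfderiv 𝓘(ℝ, ℝ) J (W.retr ∘ κ) 0 (1 : ℝ), DFunLike.congr_fun h5 (1 : ℝ)⟩

end WeinsteinData

theorem contr_pull_eq_zero_of_tangent {ι : L → M} (hι : ContMDiff J I ∞ ι) {ω₀ : Om I M 2}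
    (hL : pull hι 2 ω₀ = 0) {κ : ℝ × L → M} (hκ : ContMDiff (𝓘(ℝ, ℝ).prod J) I ∞ κ)
    (h0 : ∀ x, κ (0, x) = ι x)
    (h : ∀ x, ∃ w : TangentSpace J x, (show E from mfderiv (𝓘(ℝ, ℝ).prod J) I κ (0, x)
      (((1 : ℝ), (0 : F)) : ℝ × F)) = mfderiv J I ι x w) :
    contr 0 (pull hκ 2 ω₀) = 0 := by
  refine om_ext fun x u => ?_
  obtain ⟨w, hw⟩ := h x
  have h1 : (fun x => κ (0, x)) = ι := funext h0
  have h2 : ∀ v : F, (show E from mfderiv (𝓘(ℝ, ℝ).prod J) I κ (0, x) (((0 : ℝ), v) : ℝ × F)) =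
      mfderiv J I ι x v := by
    intro v
    refine Eq.trans (mfderiv_at_time (v := v) ((hκ (0, x)).mdifferentiableAt (by simp))).symm ?_
    rw [h1]
    rfl
  have h3 : ∀ {a b : M} (v v' : Fin 2 → E), a = b → v = v' →
    (show E [⋀^Fin 2]→L[ℝ] ℝ from ω₀.1 a) v = (show E [⋀^Fin 2]→L[ℝ] ℝ from ω₀.1 b) v' := by
    rintro a b v v' rfl rfl; rfl
  have h4 : (pull hι 2 ω₀).1 x ![w, u 0] = 0 := by rw [hL]; rfl
  refine Eq.trans ?_ h4
  refine h3 _ _ (h0 x) (funext fun i => ?_)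
  refine Fin.cases hw (fun j => ?_) i
  rw [Subsingleton.elim j 0]
  exact h2 _

variable {ι : L → M} {ω₀ : Om I M 2}

theorem trivialLagVelocities_subset (W : WeinsteinData (J := J) ι ω₀) (hι : ContMDiff J I ∞ ι)
    (hL : pull hι 2 ω₀ = 0) : trivialLagVelocities hι ω₀ ⊆ relB hι := by
  rintro v ⟨ε, η, hη, hv, ρ, hρ, hρη⟩
  have hρ0 : ∀ x, ρ 0 x = x := fun x => by rw [hρ.zero]; rfl
  have h1 := hv.pull_time hρ.contMDiff hη.smooth (hη.mem 0 ⟨le_rfl, hη.pos.le⟩).1.1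
  have h2 := h1.eq_zero_of_const hη.pos fun t ht => Subtype.ext (hρη t ht).2
  rw [hη.zero, pull_eq_self _ _ hρ.zero] at h2
  have hκ : ContMDiff (𝓘(ℝ, ℝ).prod J) I ∞ fun p : ℝ × L => ρ p.1 (ι p.2) :=
    hρ.contMDiff.comp (contMDiff_fst.prodMk (hι.comp contMDiff_snd))
  have h3 : pull hι 1 (contr 0 (pull hρ.contMDiff 2 ω₀)) = 0 := by
    rw [contr_pull_restrict hι hρ.contMDiff hκ fun _ => rfl]
    refine contr_pull_eq_zero_of_tangent hι hL hκ (fun x => hρ0 _) fun x => ?_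
    have hd := (hκ (0, x)).mdifferentiableAt (by simp)
    have hc : MDifferentiableAt 𝓘(ℝ, ℝ) I (fun t => ρ t (ι x)) 0 :=
      MDifferentiableAt.comp (0 : ℝ) hd
        ((contMDiff_id.prodMk contMDiff_const (n := ∞) (0 : ℝ)).mdifferentiableAt (by simp))
    obtain ⟨w, hw⟩ := W.exists_tangent hι hc hη.pos
      (fun t ht => by rw [← (hρη t ht).1]; exact mem_image_of_mem _ (mem_range_self x)) (hρ0 _)
    exact ⟨w, (mfderiv_time hd).symm.trans hw⟩
  refine ⟨-contr 0 (pull hρ.contMDiff 2 ω₀), ?_, ?_⟩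
  · exact LinearMap.mem_ker.2 (by rw [map_neg, h3, neg_zero])
  · rw [map_neg]
    exact (eq_neg_of_add_eq_zero_left h2).symm

/-- The diffeomorphism given by a smooth map and a smooth inverse. -/
def diffeoOf {g g' : M → M} (hg : ContMDiff I I ∞ g) (hg' : ContMDiff I I ∞ g')
    (h1 : ∀ x, g (g' x) = x) (h2 : ∀ x, g' (g x) = x) : Diffeomorph I I M M ∞ where
  toFun := g
  invFun := g'
  left_inv := h2
  right_inv := h1
  contMDiff_toFun := hg
  contMDiff_invFun := hg'

theorem trivialPairVelocities_subset (W : WeinsteinData (J := J) ι ω₀) (hι : ContMDiff J I ∞ ι)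
    (hL : pull hι 2 ω₀ = 0) : W.trivialPairVelocities ⊆ coneB hι := by
  rintro ⟨v, β⟩ ⟨ε, η, α, hp, hv, hβ, ρ, hρ, hρη⟩
  obtain ⟨φ, φ', hφ, hφ', h1, h2, h0, hφι, -, hl, h⟩ := hp.exists_lagPath hι
  obtain ⟨c, hc, hvc⟩ := h v β hv hβ
  have h3 : ∀ y, φ' (0, y) = y := fun y => by
    have := h2 0 y
    rwa [h0] at this
  have hiso : IsIsotopy I ε fun t y => φ' (t, ρ t y) := by
    refine ⟨hφ'.comp (contMDiff_fst.prodMk hρ.contMDiff), ?_, fun t ht => ?_⟩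
    · funext y
      rw [hρ.zero]
      exact h3 y
    · obtain ⟨Φ, hΦ⟩ := hρ.diffeo t ht
      refine ⟨Φ.trans (diffeoOf (contMDiff_at_time hφ' t) (contMDiff_at_time hφ t) (h2 t) (h1 t)), ?_⟩
      rw [← hΦ]
      rfl
  have h4 : v + d I M 1 c ∈ relB hι := by
    refine trivialLagVelocities_subset W hι hL ⟨ε, _, hl, hvc, _, hiso, fun t ht => ⟨?_, ?_⟩⟩
    · have h5 : (fun y => φ' (t, ρ t y)) '' range ι = (fun y => φ' (t, y)) '' (ρ t '' range ι) := by
        rw [image_image]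
      rw [h5, (hρη t ht).1, WeinsteinData.graph, ← range_comp]
      refine congrArg range (funext fun x => ?_)
      rw [Function.comp_apply, ← hφι t ht x, h2]
    · have hρt : ContMDiff I I ∞ (ρ t) := contMDiff_at_time hρ.contMDiff t
      have hφt := contMDiff_at_time hφ t
      have hφt' := contMDiff_at_time hφ' t
      have h5 := rawPull_comp (η t).1 hφt (hφt'.comp hρt)
      have h6 : (fun x => φ (t, x)) ∘ (fun x => φ' (t, x)) ∘ ρ t = ρ t :=
        funext fun y => h1 t (ρ t y)
      rw [h6, (hρη t ht).2] at h5
      exact h5.symm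
  obtain ⟨γ, hγ, hγv⟩ := h4
  have hγ' : pull hι 1 γ = 0 := hγ
  refine ⟨(γ - c, 0), Prod.ext ?_ ?_⟩
  · change d I M 1 (γ - c) = v
    rw [map_sub, hγv, add_sub_cancel_right]
  · change pull hι 1 (γ - c) - d J L 0 0 = β
    rw [map_sub, hγ', hc, map_zero, sub_zero, zero_sub, neg_neg]

end Trivial

end SymplecticDeformation

namespace SymplecticDeformation

section Flat

variable {E : Type*} [NormedAddCommGroup E] [NormedSpace ℝ E]

variable (E) in
/-- The map that sends a `2`-form `θ` to the map `v ↦ θ(v, ·)`. -/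
noncomputable def flat : (E [⋀^Fin 2]→L[ℝ] ℝ) →L[ℝ] (E →L[ℝ] E →L[ℝ] ℝ) :=
  (ContinuousLinearMap.compL ℝ E (E [⋀^Fin 1]→L[ℝ] ℝ) (E →L[ℝ] ℝ)
    (oneFormCLE E).toContinuousLinearMap).comp
      (ContinuousAlternatingMap.curryLeftLI (n := 1)).toContinuousLinearMap

theorem flat_apply (θ : E [⋀^Fin 2]→L[ℝ] ℝ) (v w : E) : flat E θ v w = θ ![v, w] := by
  change θ (Matrix.vecCons v fun _ => w) = θ ![v, w]
  congr 1
  funext i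
  refine Fin.cases rfl (fun j => ?_) i
  rw [Subsingleton.elim j 0]
  rfl

theorem contDiff_flat {n : WithTop ℕ∞} : ContDiff ℝ n (flat E) :=
  ContinuousLinearMap.contDiff (𝕜 := ℝ) (E := E [⋀^Fin 2]→L[ℝ] ℝ) (F := E →L[ℝ] E →L[ℝ] ℝ) (flat E)

theorem contDiff_oneFormCLE {n : WithTop ℕ∞} : ContDiff ℝ n (oneFormCLE E) :=
  (oneFormCLE E).contDiff

variable [FiniteDimensional ℝ E]

/-- An injective map from a finite dimensional space to its dual is an isomorphism. -/
theorem exists_equiv_of_injective {A : E →L[ℝ] E →L[ℝ] ℝ} (h : Function.Injective A) :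
    ∃ e : E ≃L[ℝ] (E →L[ℝ] ℝ), (e : E →L[ℝ] E →L[ℝ] ℝ) = A := by
  have hdim : Module.finrank ℝ E = Module.finrank ℝ (E →L[ℝ] ℝ) := by
    rw [← (LinearMap.toContinuousLinearMap (𝕜 := ℝ) (E := E) (F' := ℝ)).finrank_eq]
    exact Subspace.dual_finrank_eq.symm
  refine ⟨(LinearEquiv.ofInjectiveOfFinrankEq (A : E →ₗ[ℝ] E →L[ℝ] ℝ) h hdim).toContinuousLinearEquiv, ?_⟩
  ext v w
  rfl

variable {H : Type*} [TopologicalSpace H] {I : ModelWithCorners ℝ E H} [I.Boundaryless]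
  {M : Type*} [TopologicalSpace M] [ChartedSpace H M] [IsManifold I ∞ M]

theorem flat_chartForm (η : RawForm I M 2) {x₀ x : M} (hx : x ∈ (extChartAt I x₀).source) (v : TangentSpace I x)
    (w : E) : flat E (chartForm I η x₀ (extChartAt I x₀ x)) (chartDiff I x₀ x v) w =
      η x ![v, chartSymmDiff I x₀ (extChartAt I x₀ x) w] := by
  rw [flat_apply]
  have h1 := (extChartAt I x₀).left_inv hx
  have h3 : ∀ {a b : M} (v v' : Fin 2 → E), a = b → v = v' →
    (show E [⋀^Fin 2]→L[ℝ] ℝ from η a) v = (show E [⋀^Fin 2]→L[ℝ] ℝ from η b) v' := by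
    rintro a b v v' rfl rfl; rfl
  refine h3 _ _ h1 (funext fun i => ?_)
  refine Fin.cases ?_ (fun j => ?_) i
  · exact chartSymmDiff_chartDiff hx v
  · rw [Subsingleton.elim j 0]
    rfl

theorem chartSymmDiff_surjective {x₀ x : M} (hx : x ∈ (extChartAt I x₀).source) (v : E) :
    ∃ w : E, (show E from chartSymmDiff I x₀ (extChartAt I x₀ x) w) = v :=
  ⟨chartDiff I x₀ x v, chartSymmDiff_chartDiff hx v⟩

theorem chartDiff_surjective {x₀ x : M} (hx : x ∈ (extChartAt I x₀).source) :
    Function.Surjective (show E →L[ℝ] E from chartDiff I x₀ x) := by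
  have h1 : Function.Injective (show E →L[ℝ] E from chartDiff I x₀ x) := by
    intro v w h
    rw [← chartSymmDiff_chartDiff (I := I) hx v, ← chartSymmDiff_chartDiff (I := I) hx w]
    exact congrArg (show E →L[ℝ] E from chartSymmDiff I x₀ (extChartAt I x₀ x)) h
  exact (LinearMap.injective_iff_surjective (f := ((show E →L[ℝ] E from chartDiff I x₀ x) : E →ₗ[ℝ] E))).1 h1

/-- Nondegeneracy can be checked in a chart. -/
theorem injective_flat_chartForm_iff (η : RawForm I M 2) {x₀ x : M} (hx : x ∈ (extChartAt I x₀).source) :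
    Function.Injective (flat E (chartForm I η x₀ (extChartAt I x₀ x))) ↔
      ∀ v : TangentSpace I x, (∀ w : TangentSpace I x, η x ![v, w] = 0) → v = 0 := by
  constructor
  · intro h v hv
    have h1 : (show E from chartDiff I x₀ x v) = 0 := by
      refine h ?_
      rw [map_zero]
      refine ContinuousLinearMap.ext fun w => ?_
      rw [flat_chartForm η hx]
      exact hv _
    refine (chartSymmDiff_chartDiff (I := I) hx v).symm.trans ?_
    refine (congrArg (show E →L[ℝ] E from chartSymmDiff I x₀ (extChartAt I x₀ x)) h1).trans ?_
    exact map_zero _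
  · intro h
    refine (injective_iff_map_eq_zero _).2 fun v' hv' => ?_
    obtain ⟨v, rfl⟩ := chartDiff_surjective (I := I) hx v'
    have h1 : (show E from v) = 0 := by
      refine h v fun w => ?_
      obtain ⟨w', hw'⟩ := chartSymmDiff_surjective (I := I) hx w
      have h2 := (flat_chartForm η hx v w').symm.trans (DFunLike.congr_fun hv' w')
      rw [← hw']
      exact h2
    rw [h1]
    exact map_zero _

theorem eventually_nondegenerate {η : ℝ → Om I M 2} (hη : IsSmoothFamily η) {t₀ : ℝ} {x₀ : M}
    (h : ∀ v : TangentSpace I x₀, (∀ w : TangentSpace I x₀, (η t₀).1 x₀ ![v, w] = 0) → v = 0) :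
    ∀ᶠ p : ℝ × M in 𝓝 (t₀, x₀),
      ∀ v : TangentSpace I p.2, (∀ w : TangentSpace I p.2, (η p.1).1 p.2 ![v, w] = 0) → v = 0 := by
  have h1 : ContinuousAt (fun p : ℝ × E => flat E (chartForm I (η p.1).1 x₀ p.2)) (t₀, extChartAt I x₀ x₀) :=
    (flat E).continuous.continuousAt.comp ((hη x₀).continuousOn.continuousAt
      ((isOpen_univ.prod (isOpen_extChartAt_target x₀)).mem_nhds ⟨mem_univ _, mem_extChartAt_target x₀⟩))
  have h2 : ContinuousAt (fun p : ℝ × M => (p.1, extChartAt I x₀ p.2)) (t₀, x₀) :=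
    continuousAt_fst.prodMk (ContinuousAt.comp (x := (t₀, x₀)) (continuousAt_extChartAt x₀) continuousAt_snd)
  have h4 : ContinuousAt (fun p : ℝ × M => flat E (chartForm I (η p.1).1 x₀ (extChartAt I x₀ p.2))) (t₀, x₀) :=
    ContinuousAt.comp (x := (t₀, x₀)) (f := fun p : ℝ × M => (p.1, extChartAt I x₀ p.2))
      (g := fun p : ℝ × E => flat E (chartForm I (η p.1).1 x₀ p.2)) h1 h2
  have h5 := (injective_flat_chartForm_iff (η t₀).1 (mem_extChartAt_source (I := I) x₀)).2 h
  have h3 := h4.eventually (ContinuousLinearMap.isOpen_injective.mem_nhds h5)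
  filter_upwards [h3, continuousAt_snd.eventually (extChartAt_source_mem_nhds (I := I) x₀)] with p hp hps
  exact (injective_flat_chartForm_iff (η p.1).1 hps).1 hp

theorem eventually_isSymplectic [CompactSpace M] {η : ℝ → Om I M 2} (hη : IsSmoothFamily η) {t₀ : ℝ}
    (h : IsSymplectic (η t₀)) (hd : ∀ t, d I M 2 (η t) = 0) : ∀ᶠ t in 𝓝 t₀, IsSymplectic (η t) := by
  have h1 := isCompact_univ.eventually_forall_of_forall_eventually (x₀ := t₀)
    (P := fun t x => ∀ v : TangentSpace I x, (∀ w : TangentSpace I x, (η t).1 x ![v, w] = 0) → v = 0)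
    fun x (_ : x ∈ (univ : Set M)) => eventually_nondegenerate hη (h.2 x)
  filter_upwards [h1] with t ht using ⟨hd t, fun x => ht x (mem_univ x)⟩

/-- The vector field that is dual to a `1`-form with respect to a symplectic form. -/
theorem exists_dual_field {η : Om I M 2} (hη : IsSymplectic η) (a : Om I M 1) :
    ∃ Z : (x : M) → TangentSpace I x, IsSmoothField I Z ∧
      ∀ x (w : TangentSpace I x), η.1 x ![Z x, w] = a.1 x fun _ => w := by
  have hinj : ∀ x₀ x, x ∈ (extChartAt I x₀).source →
      Function.Injective (flat E (chartForm I η.1 x₀ (extChartAt I x₀ x))) := fun x₀ x hx =>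
    (injective_flat_chartForm_iff η.1 hx).2 (hη.2 x)
  have hex : ∀ x, ∃ Z : TangentSpace I x, ∀ w : TangentSpace I x, η.1 x ![Z, w] = a.1 x fun _ => w := by
    intro x
    have h1 : Function.Injective (flat E (show E [⋀^Fin 2]→L[ℝ] ℝ from η.1 x)) := by
      refine (injective_iff_map_eq_zero _).2 fun v hv => hη.2 x v fun w => ?_
      have h2 := DFunLike.congr_fun hv w
      exact (flat_apply (show E [⋀^Fin 2]→L[ℝ] ℝ from η.1 x) v w).symm.trans h2
    obtain ⟨e, he⟩ := exists_equiv_of_injective h1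
    obtain ⟨v, hv⟩ := e.surjective (oneFormCLE E (show E [⋀^Fin 1]→L[ℝ] ℝ from a.1 x))
    refine ⟨v, fun w => ?_⟩
    have h2 := DFunLike.congr_fun ((DFunLike.congr_fun he v).symm.trans hv) w
    exact (flat_apply (show E [⋀^Fin 2]→L[ℝ] ℝ from η.1 x) v w).symm.trans h2
  choose Z hZ using hex
  refine ⟨Z, fun x₀ => contMDiffAt_tangentBundle_iff.2 ⟨contMDiffAt_id, ?_⟩, hZ⟩
  have hx₀ := mem_extChartAt_target (I := I) x₀
  obtain ⟨e, he⟩ := exists_equiv_of_injective (hinj x₀ x₀ (mem_extChartAt_source x₀))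
  have h1 : ContDiffAt ℝ ∞ (fun y => flat E (chartForm I η.1 x₀ y)) (extChartAt I x₀ x₀) :=
    contDiff_flat.contDiffAt.comp _ (IsSmoothForm.contDiffAt η.2 hx₀)
  have h2 : ContDiffAt ℝ ∞ (fun y => oneFormCLE E (chartForm I a.1 x₀ y)) (extChartAt I x₀ x₀) :=
    contDiff_oneFormCLE.contDiffAt.comp _ (IsSmoothForm.contDiffAt a.2 hx₀)
  have h3 : ContDiffAt ℝ ∞ ContinuousLinearMap.inverse (flat E (chartForm I η.1 x₀ (extChartAt I x₀ x₀))) := by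
    rw [← he]
    exact contDiffAt_map_inverse e
  have h4 := (ContDiffAt.comp (extChartAt I x₀ x₀) (g := ContinuousLinearMap.inverse)
    (f := fun y => flat E (chartForm I η.1 x₀ y)) h3 h1).clm_apply h2
  refine (ContMDiffAt.comp x₀ h4.contMDiffAt (contMDiffAt_extChartAt (n := ∞))).congr_of_eventuallyEq ?_
  filter_upwards [extChartAt_source_mem_nhds (I := I) x₀] with x hx
  obtain ⟨e', he'⟩ := exists_equiv_of_injective (hinj x₀ x hx)
  have h5 : e' (chartDiff I x₀ x (Z x)) = oneFormCLE E (chartForm I a.1 x₀ (extChartAt I x₀ x)) := by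
    refine ContinuousLinearMap.ext fun w => ?_
    have h6 := (flat_chartForm η.1 hx (Z x) w).trans (hZ x _)
    rw [← he'] at h6
    refine h6.trans ?_
    have h7 := comp_congr a.1 ((extChartAt I x₀).left_inv hx).symm
      (show E →L[ℝ] E from chartSymmDiff I x₀ (extChartAt I x₀ x))
      (show E →L[ℝ] E from chartSymmDiff I x₀ (extChartAt I x₀ x)) fun v => rfl
    exact (DFunLike.congr_fun h7 fun _ => w :)
  simp only [Function.comp_apply, ← he', ContinuousLinearMap.inverse_equiv, ← h5]
  exact (e'.symm_apply_apply _).symm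

end Flat

end SymplecticDeformation

namespace SymplecticDeformation

/-- A half-dimensional isotropic subspace contains every vector that is orthogonal to it. -/
theorem mem_range_of_orthogonal {E F : Type*} [NormedAddCommGroup E] [NormedSpace ℝ E]
    [FiniteDimensional ℝ E] [NormedAddCommGroup F] [NormedSpace ℝ F] [FiniteDimensional ℝ F]
    (hdim : Module.finrank ℝ E = 2 * Module.finrank ℝ F) {θ : E [⋀^Fin 2]→L[ℝ] ℝ}
    (hθ : ∀ v, (∀ w, θ ![v, w] = 0) → v = 0) {A : F →L[ℝ] E} (hA : Function.Injective A)
    (hiso : ∀ u u', θ ![A u, A u'] = 0) {z : E} (hz : ∀ u, θ ![z, A u] = 0) : ∃ w, z = A w := by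
  have hB : Function.Injective (flat E θ) := by
    refine (injective_iff_map_eq_zero _).2 fun v hv => hθ v fun w => ?_
    rw [← flat_apply, hv]
    rfl
  obtain ⟨e, he⟩ := exists_equiv_of_injective hB
  obtain ⟨P, hP⟩ := LinearMap.exists_leftInverse_of_injective (A : F →ₗ[ℝ] E)
    (LinearMap.ker_eq_bot.2 hA)
  let R : (E →L[ℝ] ℝ) →ₗ[ℝ] (F →L[ℝ] ℝ) :=
    { toFun := fun φ => φ.comp A, map_add' := fun _ _ => rfl, map_smul' := fun _ _ => rfl }
  let T : E →ₗ[ℝ] (F →L[ℝ] ℝ) := R ∘ₗ (e : E →ₗ[ℝ] (E →L[ℝ] ℝ))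
  have hT : ∀ v u, T v u = θ ![v, A u] := by
    intro v u
    rw [← flat_apply, ← he]
    rfl
  have hsurj : Function.Surjective T := by
    intro φ
    refine ⟨e.symm (φ.comp (LinearMap.toContinuousLinearMap P)), ContinuousLinearMap.ext fun u => ?_⟩
    have h1 : P (A u) = u := DFunLike.congr_fun hP u
    change (e (e.symm (φ.comp (LinearMap.toContinuousLinearMap P)))) (A u) = φ u
    rw [e.apply_symm_apply]
    exact congrArg φ h1
  have hle : LinearMap.range (A : F →ₗ[ℝ] E) ≤ LinearMap.ker T := by
    rintro _ ⟨u, rfl⟩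
    refine LinearMap.mem_ker.2 (ContinuousLinearMap.ext fun u' => ?_)
    rw [hT]
    exact hiso u u'
  have h1 := LinearMap.finrank_range_add_finrank_ker T
  have h2 : Module.finrank ℝ (F →L[ℝ] ℝ) = Module.finrank ℝ F := by
    rw [← (LinearMap.toContinuousLinearMap (𝕜 := ℝ) (E := F) (F' := ℝ)).finrank_eq]
    exact Subspace.dual_finrank_eq
  rw [LinearMap.range_eq_top.2 hsurj, finrank_top, h2] at h1
  have h3 : Module.finrank ℝ (LinearMap.range (A : F →ₗ[ℝ] E)) = Module.finrank ℝ F :=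
    LinearMap.finrank_range_of_inj hA
  have h4 := Submodule.eq_of_le_of_finrank_eq hle (by omega)
  have h5 : z ∈ LinearMap.ker T := LinearMap.mem_ker.2 (ContinuousLinearMap.ext fun u => by
    rw [hT]; exact hz u)
  rw [← h4] at h5
  obtain ⟨w, hw⟩ := h5
  exact ⟨w, hw.symm⟩

section Moser

variable {E : Type*} [NormedAddCommGroup E] [NormedSpace ℝ E] [FiniteDimensional ℝ E]
  {H : Type*} [TopologicalSpace H] {I : ModelWithCorners ℝ E H} [I.Boundaryless]
  {M : Type*} [TopologicalSpace M] [ChartedSpace H M] [IsManifold I ∞ M] [T2Space M] [CompactSpace M]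
  {F : Type*} [NormedAddCommGroup F] [NormedSpace ℝ F] [FiniteDimensional ℝ F]
  {K : Type*} [TopologicalSpace K] {J : ModelWithCorners ℝ F K} [J.Boundaryless]
  {L : Type*} [TopologicalSpace L] [ChartedSpace K L] [IsManifold J ∞ L] [T2Space L] [CompactSpace L]
  {ι : L → M} {ω₀ : Om I M 2}

/-- The dual vector field of a `1`-form with vanishing pullback to a Lagrangian submanifold is
tangent to this submanifold. -/
theorem dual_field_tangent (hdim : Module.finrank ℝ E = 2 * Module.finrank ℝ F)
    (W : WeinsteinData (J := J) ι ω₀) (hι : ContMDiff J I ∞ ι) (hω₀ : IsSymplectic ω₀)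
    (hL : pull hι 2 ω₀ = 0) {a : Om I M 1} (ha : pull hι 1 a = 0) {Z : (x : M) → TangentSpace I x}
    (hZ : ∀ x (w : TangentSpace I x), ω₀.1 x ![Z x, w] = a.1 x fun _ => w) (x : L) :
    ∃ w : TangentSpace J x, (show E from Z (ι x)) = mfderiv J I ι x w := by
  refine mem_range_of_orthogonal (θ := (show E [⋀^Fin 2]→L[ℝ] ℝ from ω₀.1 (ι x)))
    (A := (show F →L[ℝ] E from mfderiv J I ι x)) hdim (hω₀.2 (ι x)) ?_ ?_ ?_
  · intro u u' h
    have h1 := congrArg (show E →L[ℝ] F from mfderiv I J W.retr (ι x)) h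
    exact (W.mfderiv_retr_mfderiv_ι hι x u).symm.trans (h1.trans (W.mfderiv_retr_mfderiv_ι hι x u'))
  · intro u u'
    have h1 : (pull hι 2 ω₀).1 x ![u, u'] = 0 := by rw [hL]; rfl
    refine Eq.trans ?_ h1
    refine congrArg (show E [⋀^Fin 2]→L[ℝ] ℝ from ω₀.1 (ι x)) (funext fun i => ?_)
    refine Fin.cases rfl (fun j => ?_) i
    rw [Subsingleton.elim j 0]
    rfl
  · intro u
    refine (hZ (ι x) (mfderiv J I ι x u)).trans ?_
    have h1 : (pull hι 1 a).1 x (fun _ => u) = 0 := by rw [ha]; rfl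
    exact h1

/-- The flow of the dual vector field of a `1`-form with vanishing pullback to a Lagrangian
submanifold restricts to this submanifold. -/
theorem exists_lag_flow (hdim : Module.finrank ℝ E = 2 * Module.finrank ℝ F)
    (W : WeinsteinData (J := J) ι ω₀) (hι : ContMDiff J I ∞ ι) (hω₀ : IsSymplectic ω₀)
    (hL : pull hι 2 ω₀ = 0) {a : Om I M 1} (ha : pull hι 1 a = 0) :
    ∃ (χ : ℝ × M → M) (hχ : ContMDiff (𝓘(ℝ, ℝ).prod I) I ∞ χ) (g : ℝ × L → L),
      ContMDiff (𝓘(ℝ, ℝ).prod J) J ∞ g ∧ (∀ y, χ (0, y) = y) ∧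
      (∀ s t y, χ (s + t, y) = χ (s, χ (t, y))) ∧ (∀ t x, χ (t, ι x) = ι (g (t, x))) ∧
      (∀ s t x, g (s + t, x) = g (s, g (t, x))) ∧ (∀ x, g (0, x) = x) ∧
      contr 0 (pull hχ 2 ω₀) = a := by
  obtain ⟨Z, hZs, hZ⟩ := exists_dual_field hω₀ a
  obtain ⟨χ, hχ, hχ0, hχγ, hχadd⟩ := exists_smooth_flow hZs
    (exists_isMIntegralCurve_of_compactSpace hZs)
  let κ : ℝ × L → L := fun p => W.retr (χ (p.1, ι p.2))
  have hκ : ∀ x, ContMDiffAt (𝓘(ℝ, ℝ).prod J) J ∞ κ (0, x) := by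
    intro x
    refine ContMDiffAt.comp (0, x) (g := W.retr) (f := fun p : ℝ × L => χ (p.1, ι p.2))
      (W.contMDiffAt_retr ?_) (hχ.comp (contMDiff_fst.prodMk (hι.comp contMDiff_snd))).contMDiffAt
    simp only [hχ0]
    exact W.ι_mem_target x
  have hκ0 : ∀ x, κ (0, x) = x := fun x => by simp only [κ, hχ0, W.retr_ι]
  let Y : (x : L) → TangentSpace J x := fun x =>
    (show F from mfderiv (𝓘(ℝ, ℝ).prod J) J κ (0, x) (((1 : ℝ), (0 : F)) : ℝ × F))
  have hYs : IsSmoothField J Y := by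
    intro x
    refine (contMDiffAt_deriv_param (Eventually.of_forall hκ)).congr_of_eventuallyEq
      (Eventually.of_forall fun p => ?_)
    have : ∀ {b b' : L} (v : F), b = b' → (⟨b, v⟩ : TangentBundle J L) = ⟨b', v⟩ := by
      rintro b b' v rfl; rfl
    exact this _ (hκ0 p).symm
  have hχd : ∀ y, HasMFDerivAt 𝓘(ℝ, ℝ) I (fun s => χ (s, y)) 0 ((1 : ℝ →L[ℝ] ℝ).smulRight (Z y)) := by
    intro y
    refine (hχγ y 0).congr_mfderiv ?_
    have : ∀ {b b' : M}, b = b' → ((1 : ℝ →L[ℝ] ℝ).smulRight (show E from Z b)) =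
      (1 : ℝ →L[ℝ] ℝ).smulRight (show E from Z b') := by rintro b b' rfl; rfl
    exact this (hχ0 y)
  have hY : ∀ x, (show E from mfderiv J I ι x (Y x)) = Z (ι x) := by
    intro x
    obtain ⟨w, hw⟩ := dual_field_tangent hdim W hι hω₀ hL ha hZ x
    have hr := ((W.contMDiffAt_retr (W.ι_mem_target x)).mdifferentiableAt (by simp)).hasMFDerivAt
    have hr' : HasMFDerivAt I J W.retr (χ (0, ι x)) (mfderiv I J W.retr (ι x)) := by rwa [hχ0]
    have h1 := (HasMFDerivAt.comp (0 : ℝ) hr' (hχd (ι x))).mfderiv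
    have h2 : (show F from Y x) = w := by
      refine (mfderiv_time ((hκ x).mdifferentiableAt (by simp))).symm.trans ?_
      refine (DFunLike.congr_fun h1 (1 : ℝ)).trans ?_
      have h3 : (show E from ((1 : ℝ →L[ℝ] ℝ).smulRight (show E from Z (ι x))) (1 : ℝ)) =
        mfderiv J I ι x w := (one_smul ℝ (show E from Z (ι x))).trans hw
      exact (congrArg (show E →L[ℝ] F from mfderiv I J W.retr (ι x)) h3).trans
        (W.mfderiv_retr_mfderiv_ι hι x w)
    exact (congrArg (show F →L[ℝ] E from mfderiv J I ι x) h2).trans hw.symm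
  obtain ⟨g, hg, hg0, hgγ, hgadd⟩ := exists_smooth_flow hYs
    (exists_isMIntegralCurve_of_compactSpace hYs)
  refine ⟨χ, hχ, g, hg, hχ0, hχadd, fun t x => ?_, hgadd, hg0, ?_⟩
  · have h1 : IsMIntegralCurve (I := I) (fun s => ι (g (s, x))) Z := by
      intro s
      refine (HasMFDerivAt.comp s ((hι (g (s, x))).mdifferentiableAt (by simp)).hasMFDerivAt
        (hgγ x s)).congr_mfderiv ?_
      refine ContinuousLinearMap.ext_ring ?_
      have h3 : (show F from ((1 : ℝ →L[ℝ] ℝ).smulRight (show F from Y (g (s, x)))) (1 : ℝ)) =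
        Y (g (s, x)) := one_smul ℝ _
      refine (congrArg (show F →L[ℝ] E from mfderiv J I ι (g (s, x))) h3).trans ?_
      exact (hY _).trans (one_smul ℝ (show E from Z (ι (g (s, x))))).symm
    exact congrFun (isMIntegralCurve_Ioo_eq_of_contMDiff_boundaryless (t₀ := 0) hZs.one (hχγ (ι x)) h1
      (by simp only [hχ0, hg0])) t
  · refine om_ext fun x u => ?_
    have hd := (hχ (0, x)).mdifferentiableAt (by simp)
    have h3 : ∀ {b b' : M} (v v' : Fin 2 → E), b = b' → v = v' →
        (show E [⋀^Fin 2]→L[ℝ] ℝ from ω₀.1 b) v = (show E [⋀^Fin 2]→L[ℝ] ℝ from ω₀.1 b') v' := by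
      rintro b b' v v' rfl rfl; rfl
    have h4 : u = fun _ => u 0 := funext fun i => by rw [Subsingleton.elim i 0]
    rw [h4, ← hZ]
    refine h3 _ _ (hχ0 x) (funext fun i => ?_)
    refine Fin.cases ?_ (fun j => ?_) i
    · refine (mfderiv_time hd).symm.trans ((DFunLike.congr_fun (hχd x).mfderiv (1 : ℝ)).trans ?_)
      exact one_smul ℝ _
    · rw [Subsingleton.elim j 0]
      refine (mfderiv_at_time hd (u 0)).symm.trans ?_
      have h5 : (fun x => χ (0, x)) = id := funext hχ0
      rw [h5, mfderiv_id]
      rfl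

end Moser

end SymplecticDeformation

namespace SymplecticDeformation

theorem exists_Icc_of_eventually {P : ℝ → Prop} (h : ∀ᶠ t in 𝓝 (0 : ℝ), P t) :
    ∃ ε > 0, ∀ t ∈ Icc 0 ε, P t := by
  obtain ⟨δ, hδ, h1⟩ := Metric.eventually_nhds_iff.1 h
  refine ⟨δ / 2, half_pos hδ, fun t ht => h1 ?_⟩
  rw [Real.dist_eq, sub_zero, abs_of_nonneg ht.1]
  linarith [ht.2]

section ZeroForm

variable {E : Type*} [NormedAddCommGroup E] [NormedSpace ℝ E]
  {H : Type*} [TopologicalSpace H] {I : ModelWithCorners ℝ E H} [I.Boundaryless]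
  {M : Type*} [TopologicalSpace M] [ChartedSpace H M] [IsManifold I ∞ M]

theorem contMDiff_zeroForm (b : Om I M 0) : ContMDiff I 𝓘(ℝ, ℝ) ∞ fun x => b.1 x 0 := by
  intro x₀
  let ev : (E [⋀^Fin 0]→L[ℝ] ℝ) →L[ℝ] ℝ := ContinuousAlternatingMap.apply ℝ E ℝ 0
  have h1 : ContDiffAt ℝ ∞ (fun y => ev (chartForm I b.1 x₀ y)) (extChartAt I x₀ x₀) :=
    ev.contDiff.contDiffAt.comp _ (IsSmoothForm.contDiffAt b.2 (mem_extChartAt_target x₀))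
  refine (ContMDiffAt.comp x₀ h1.contMDiffAt (contMDiffAt_extChartAt (n := ∞))).congr_of_eventuallyEq ?_
  filter_upwards [extChartAt_source_mem_nhds (I := I) x₀] with x hx
  have h2 := comp_congr b.1 ((extChartAt I x₀).left_inv hx).symm (0 : E →L[ℝ] E) (0 : E →L[ℝ] E) fun _ => rfl
  have h3 := DFunLike.congr_fun h2 0
  have h4 : ∀ (m : M) (u u' : Fin 0 → E), (show E [⋀^Fin 0]→L[ℝ] ℝ from b.1 m) u =
    (show E [⋀^Fin 0]→L[ℝ] ℝ from b.1 m) u' := fun m u u' => by rw [Subsingleton.elim u u']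
  exact (h4 _ _ _).trans (h3.trans (h4 _ _ _))

/-- A smooth function as a `0`-form. -/
noncomputable def zeroForm {h : M → ℝ} (hh : ContMDiff I 𝓘(ℝ, ℝ) ∞ h) : Om I M 0 :=
  ⟨fun x => ContinuousAlternatingMap.constOfIsEmpty ℝ (TangentSpace I x) (Fin 0) (h x), by
    intro x₀
    have h1 : ContDiffOn ℝ ∞ (fun y => h ((extChartAt I x₀).symm y)) (extChartAt I x₀).target :=
      (hh.comp_contMDiffOn (contMDiffOn_extChartAt_symm x₀)).contDiffOn
    refine ((ContinuousAlternatingMap.constOfIsEmptyLIE ℝ E ℝ (Fin 0)).contDiff.comp_contDiffOn h1).congr ?_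
    intro y hy
    rfl⟩

end ZeroForm

section Extension

variable {E : Type*} [NormedAddCommGroup E] [NormedSpace ℝ E] [FiniteDimensional ℝ E]
  {H : Type*} [TopologicalSpace H] {I : ModelWithCorners ℝ E H} [I.Boundaryless]
  {M : Type*} [TopologicalSpace M] [ChartedSpace H M] [IsManifold I ∞ M] [T2Space M] [CompactSpace M]
  {F : Type*} [NormedAddCommGroup F] [NormedSpace ℝ F]
  {K : Type*} [TopologicalSpace K] {J : ModelWithCorners ℝ F K} [J.Boundaryless]
  {L : Type*} [TopologicalSpace L] [ChartedSpace K L] [IsManifold J ∞ L] [CompactSpace L]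
  {ι : L → M} {ω₀ : Om I M 2}

namespace WeinsteinData

theorem exists_extension_zeroForm (W : WeinsteinData (J := J) ι ω₀) (hι : ContMDiff J I ∞ ι) (b : Om J L 0) :
    ∃ b' : Om I M 0, pull hι 0 b' = b := by
  classical
  let h : M → ℝ := fun y => if y ∈ W.ψ.target then W.f y * b.1 (W.retr y) 0 else 0
  have hh : ContMDiff I 𝓘(ℝ, ℝ) ∞ h := by
    intro y₀
    by_cases hy₀ : y₀ ∈ W.ψ.target
    · have h1 : ContMDiffAt I 𝓘(ℝ, ℝ) ∞ (fun y => W.f y * b.1 (W.retr y) 0) y₀ :=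
        W.contMDiff_f.contMDiffAt.mul (ContMDiffAt.comp y₀ (contMDiff_zeroForm b _) (W.contMDiffAt_retr hy₀))
      refine h1.congr_of_eventuallyEq ?_
      filter_upwards [W.ψ.open_target.mem_nhds hy₀] with y hy
      exact if_pos hy
    · have h0 : y₀ ∈ (tsupport W.f)ᶜ := fun h => hy₀ (W.tsupport_f h)
      have h1 : ContMDiffAt I 𝓘(ℝ, ℝ) ∞ (fun _ : M => (0 : ℝ)) y₀ := contMDiffAt_const
      refine h1.congr_of_eventuallyEq ?_
      filter_upwards [(isClosed_tsupport W.f).isOpen_compl.mem_nhds h0] with y hy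
      have hf : W.f y = 0 := image_eq_zero_of_notMem_tsupport hy
      simp only [h, hf, zero_mul, ite_self]
  refine ⟨zeroForm hh, om_ext fun x u => ?_⟩
  have h1 : h (ι x) = b.1 x 0 := by
    have h2 : W.f (ι x) = 1 := by
      refine W.f_eq_one _ (subset_closure ?_)
      rw [← W.ψ_zero x]
      exact mem_image_of_mem _ (W.zero_mem_V' x)
    have h3 : ∀ {x x' : L}, x = x' → b.1 x 0 = b.1 x' 0 := by
      rintro x _ rfl
      rfl
    simp only [h, if_pos (W.ι_mem_target x), h2, one_mul]
    exact h3 (W.retr_ι x)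
  have h3 : u = 0 := Subsingleton.elim _ _
  rw [h3, ← h1]
  rfl

end WeinsteinData

end Extension

section Families

variable {E : Type*} [NormedAddCommGroup E] [NormedSpace ℝ E]
  {H : Type*} [TopologicalSpace H] {I : ModelWithCorners ℝ E H} [I.Boundaryless]
  {M : Type*} [TopologicalSpace M] [ChartedSpace H M] [IsManifold I ∞ M]

/-- The derivative of `η_t` if that of `φ_t^* η_t` is known. -/
theorem isVelocity_of_pull {k : ℕ} {φ : ℝ × M → M} (hφ : ContMDiff (𝓘(ℝ, ℝ).prod I) I ∞ φ)
    (h0 : ∀ y, φ (0, y) = y) {η θ : ℝ → Om I M (k + 1)} (hη : IsSmoothFamily η)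
    (hd : d I M (k + 1) (η 0) = 0) {w : Om I M (k + 1)} (hw : IsVelocity θ w)
    (h : ∀ t, pull (contMDiff_at_time hφ t) (k + 1) (η t) = θ t) :
    IsVelocity η (w - d I M k (contr 0 (pull hφ (k + 1) (η 0)))) := by
  have h1 := (isVelocity_velocity hη).pull_time hφ hη hd
  simp only [h] at h1
  have h2 := h1.unique hw
  rw [pull_eq_self _ _ (funext h0)] at h2
  rw [← h2, add_sub_cancel_right]
  exact isVelocity_velocity hη

theorem contr_pull_snd {k : ℕ} (η : Om I M (k + 1)) (h : ContMDiff (𝓘(ℝ, ℝ).prod I) I ∞ fun p : ℝ × M => p.2) :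
    contr 0 (pull h (k + 1) η) = 0 := by
  rw [← contr_total (isSmoothFamily_const η) 0]
  congr 1
  refine om_ext fun p u => ?_
  have h1 : mfderiv (𝓘(ℝ, ℝ).prod I) I (fun p : ℝ × M => p.2) p = ContinuousLinearMap.snd ℝ ℝ E :=
    mfderiv_snd
  exact congrArg (show E [⋀^Fin (k + 1)]→L[ℝ] ℝ from η.1 p.2)
    (funext fun i => DFunLike.congr_fun h1 (u i))

end Families

section Existence

variable {E : Type*} [NormedAddCommGroup E] [NormedSpace ℝ E] [FiniteDimensional ℝ E]
  {H : Type*} [TopologicalSpace H] {I : ModelWithCorners ℝ E H} [I.Boundaryless]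
  {M : Type*} [TopologicalSpace M] [ChartedSpace H M] [IsManifold I ∞ M] [T2Space M] [CompactSpace M]
  {F : Type*} [NormedAddCommGroup F] [NormedSpace ℝ F]
  {K : Type*} [TopologicalSpace K] {J : ModelWithCorners ℝ F K} [J.Boundaryless]
  {L : Type*} [TopologicalSpace L] [ChartedSpace K L] [IsManifold J ∞ L] [CompactSpace L]
  {ι : L → M} {ω₀ : Om I M 2}

theorem isSymplectic_affine (hω₀ : IsSymplectic ω₀) {w : Om I M 2} (hw : d I M 2 w = 0) :
    ∀ᶠ t : ℝ in 𝓝 0, IsSymplectic (ω₀ + t • w) := by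
  refine eventually_isSymplectic (isSmoothFamily_affine ω₀ w) ?_ fun t => ?_
  · rwa [zero_smul, add_zero]
  · rw [map_add, map_smul, hω₀.1, hw, smul_zero, add_zero]

theorem relZ_subset_lagVelocities (hι : ContMDiff J I ∞ ι) (hω₀ : IsSymplectic ω₀)
    (hL : pull hι 2 ω₀ = 0) : (relZ hι : Set (Om I M 2)) ⊆ lagVelocities hι ω₀ := by
  rintro w ⟨hw1, hw2⟩
  have hw1' : pull hι 2 w = 0 := hw1
  obtain ⟨ε, hε, h⟩ := exists_Icc_of_eventually (isSymplectic_affine hω₀ hw2)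
  refine ⟨ε, fun t => ω₀ + t • w, ⟨hε, isSmoothFamily_affine ω₀ w, fun t ht => ⟨h t ht, ?_⟩, ?_⟩,
    isVelocity_affine ω₀ w⟩
  · rw [map_add, map_smul, hL, hw1', smul_zero, add_zero]
  · simp only [zero_smul, add_zero]

namespace WeinsteinData

/-- Every `1`-form on `L` extends to `M`; moreover there is an extension that is the derivative of a
family of diffeomorphisms generating `tβ`. -/
theorem exists_flowOut_smul (W : WeinsteinData (J := J) ι ω₀) (hι : ContMDiff J I ∞ ι) (β : Om J L 1) :
    ∃ (φ φ' : ℝ × M → M) (hφ : ContMDiff (𝓘(ℝ, ℝ).prod I) I ∞ φ)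
      (_ : ContMDiff (𝓘(ℝ, ℝ).prod I) I ∞ φ'),
      (∀ t y, φ (t, φ' (t, y)) = y) ∧ (∀ t y, φ' (t, φ (t, y)) = y) ∧ (∀ y, φ (0, y) = y) ∧
      (∀ᶠ t : ℝ in 𝓝 0, t • β ∈ W.sections ∧ ∀ x, φ (t, ι x) = W.ψ (toSection (t • β) x)) ∧
      pull hι 1 (contr 0 (pull hφ 2 ω₀)) = -β := by
  obtain ⟨φ, φ', hφ, hφ', h1, h2, h0, h3⟩ := W.exists_flowOut (isSmoothFamily_smul β)
  have hκ : ContMDiff (𝓘(ℝ, ℝ).prod J) I ∞ fun p : ℝ × L => φ (p.1, ι p.2) :=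
    hφ.comp (contMDiff_fst.prodMk (hι.comp contMDiff_snd))
  have hs : (0 : ℝ) • β ∈ W.sections := by rw [zero_smul]; exact W.zero_mem_sections
  refine ⟨φ, φ', hφ, hφ', h1, h2, h0 0 (zero_smul ℝ β), ?_, ?_⟩
  · filter_upwards [W.eventually_mem_sections (isSmoothFamily_smul β) hs] with t ht
    exact ⟨ht, (h3 t ht).1⟩
  · rw [contr_pull_restrict hι hφ hκ fun _ => rfl,
      W.contr_pull_ψ_toSection (isSmoothFamily_smul β) hs hκ fun t ht x => (h3 t ht).1 x,
      (isVelocity_velocity (isSmoothFamily_smul β)).unique (isVelocity_smul β)]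

theorem exists_extension (W : WeinsteinData (J := J) ι ω₀) (hι : ContMDiff J I ∞ ι) (β : Om J L 1) :
    ∃ β' : Om I M 1, pull hι 1 β' = β := by
  obtain ⟨φ, φ', hφ, -, -, -, -, -, h⟩ := W.exists_flowOut_smul hι β
  exact ⟨-contr 0 (pull hφ 2 ω₀), by rw [map_neg, h, neg_neg]⟩

theorem coneZ_subset_pairVelocities (W : WeinsteinData (J := J) ι ω₀) (hι : ContMDiff J I ∞ ι)
    (hω₀ : IsSymplectic ω₀) (hL : pull hι 2 ω₀ = 0) :
    (coneZ hι : Set (Om I M 2 × Om J L 1)) ⊆ W.pairVelocities := by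
  rintro ⟨v, β⟩ hv
  obtain ⟨hv1, hv2⟩ := (mem_coneZ_iff hι).1 hv
  obtain ⟨φ, φ', hφ, hφ', h1, h2, h0, h3, hc⟩ := W.exists_flowOut_smul hι β
  set c := contr 0 (pull hφ 2 ω₀) with hcdef
  have hw1 : d I M 2 (v + d I M 1 c) = 0 := by rw [map_add, d_d, hv1, add_zero]
  have hw2 : pull hι 2 (v + d I M 1 c) = 0 := by
    rw [map_add, pull_d, hc, map_neg, hv2, add_neg_cancel]
  obtain ⟨ε, hε, h⟩ := exists_Icc_of_eventually ((isSymplectic_affine hω₀ hw1).and h3)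
  have hsm := (isSmoothFamily_affine ω₀ (v + d I M 1 c)).pull_time hφ'
  have h0' : ∀ y, φ' (0, y) = y := fun y => by
    have := h2 0 y
    rwa [h0] at this
  have hη0 : pull (contMDiff_at_time hφ' 0) 2 (ω₀ + (0 : ℝ) • (v + d I M 1 c)) = ω₀ := by
    rw [zero_smul, add_zero, pull_eq_self _ _ (funext h0')]
  have hback : ∀ t : ℝ, pull (contMDiff_at_time hφ t) 2 (pull (contMDiff_at_time hφ' t) 2
      (ω₀ + t • (v + d I M 1 c))) = ω₀ + t • (v + d I M 1 c) := by
    intro t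
    rw [← pull_comp _ (contMDiff_at_time hφ' t) (contMDiff_at_time hφ t)
      ((contMDiff_at_time hφ' t).comp (contMDiff_at_time hφ t))]
    exact pull_eq_self _ _ (funext (h2 t))
  have hvel := isVelocity_of_pull hφ h0 hsm (by rw [hη0]; exact hω₀.1) (isVelocity_affine ω₀ (v + d I M 1 c))
    hback
  rw [hη0, ← hcdef, add_sub_cancel_right] at hvel
  refine ⟨ε, _, fun t => t • β, ⟨hε, hsm, isSmoothFamily_smul β, fun t ht => (h t ht).2.1,
    fun t ht => ⟨?_, t • β, (h t ht).2.1, rfl, ?_⟩, hη0, ?_⟩, hvel, isVelocity_smul β⟩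
  · exact IsSymplectic.pull (h t ht).1 _ (contMDiff_at_time hφ t) (h2 t) (h1 t)
  · have h4 : (fun x => W.ψ (toSection (t • β) x)) = (fun y => φ (t, y)) ∘ ι :=
      funext fun x => ((h t ht).2.2 x).symm
    simp only [h4]
    have h6 : pull hι 2 (ω₀ + t • (v + d I M 1 c)) = 0 := by
      rw [map_add, map_smul, hL, hw2, smul_zero, add_zero]
    have h5 := (congrArg (pull hι 2) (hback t)).trans h6
    rw [← pull_comp _ (contMDiff_at_time hφ t) hι ((contMDiff_at_time hφ t).comp hι)] at h5
    exact congrArg Subtype.val h5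
  · simp only [zero_smul]
    exact W.graph_zero_eq

end WeinsteinData

end Existence

end SymplecticDeformation

namespace SymplecticDeformation

section Existence

variable {E : Type*} [NormedAddCommGroup E] [NormedSpace ℝ E] [FiniteDimensional ℝ E]
  {H : Type*} [TopologicalSpace H] {I : ModelWithCorners ℝ E H} [I.Boundaryless]
  {M : Type*} [TopologicalSpace M] [ChartedSpace H M] [IsManifold I ∞ M] [T2Space M] [CompactSpace M]
  {F : Type*} [NormedAddCommGroup F] [NormedSpace ℝ F] [FiniteDimensional ℝ F]
  {K : Type*} [TopologicalSpace K] {J : ModelWithCorners ℝ F K} [J.Boundaryless]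
  {L : Type*} [TopologicalSpace L] [ChartedSpace K L] [IsManifold J ∞ L] [T2Space L] [CompactSpace L]
  {ι : L → M} {ω₀ : Om I M 2}

/-- Given a family `φ` of diffeomorphisms and a `1`-form `a` whose pullback to `L` is that of the
infinitesimal generator of `φ`, there is an isotopy that moves `L` like `φ` and whose inverse moves
`ω₀` in the direction `da`. -/
theorem exists_isotopy_of_oneForm (hdim : Module.finrank ℝ E = 2 * Module.finrank ℝ F)
    (W : WeinsteinData (J := J) ι ω₀) (hι : ContMDiff J I ∞ ι) (hω₀ : IsSymplectic ω₀)
    (hL : pull hι 2 ω₀ = 0) {φ φ' : ℝ × M → M} (hφ : ContMDiff (𝓘(ℝ, ℝ).prod I) I ∞ φ)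
    (hφ' : ContMDiff (𝓘(ℝ, ℝ).prod I) I ∞ φ') (h1 : ∀ t y, φ (t, φ' (t, y)) = y)
    (h2 : ∀ t y, φ' (t, φ (t, y)) = y) (h0 : ∀ y, φ (0, y) = y) {a : Om I M 1}
    (ha : pull hι 1 (contr 0 (pull hφ 2 ω₀) + a) = 0) :
    ∃ (ρ : ℝ → M → M) (η : ℝ → Om I M 2), (∀ ε, IsIsotopy I ε ρ) ∧ IsSmoothFamily η ∧
      (∀ t, IsSymplectic (η t)) ∧ η 0 = ω₀ ∧ IsVelocity η (d I M 1 a) ∧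
      (∀ t, ρ t '' range ι = range fun x => φ (t, ι x)) ∧ (∀ t, rawPull (I := I) (ρ t) (η t).1 = ω₀.1) ∧
      ∀ t, rawPull (I := J) (fun x => φ (t, ι x)) (η t).1 = 0 := by
  obtain ⟨χ, hχ, g, hg, hχ0, hχadd, hχι, hgadd, hg0, hχc⟩ := exists_lag_flow hdim W hι hω₀ hL
    (a := -(contr 0 (pull hφ 2 ω₀) + a)) (by rw [map_neg, ha, neg_zero])
  have hχ1 : ∀ t y, χ (t, χ (-t, y)) = y := fun t y => by rw [← hχadd, add_neg_cancel, hχ0]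
  have hχ2 : ∀ t y, χ (-t, χ (t, y)) = y := fun t y => by rw [← hχadd, neg_add_cancel, hχ0]
  have hρ : ContMDiff (𝓘(ℝ, ℝ).prod I) I ∞ fun p : ℝ × M => φ (p.1, χ p) := hφ.comp (contMDiff_timeMap hχ)
  have hneg : ContMDiff (𝓘(ℝ, ℝ).prod I) 𝓘(ℝ, ℝ) ∞ fun p : ℝ × M => -p.1 := contMDiff_fst.neg
  have hρ' : ContMDiff (𝓘(ℝ, ℝ).prod I) I ∞ fun p : ℝ × M => χ (-p.1, φ' p) := hχ.comp (hneg.prodMk hφ')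
  have hρ1 : ∀ t y, φ (t, χ (t, χ (-t, φ' (t, y)))) = y := fun t y => by rw [hχ1, h1]
  have hρ2 : ∀ t y, χ (-t, φ' (t, φ (t, χ (t, y)))) = y := fun t y => by rw [h2, hχ2]
  have hρ0 : ∀ y, φ (0, χ (0, y)) = y := fun y => by rw [hχ0, h0]
  have hρ0' : ∀ y, χ (-0, φ' (0, y)) = y := fun y => by rw [neg_zero, hχ0]; have := h2 0 y; rwa [h0] at this
  have hη := (isSmoothFamily_const ω₀).pull_time hρ'
  have hη0 : pull (contMDiff_at_time hρ' 0) 2 ω₀ = ω₀ := pull_eq_self _ _ (funext hρ0')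
  have hback : ∀ t, pull (contMDiff_at_time hρ t) 2 (pull (contMDiff_at_time hρ' t) 2 ω₀) = ω₀ := by
    intro t
    rw [← pull_comp _ (contMDiff_at_time hρ' t) (contMDiff_at_time hρ t)
      ((contMDiff_at_time hρ' t).comp (contMDiff_at_time hρ t))]
    exact pull_eq_self _ _ (funext (hρ2 t))
  have hcontr : contr 0 (pull hρ 2 ω₀) = -a := by
    have h3 : pull hρ 2 ω₀ = pull (contMDiff_timeMap hχ) 2 (pull hφ 2 ω₀) :=
      pull_comp ω₀ hφ (contMDiff_timeMap hχ) (hφ.comp (contMDiff_timeMap hχ))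
    have h4 : pull (contMDiff_slice I M 0) 2 (pull hφ 2 ω₀) = ω₀ := by
      rw [← pull_comp _ hφ (contMDiff_slice I M 0) (hφ.comp (contMDiff_slice I M 0))]
      exact pull_eq_self _ _ (funext h0)
    rw [h3, contr_pull_timeMap hχ, pull_eq_self _ _ (funext hχ0), h4, hχc]
    abel
  have hvel := isVelocity_of_pull hρ hρ0 hη (by rw [hη0]; exact hω₀.1)
    (w := 0) (θ := fun _ => ω₀) (fun x u => hasDerivAt_const _ _) hback
  rw [hη0, hcontr, map_neg, sub_neg_eq_add, zero_add] at hvel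
  refine ⟨fun t y => φ (t, χ (t, y)), _, fun ε => ⟨hρ, funext hρ0, fun t _ =>
    ⟨diffeoOf (contMDiff_at_time hρ t) (contMDiff_at_time hρ' t) (hρ1 t) (hρ2 t), rfl⟩⟩, hη,
    fun t => ?_, hη0, hvel, fun t => ?_, fun t => congrArg Subtype.val (hback t), fun t => ?_⟩
  · exact IsSymplectic.pull hω₀ _ (contMDiff_at_time hρ t) (hρ2 t) (hρ1 t)
  · rw [← range_comp]
    have h3 : (fun y => φ (t, χ (t, y))) ∘ ι = (fun x => φ (t, ι x)) ∘ fun x => g (t, x) := by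
      funext x
      simp only [Function.comp_apply, hχι]
    rw [h3]
    refine Function.Surjective.range_comp (fun x => ⟨g (-t, x), ?_⟩) _
    rw [← hgadd, add_neg_cancel, hg0]
  · have hφι : ContMDiff J I ∞ fun x => φ (t, ι x) := (contMDiff_at_time hφ t).comp hι
    have hg' := contMDiff_at_time hg (-t)
    have h3 : (fun y => χ (-t, φ' (t, y))) ∘ (fun x => φ (t, ι x)) = ι ∘ fun x => g (-t, x) := by
      funext x
      simp only [Function.comp_apply, h2, hχι]
    have h4 := rawPull_comp ω₀.1 (contMDiff_at_time hρ' t) hφι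
    have h5 := congrArg Subtype.val (pull_comp ω₀ hι hg' (hι.comp hg'))
    rw [hL, map_zero] at h5
    rw [h3] at h4
    exact h4.symm.trans h5

theorem relB_subset_trivialLagVelocities (hdim : Module.finrank ℝ E = 2 * Module.finrank ℝ F)
    (W : WeinsteinData (J := J) ι ω₀) (hι : ContMDiff J I ∞ ι) (hω₀ : IsSymplectic ω₀)
    (hL : pull hι 2 ω₀ = 0) : (relB hι : Set (Om I M 2)) ⊆ trivialLagVelocities hι ω₀ := by
  rintro _ ⟨a, ha, rfl⟩
  have ha' : pull hι 1 a = 0 := ha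
  have hφ : ContMDiff (𝓘(ℝ, ℝ).prod I) I ∞ fun p : ℝ × M => p.2 := contMDiff_snd
  obtain ⟨ρ, η, hρ, hη, hsym, h0, hv, hρL, hρη, hLag⟩ := exists_isotopy_of_oneForm hdim W hι hω₀ hL hφ hφ
    (fun _ _ => rfl) (fun _ _ => rfl) (fun _ => rfl) (a := a) (by rw [contr_pull_snd, zero_add, ha'])
  exact ⟨1, η, ⟨one_pos, hη, fun t _ => ⟨hsym t, Subtype.ext (hLag t)⟩, h0⟩, hv, ρ, hρ 1,
    fun t _ => ⟨hρL t, hρη t⟩⟩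

theorem coneB_subset_trivialPairVelocities (hdim : Module.finrank ℝ E = 2 * Module.finrank ℝ F)
    (W : WeinsteinData (J := J) ι ω₀) (hι : ContMDiff J I ∞ ι) (hω₀ : IsSymplectic ω₀)
    (hL : pull hι 2 ω₀ = 0) : (coneB hι : Set (Om I M 2 × Om J L 1)) ⊆ W.trivialPairVelocities := by
  rintro _ ⟨⟨a₀, b⟩, rfl⟩
  obtain ⟨b', hb'⟩ := W.exists_extension_zeroForm hι b
  set a := a₀ - d I M 0 b' with ha
  obtain ⟨φ, φ', hφ, hφ', h1, h2, h0, h3, hc⟩ := W.exists_flowOut_smul hι (pull hι 1 a)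
  obtain ⟨ρ, η, hρ, hη, hsym, hη0, hv, hρL, hρη, hLag⟩ := exists_isotopy_of_oneForm hdim W hι hω₀ hL hφ hφ'
    h1 h2 h0 (a := a) (by rw [map_add, hc, neg_add_cancel])
  obtain ⟨ε, hε, h⟩ := exists_Icc_of_eventually h3
  have hgr : ∀ t ∈ Icc 0 ε, (fun x => φ (t, ι x)) = fun x => W.ψ (toSection (t • pull hι 1 a) x) :=
    fun t ht => funext (h t ht).2
  have hva : coneD hι 0 (a₀, b) = (d I M 1 a, pull hι 1 a) := by
    refine Prod.ext ?_ ?_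
    · change d I M 1 a₀ = d I M 1 a
      rw [ha, map_sub, d_d, sub_zero]
    · change pull hι 1 a₀ - d J L 0 b = pull hι 1 a
      rw [ha, map_sub, pull_d, hb']
  rw [hva]
  refine ⟨ε, η, fun t => t • pull hι 1 a, ⟨hε, hη, isSmoothFamily_smul _, fun t ht => (h t ht).1,
    fun t ht => ⟨hsym t, _, (h t ht).1, rfl, ?_⟩, hη0, ?_⟩, hv, isVelocity_smul _, ρ, hρ ε,
    fun t ht => ⟨?_, hρη t⟩⟩
  · rw [← hgr t ht]
    exact hLag t
  · simp only [zero_smul]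
    exact W.graph_zero_eq
  · rw [hρL t, hgr t ht]
    rfl

end Existence

end SymplecticDeformation

namespace SymplecticDeformation

section Inverse

variable {E : Type*} [NormedAddCommGroup E] [NormedSpace ℝ E] [FiniteDimensional ℝ E]
  {H : Type*} [TopologicalSpace H] {I : ModelWithCorners ℝ E H} [I.Boundaryless]
  {M : Type*} [TopologicalSpace M] [ChartedSpace H M] [IsManifold I ∞ M]
  {H' : Type*} [TopologicalSpace H'] {I' : ModelWithCorners ℝ E H'} [I'.Boundaryless]
  {M' : Type*} [TopologicalSpace M'] [ChartedSpace H' M'] [IsManifold I' ∞ M']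

/-- The inverse of a smooth bijection with injective differentials is smooth. -/
theorem contMDiff_of_inverse {g : M → M'} {g' : M' → M} (hg : ContMDiff I I' ∞ g)
    (h1 : ∀ x, g' (g x) = x) (h2 : ∀ y, g (g' y) = y)
    (hd : ∀ x, Function.Injective (mfderiv I I' g x)) : ContMDiff I' I ∞ g' := by
  intro y₀
  obtain ⟨x₀, rfl⟩ : ∃ x, g x = y₀ := ⟨g' y₀, h2 y₀⟩
  set z₀ := extChartAt I x₀ x₀
  set f : E → E := inCharts I I' g x₀ (g x₀)
  have hx₀ : (extChartAt I x₀).symm z₀ = x₀ := extChartAt_to_inv x₀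
  have hf : ContDiffAt ℝ ∞ f z₀ := contDiffAt_inCharts hg
    (by rw [hx₀]; exact mem_extChartAt_source _) (mem_extChartAt_target x₀)
  have hfz : f z₀ = extChartAt I' (g x₀) (g x₀) := by
    simp only [f, inCharts, hx₀]
  have hfd : mfderiv I I' g x₀ = fderiv ℝ f z₀ := by
    have h3 : mfderiv I I' g x₀ = fderivWithin ℝ f (range I) z₀ :=
      if_pos ((hg x₀).mdifferentiableAt (by simp))
    rwa [I.range_eq_univ, fderivWithin_univ] at h3
  let A : E →L[ℝ] E := fderiv ℝ f z₀
  have hA : Function.Injective (A : E →ₗ[ℝ] E) := by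
    have := hd x₀
    rw [hfd] at this
    exact this
  let e : E ≃L[ℝ] E := (LinearEquiv.ofInjectiveEndo (A : E →ₗ[ℝ] E) hA).toContinuousLinearEquiv
  have he : HasFDerivAt f (e : E →L[ℝ] E) z₀ := by
    have h3 : (e : E →L[ℝ] E) = A := by
      ext v
      rfl
    rw [h3]
    exact (hf.differentiableAt (by simp)).hasFDerivAt
  have hn : (∞ : WithTop ℕ∞) ≠ 0 := by simp
  let l : E → E := hf.localInverse he hn
  have hl : ContDiffAt ℝ ∞ l (f z₀) := hf.to_localInverse he hn
  have hl0 : l (f z₀) = z₀ := hf.localInverse_apply_image he hn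
  have hlr : ∀ᶠ w in 𝓝 (f z₀), f (l w) = w :=
    (hf.hasStrictFDerivAt' he hn).eventually_right_inverse
  let k : M' → M := fun y => (extChartAt I x₀).symm (l (extChartAt I' (g x₀) y))
  have hch : ContMDiffAt I' 𝓘(ℝ, E) ∞ (extChartAt I' (g x₀)) (g x₀) := contMDiffAt_extChartAt
  have hk1 : ContMDiffAt I' 𝓘(ℝ, E) ∞ (fun y => l (extChartAt I' (g x₀) y)) (g x₀) := by
    refine ContMDiffAt.comp (g x₀) (g := l) ?_ hch
    rw [← hfz]
    exact hl.contMDiffAt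
  have hl0' : l (extChartAt I' (g x₀) (g x₀)) = z₀ := by rw [← hfz, hl0]
  have hk : ContMDiffAt I' I ∞ k (g x₀) := by
    refine ContMDiffAt.comp (g x₀) (g := (extChartAt I x₀).symm) ?_ hk1
    rw [hl0']
    exact (contMDiffOn_extChartAt_symm x₀).contMDiffAt (extChartAt_target_mem_nhds x₀)
  have hk0 : k (g x₀) = x₀ := by
    simp only [k, hl0', hx₀]
  refine hk.congr_of_eventuallyEq ?_
  have hc : ContinuousAt (fun y => g (k y)) (g x₀) :=
    ContinuousAt.comp (f := k) (g := g) hg.continuous.continuousAt hk.continuousAt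
  have hs : ∀ᶠ y in 𝓝 (g x₀), g (k y) ∈ (extChartAt I' (g x₀)).source :=
    hc.eventually (by
      beta_reduce
      rw [hk0]
      exact extChartAt_source_mem_nhds (g x₀))
  have ht := (continuousAt_extChartAt (I := I') (g x₀)).eventually (hfz ▸ hlr)
  filter_upwards [hs, ht, extChartAt_source_mem_nhds (I := I') (g x₀)] with y hy1 hy2 hy3
  have h3 : g (k y) = y := (extChartAt I' (g x₀)).injOn hy1 hy3 hy2
  have h4 := h1 (k y)
  rwa [h3] at h4

end Inverse

section Induced

variable {E : Type*} [NormedAddCommGroup E] [NormedSpace ℝ E] [FiniteDimensional ℝ E]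
  {H : Type*} [TopologicalSpace H] {I : ModelWithCorners ℝ E H} [I.Boundaryless]
  {M : Type*} [TopologicalSpace M] [ChartedSpace H M] [IsManifold I ∞ M] [T2Space M] [CompactSpace M]
  {F : Type*} [NormedAddCommGroup F] [NormedSpace ℝ F] [FiniteDimensional ℝ F]
  {K : Type*} [TopologicalSpace K] {J : ModelWithCorners ℝ F K} [J.Boundaryless]
  {L : Type*} [TopologicalSpace L] [ChartedSpace K L] [IsManifold J ∞ L] [CompactSpace L]
  {ι : L → M} {ω₀ : Om I M 2}

namespace WeinsteinData

variable (W : WeinsteinData (J := J) ι ω₀)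

/-- An isotopy that moves a graph through graphs moves it through the graphs of a smooth family of
sections, after reparametrization. -/
theorem exists_family_of_isotopy {σ : Om J L 1} (hσ : σ ∈ W.sections) {ρ : ℝ → M → M}
    (hρ : IsIsotopy I 1 ρ)
    (h : ∀ t ∈ Icc (0 : ℝ) 1, ∃ σ' ∈ W.sections, ρ t '' W.graph σ = W.graph σ') :
    ∃ α : ℝ → Om J L 1, IsSmoothFamily α ∧ ∀ t, α t ∈ W.sections ∧
      W.graph (α t) = ρ (Real.smoothTransition t) '' W.graph σ := by
  have hχ : ∀ t, Real.smoothTransition t ∈ Icc (0 : ℝ) 1 := fun t =>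
    ⟨Real.smoothTransition.nonneg t, Real.smoothTransition.le_one t⟩
  choose s hs hgr using fun t => h _ (hχ t)
  have hj := W.contMDiff_ψ_toSection hσ
  have hχs : ContMDiff 𝓘(ℝ, ℝ) 𝓘(ℝ, ℝ) ∞ Real.smoothTransition :=
    Real.smoothTransition.contDiff.contMDiff
  let G : ℝ × L → M := fun p => ρ (Real.smoothTransition p.1) (W.ψ (toSection σ p.2))
  have hG : ContMDiff (𝓘(ℝ, ℝ).prod J) I ∞ G :=
    hρ.contMDiff.comp ((hχs.comp contMDiff_fst).prodMk (hj.comp contMDiff_snd))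
  let c : ℝ × L → L := fun p => W.retr (G p)
  have hGs : ∀ t x, W.ψ (toSection (s t) (c (t, x))) = G (t, x) := by
    intro t x
    have h1 : G (t, x) ∈ W.graph (s t) := by
      rw [← hgr]
      exact mem_image_of_mem _ (mem_range_self x)
    obtain ⟨y, hy⟩ := h1
    have h2 : c (t, x) = y := by
      simp only [c, ← hy]
      exact W.retr_ψ (W.V'_subset (hs t y))
    rw [h2]
    exact hy
  have hGt : ∀ p, G p ∈ W.ψ.target := fun p => by
    rw [← hGs p.1 p.2]
    exact W.ψ.map_source (W.V'_subset (hs _ _))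
  have hc : ContMDiff (𝓘(ℝ, ℝ).prod J) J ∞ c := fun p =>
    ContMDiffAt.comp (g := W.retr) (f := G) p (W.contMDiffAt_retr (hGt p)) (hG p)
  have hjinj : ∀ x x', W.ψ (toSection σ x) = W.ψ (toSection σ x') → x = x' := fun x x' hx => by
    have h1 := congrArg W.retr hx
    rwa [W.retr_ψ (W.V'_subset (hσ x)), W.retr_ψ (W.V'_subset (hσ x'))] at h1
  have hcinj : ∀ t x x', c (t, x) = c (t, x') → x = x' := by
    intro t x x' hx
    have h1 : G (t, x) = G (t, x') := by rw [← hGs, ← hGs, hx]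
    obtain ⟨Φ, hΦ⟩ := hρ.diffeo _ (hχ t)
    refine hjinj x x' (Φ.injective ?_)
    change Φ _ = Φ _
    rw [hΦ]
    exact h1
  have hcsurj : ∀ p : ℝ × L, ∃ x, c (p.1, x) = p.2 := by
    rintro ⟨t, y⟩
    have h1 : W.ψ (toSection (s t) y) ∈ ρ (Real.smoothTransition t) '' W.graph σ := by
      rw [hgr]
      exact mem_range_self y
    obtain ⟨_, ⟨x, rfl⟩, hx⟩ := h1
    refine ⟨x, ?_⟩
    have h2 : G (t, x) = W.ψ (toSection (s t) y) := hx
    simp only [c, h2]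
    exact W.retr_ψ (W.V'_subset (hs t y))
  choose b hb using hcsurj
  have hdj : ∀ x, Function.Injective (mfderiv J I (fun x => W.ψ (toSection σ x)) x) := by
    intro x
    refine (injective_iff_map_eq_zero _).2 fun v hv => ?_
    have ht := W.ψ.map_source (W.V'_subset (hσ x))
    have h1 := mfderiv_comp x ((W.contMDiffAt_retr ht).mdifferentiableAt (by simp))
      ((hj x).mdifferentiableAt (by simp))
    have h2 : (W.retr ∘ fun x => W.ψ (toSection σ x)) = id :=
      funext fun x => W.retr_ψ (W.V'_subset (hσ x))
    rw [h2, mfderiv_id] at h1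
    refine (DFunLike.congr_fun h1 v).trans ?_
    refine (congrArg (mfderiv I J W.retr _) hv).trans ?_
    exact map_zero (show E →L[ℝ] F from mfderiv I J W.retr (W.ψ (toSection σ x)))
  have hdc : ∀ t x, Function.Injective (mfderiv J J (fun x => c (t, x)) x) := by
    intro t x
    refine (injective_iff_map_eq_zero _).2 fun v hv => ?_
    obtain ⟨Φ, hΦ⟩ := hρ.diffeo _ (hχ t)
    have hct : MDifferentiableAt J J (fun x => c (t, x)) x :=
      (contMDiff_at_time hc t x).mdifferentiableAt (by simp)
    have h1 := mfderiv_comp x (((W.contMDiff_ψ_toSection (hs t)) (c (t, x))).mdifferentiableAt (by simp)) hct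
    have h2 := mfderiv_comp x ((Φ.contMDiff (W.ψ (toSection σ x))).mdifferentiableAt (by simp))
      ((hj x).mdifferentiableAt (by simp))
    have h3 : (fun x => W.ψ (toSection (s t) x)) ∘ (fun x => c (t, x)) =
        Φ ∘ fun x => W.ψ (toSection σ x) := by
      rw [hΦ]
      exact funext (hGs t)
    rw [h3, h2] at h1
    have h4 := (DFunLike.congr_fun h1 v).trans
      ((congrArg (mfderiv J I (fun x => W.ψ (toSection (s t) x)) (c (t, x))) hv).trans
        (map_zero (show F →L[ℝ] E from mfderiv J I (fun x => W.ψ (toSection (s t) x)) (c (t, x)))))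
    refine hdj x ((Φ.mfderivToContinuousLinearEquiv (by simp) _).injective ?_)
    refine h4.trans (Eq.symm ((congrArg _ (map_zero (mfderiv J I (fun x => W.ψ (toSection σ x)) x))).trans ?_))
    exact map_zero (Φ.mfderivToContinuousLinearEquiv (by simp) _)
  have hinv : ContMDiff (𝓘(ℝ, ℝ).prod J) (𝓘(ℝ, ℝ).prod J) ∞ (timeMap b) := by
    refine contMDiff_of_inverse (contMDiff_timeMap hc) ?_ ?_ ?_
    · rintro ⟨t, x⟩
      exact Prod.ext rfl (hcinj t _ _ (hb (t, c (t, x))))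
    · rintro ⟨t, x⟩
      exact Prod.ext rfl (hb (t, x))
    · rintro ⟨t, x⟩
      have hcd := (hc (t, x)).mdifferentiableAt (by simp : (∞ : WithTop ℕ∞) ≠ 0)
      refine (injective_iff_map_eq_zero _).2 ?_
      rintro ⟨r, v⟩ hv
      have h1 := (mfderiv_timeMap hcd _).symm.trans hv
      obtain rfl : r = 0 := congrArg Prod.fst h1
      have h2 : v = 0 := by
        refine (injective_iff_map_eq_zero _).1 (hdc t x) v ?_
        exact (mfderiv_at_time hcd v).trans (congrArg Prod.snd h1)
      rw [h2]
      rfl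
  have hbs : ContMDiff (𝓘(ℝ, ℝ).prod J) J ∞ b := contMDiff_snd.comp hinv
  let S : ℝ × L → CotangentBundle J L := fun p => W.ψ.symm (G (p.1, b p))
  have hSs : ∀ t x, S (t, x) = toSection (s t) x := by
    intro t x
    simp only [S]
    rw [← hGs, hb (t, x)]
    exact W.ψ.left_inv (W.V'_subset (hs t x))
  have hS : ContMDiff (𝓘(ℝ, ℝ).prod J) (cotangentModel J) ∞ S := fun p =>
    ContMDiffAt.comp p (W.contMDiffAt_ψ_symm (hGt (p.1, b p)))
      ((hG.comp (contMDiff_fst.prodMk hbs)) p)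
  obtain ⟨α, hα, hαS⟩ := exists_family_of_section hS fun p => by rw [hSs p.1 p.2]; rfl
  have hαs : ∀ t x, toSection (α t) x = toSection (s t) x := fun t x => (hαS t x).trans (hSs t x)
  refine ⟨α, hα, fun t => ⟨fun x => ?_, ?_⟩⟩
  · rw [hαs]
    exact hs t x
  · rw [hgr]
    exact congrArg range (funext fun x => by rw [hαs])

theorem exists_lagForm (hι : ContMDiff J I ∞ ι) (p : W.pairs) : ∃ η : lagForms hι, η.1.1 = W.q p.1 := by
  obtain ⟨⟨θ, L'⟩, hp⟩ := p
  obtain ⟨hω, σ, hσ, hL', hpull⟩ := hp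
  obtain rfl : L' = W.graph σ := hL'
  obtain ⟨φ, φ', hφ, hφ', h1, h2, -, h3⟩ := W.exists_flowOut (isSmoothFamily_const σ)
  obtain ⟨h4, h5⟩ := h3 0 hσ
  refine ⟨⟨pull (contMDiff_at_time hφ 0) 2 θ, IsSymplectic.pull hω _ (contMDiff_at_time hφ' 0) (h1 0) (h2 0), ?_⟩, ?_⟩
  · rw [← pull_comp _ (contMDiff_at_time hφ 0) hι ((contMDiff_at_time hφ 0).comp hι)]
    refine Subtype.ext (Eq.trans ?_ hpull)
    change rawPull ((fun x => φ (0, x)) ∘ ι) θ.1 = rawPull _ θ.1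
    congr 1
    exact funext h4
  · exact (congrArg (fun g => rawPull (I := I) g θ.1) h5).symm

theorem lagRel_of_pairRel (hι : ContMDiff J I ∞ ι) {p p' : W.pairs} (h : W.pairRel p p')
    {η η' : lagForms hι} (hη : η.1.1 = W.q p.1) (hη' : η'.1.1 = W.q p'.1) : lagRel hι η η' := by
  obtain ⟨⟨θ, L'⟩, hp⟩ := p
  obtain ⟨⟨θ', L''⟩, hp'⟩ := p'
  obtain ⟨ρ, hρ, hρ1, hρω, hρs⟩ := h
  obtain ⟨-, σ, hσ, hL', -⟩ := id hp
  obtain rfl : L' = W.graph σ := hL'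
  obtain ⟨α, hα, hαs⟩ := W.exists_family_of_isotopy hσ hρ fun t ht => hρs t ht
  obtain ⟨φ, φ', hφ, hφ', h1, h2, -, h3⟩ := W.exists_flowOut hα
  have h4 := fun t => h3 t (hαs t).1
  have hχ : ∀ t, Real.smoothTransition t ∈ Icc (0 : ℝ) 1 := fun t =>
    ⟨Real.smoothTransition.nonneg t, Real.smoothTransition.le_one t⟩
  have hχs : ContMDiff 𝓘(ℝ, ℝ) 𝓘(ℝ, ℝ) ∞ Real.smoothTransition :=
    Real.smoothTransition.contDiff.contMDiff
  have hg0 : W.graph (α 0) = W.graph σ := by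
    rw [(hαs 0).2, Real.smoothTransition.zero, hρ.zero, image_id]
  have hg1 : W.graph (α 1) = L'' := by
    rw [(hαs 1).2, Real.smoothTransition.one]
    exact hρ1
  have himg : ∀ t, (fun y => φ (t, y)) '' range ι = W.graph (α t) := fun t => by
    rw [← range_comp]
    exact congrArg range (funext (h4 t).1)
  have hφ0 : ContMDiff (𝓘(ℝ, ℝ).prod I) I ∞ fun p : ℝ × M => φ (0, p.2) :=
    (contMDiff_at_time hφ 0).comp contMDiff_snd
  refine ⟨fun t y => φ' (t, ρ (Real.smoothTransition t) (φ (0, y))), ⟨?_, ?_, fun t _ => ?_⟩, ?_,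
    fun t _ => ?_⟩
  · exact hφ'.comp (contMDiff_fst.prodMk (hρ.contMDiff.comp ((hχs.comp contMDiff_fst).prodMk hφ0)))
  · funext y
    rw [Real.smoothTransition.zero, hρ.zero]
    exact h2 0 y
  · obtain ⟨Φ, hΦ⟩ := hρ.diffeo _ (hχ t)
    refine ⟨((diffeoOf (contMDiff_at_time hφ 0) (contMDiff_at_time hφ' 0) (h1 0) (h2 0)).trans Φ).trans
      (diffeoOf (contMDiff_at_time hφ' t) (contMDiff_at_time hφ t) (h2 t) (h1 t)), ?_⟩
    rw [← hΦ]
    rfl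
  · have e1 : η'.1.1 = rawPull (I := I) (fun y => φ (1, y)) θ'.1 := by
      rw [hη', ← (h4 1).2, hg1]
      rfl
    have e2 : η.1.1 = rawPull (I := I) (fun y => φ (0, y)) θ.1 := by
      rw [hη, ← (h4 0).2, hg0]
      rfl
    have hρ1s : ContMDiff I I ∞ (ρ 1) := contMDiff_at_time hρ.contMDiff 1
    have hφ0s := contMDiff_at_time hφ 0
    have e3 : rawPull (I := I) (ρ 1) θ'.1 = θ.1 := hρω
    beta_reduce
    rw [e1, e2, ← e3, Real.smoothTransition.one]
    refine (rawPull_comp _ (contMDiff_at_time hφ 1)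
      ((contMDiff_at_time hφ' 1).comp (hρ1s.comp hφ0s))).symm.trans (Eq.trans ?_ (rawPull_comp _ hρ1s hφ0s))
    congr 1
    exact funext fun y => h1 1 _
  · have e : (fun y => φ' (t, ρ (Real.smoothTransition t) (φ (0, y)))) '' range ι =
        (fun y => φ' (t, y)) '' (ρ (Real.smoothTransition t) '' ((fun y => φ (0, y)) '' range ι)) := by
      rw [image_image, image_image]
    rw [e, himg 0, hg0, ← (hαs t).2, ← himg t, image_image]
    simp only [h2, image_id']

end WeinsteinData

end Induced

end SymplecticDeformation

namespace SymplecticDeformation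

theorem exists_subQuotEquiv {A : Type*} [AddCommGroup A] [Module ℝ A] {Z Z' B B' : Submodule ℝ A}
    (hZ : Z = Z') (hB : B = B') : ∃ Φ : SubQuot Z B ≃ₗ[ℝ] SubQuot Z' B',
      ∀ a (ha : a ∈ Z), ∃ ha' : a ∈ Z', Φ (cls _ a ha) = cls _ a ha' := by
  subst hZ hB
  exact ⟨LinearEquiv.refl ℝ _, fun a ha => ⟨ha, rfl⟩⟩

theorem cls_eq_iff {A : Type*} [AddCommGroup A] [Module ℝ A] {Z B : Submodule ℝ A} {a b : A}
    (ha : a ∈ Z) (hb : b ∈ Z) : cls B a ha = cls B b hb ↔ a - b ∈ B :=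
  Submodule.Quotient.eq _

section Linearization

variable {E : Type*} [NormedAddCommGroup E] [NormedSpace ℝ E] [FiniteDimensional ℝ E]
  {H : Type*} [TopologicalSpace H] {I : ModelWithCorners ℝ E H} [I.Boundaryless]
  {M : Type*} [TopologicalSpace M] [ChartedSpace H M] [IsManifold I ∞ M] [T2Space M] [CompactSpace M]
  {F : Type*} [NormedAddCommGroup F] [NormedSpace ℝ F] [FiniteDimensional ℝ F]
  {K : Type*} [TopologicalSpace K] {J : ModelWithCorners ℝ F K} [J.Boundaryless]
  {L : Type*} [TopologicalSpace L] [ChartedSpace K L] [IsManifold J ∞ L] [CompactSpace L]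
  {ι : L → M} {ω₀ : Om I M 2}

namespace WeinsteinData

variable (W : WeinsteinData (J := J) ι ω₀) (hι : ContMDiff J I ∞ ι)

theorem exists_isInducedByQ : ∃ Q : W.PairModuli → LagModuli hι, W.IsInducedByQ hι Q := by
  choose η hη using W.exists_lagForm hι
  exact ⟨Quot.lift (fun p => Quot.mk _ (η p)) fun p p' h =>
    Quot.sound (W.lagRel_of_pairRel hι h (hη p) (hη p')), fun p => ⟨η p, hη p, rfl⟩⟩

/-- The relative cohomology is isomorphic to the cohomology of the mapping cone. -/
theorem exists_cohomologyEquiv (W : WeinsteinData (J := J) ι ω₀) : ∃ Θ : H2Cone hι ≃ₗ[ℝ] H2Rel hι,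
    ∀ (η : Om I M 2) (β : Om J L 1) (h : (η, β) ∈ coneZ hι) (β' : Om I M 1), pull hι 1 β' = β →
      ∃ h' : η - d I M 1 β' ∈ relZ hι, Θ (cls _ (η, β) h) = cls _ (η - d I M 1 β') h' := by
  have hZ : ∀ η ∈ relZ hι, ((η, 0) : Om I M 2 × Om J L 1) ∈ coneZ hι := by
    rintro η ⟨h1, h2⟩
    refine (mem_coneZ_iff hι).2 ⟨h2, ?_⟩
    rw [map_zero]
    exact h1
  have hB : (relB hι).submoduleOf (relZ hι) ≤ ((coneB hι).submoduleOf (coneZ hι)).comap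
      ((LinearMap.inl ℝ (Om I M 2) (Om J L 1)).restrict hZ) := by
    rintro ⟨_, hη⟩ ⟨γ, hγ, rfl⟩
    have hγ' : pull hι 1 γ = 0 := hγ
    refine ⟨(γ, 0), Prod.ext rfl ?_⟩
    change pull hι 1 γ - d J L 0 0 = 0
    rw [hγ', map_zero, sub_zero]
  let k : H2Rel hι →ₗ[ℝ] H2Cone hι := Submodule.mapQ _ _ _ hB
  have hk : ∀ η (hη : η ∈ relZ hι), k (cls _ η hη) = cls _ (η, 0) (hZ η hη) := fun _ _ => rfl
  have key : ∀ (η : Om I M 2) (β : Om J L 1) (h : (η, β) ∈ coneZ hι) (β' : Om I M 1),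
      pull hι 1 β' = β → ∃ h' : η - d I M 1 β' ∈ relZ hι,
        k (cls _ (η - d I M 1 β') h') = cls _ (η, β) h := by
    intro η β h β' hβ
    obtain ⟨h1, h2⟩ := (mem_coneZ_iff hι).1 h
    have h' : η - d I M 1 β' ∈ relZ hι := by
      refine ⟨?_, ?_⟩
      · change pull hι 2 (η - d I M 1 β') = 0
        rw [map_sub, pull_d, hβ, h2, sub_self]
      · change d I M 2 (η - d I M 1 β') = 0
        rw [map_sub, h1, d_d, sub_zero]
    refine ⟨h', ?_⟩
    rw [hk, cls_eq_iff]
    refine ⟨(-β', 0), Prod.ext ?_ ?_⟩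
    · change d I M 1 (-β') = η - d I M 1 β' - η
      rw [map_neg]
      abel
    · change pull hι 1 (-β') - d J L 0 0 = 0 - β
      rw [map_neg, map_zero, hβ, sub_zero, zero_sub]
  have hbij : Function.Bijective k := by
    refine ⟨(injective_iff_map_eq_zero k).2 fun τ hτ => ?_, fun τ => ?_⟩
    · obtain ⟨⟨η, hη⟩, rfl⟩ := Submodule.Quotient.mk_surjective _ τ
      have h1 : (η, 0) ∈ coneB hι := (Submodule.Quotient.mk_eq_zero ((coneB hι).submoduleOf (coneZ hι))).1 hτ
      obtain ⟨⟨γ, b⟩, hγ⟩ := h1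
      have h2 : d I M 1 γ = η := congrArg Prod.fst hγ
      have h3 : pull hι 1 γ - d J L 0 b = 0 := congrArg Prod.snd hγ
      obtain ⟨b', hb'⟩ := W.exists_extension_zeroForm hι b
      refine (Submodule.Quotient.mk_eq_zero _).2 ⟨γ - d I M 0 b', ?_, ?_⟩
      · change pull hι 1 (γ - d I M 0 b') = 0
        rw [map_sub, pull_d, hb', h3]
      · rw [map_sub, d_d, sub_zero]
        exact h2
    · obtain ⟨⟨⟨η, β⟩, h⟩, rfl⟩ := Submodule.Quotient.mk_surjective _ τ
      obtain ⟨β', hβ⟩ := W.exists_extension hι β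
      obtain ⟨h', hk'⟩ := key η β h β' hβ
      exact ⟨_, hk'⟩
  refine ⟨(LinearEquiv.ofBijective k hbij).symm, fun η β h β' hβ => ?_⟩
  obtain ⟨h', hk'⟩ := key η β h β' hβ
  exact ⟨h', (LinearEquiv.symm_apply_eq _).2 hk'.symm⟩

variable {W hι}

theorem isFormalLinearization_of_classes {Q : W.PairModuli → LagModuli hι} (hQ : W.IsInducedByQ hι Q)
    {T : W.PairTangent →ₗ[ℝ] LagTangent hι ω₀}
    (hT : ∀ (v : Om I M 2) (β : Om J L 1) (hv : (v, β) ∈ Submodule.span ℝ W.pairVelocities)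
      (c : Om I M 1) (hw : v + d I M 1 c ∈ Submodule.span ℝ (lagVelocities hι ω₀)), pull hι 1 c = -β →
      T (cls _ (v, β) hv) = cls _ (v + d I M 1 c) hw) :
    W.IsFormalLinearization hι Q T := by
  intro ε η α hp
  obtain ⟨φ, φ', hφ, -, -, -, -, -, hq, hl, h⟩ := hp.exists_lagPath hι
  have hv := isVelocity_velocity hp.smooth_form
  have hβ := isVelocity_velocity hp.smooth_section
  obtain ⟨c, hc, hvc⟩ := h _ _ hv hβ
  have hζ : ∀ t ∈ Icc 0 ε, (pull (contMDiff_at_time hφ t) 2 (η t)).1 = W.q (η t, W.graph (α t)) :=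
    fun t ht => (congrArg (fun g => rawPull (I := I) g (η t).1) (hq t ht)).symm
  refine ⟨_, hl, fun t ht => ⟨hζ t ht, ?_⟩, (_, _), _, Submodule.subset_span ⟨ε, η, α, hp, hv, hβ⟩,
    Submodule.subset_span ⟨ε, _, hl, hvc⟩, hv, hβ, hvc, hT _ _ _ c _ hc⟩
  obtain ⟨η', hη', hQη⟩ := hQ ⟨(η t, W.graph (α t)), hp.mem_pairs t ht⟩
  rw [hQη]
  exact congrArg _ (Subtype.ext (Subtype.ext (hη'.trans (hζ t ht).symm)))

theorem IsFormalLinearization.unique {Q : W.PairModuli → LagModuli hι}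
    {T T' : W.PairTangent →ₗ[ℝ] LagTangent hι ω₀} (hT : W.IsFormalLinearization hι Q T)
    (hT' : W.IsFormalLinearization hι Q T')
    (h : ∀ v ∈ Submodule.span ℝ W.pairVelocities, v ∈ W.pairVelocities) : T = T' := by
  refine LinearMap.ext fun τ => ?_
  obtain ⟨⟨v, hv⟩, rfl⟩ := Submodule.Quotient.mk_surjective _ τ
  obtain ⟨ε, η, α, hp, hη, hα⟩ := h v hv
  obtain ⟨ζ, hζ, h1, v₁, w₁, hv₁, hw₁, h2, h3, h4, h5⟩ := hT ε η α hp
  obtain ⟨ζ', hζ', h1', v₂, w₂, hv₂, hw₂, h2', h3', h4', h5'⟩ := hT' ε η α hp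
  obtain rfl : v₁ = v := Prod.ext (h2.unique hη) (h3.unique hα)
  obtain rfl : v₂ = v₁ := Prod.ext (h2'.unique hη) (h3'.unique hα)
  obtain rfl : w₁ = w₂ := h4.unique_of_eqOn hp.pos h4' fun t ht =>
    Subtype.ext ((h1 t ht).1.trans (h1' t ht).1.symm)
  exact h5.trans h5'.symm

/-- The formal linearization is the isomorphism in cohomology, once the spaces of first order
deformations are known. -/
theorem exists_formalLinearization (h1 : W.pairVelocities = (coneZ hι : Set _))
    (h2 : W.trivialPairVelocities = (coneB hι : Set _))
    (h3 : lagVelocities hι ω₀ = (relZ hι : Set _))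
    (h4 : trivialLagVelocities hι ω₀ = (relB hι : Set _)) :
    ∃ (Q : W.PairModuli → LagModuli hι)
      (Φ : W.PairTangent ≃ₗ[ℝ] H2Cone hι)
      (Ψ : LagTangent hι ω₀ ≃ₗ[ℝ] H2Rel hι)
      (Θ : H2Cone hι ≃ₗ[ℝ] H2Rel hι)
      (dq : W.PairTangent →ₗ[ℝ] LagTangent hι ω₀),
      W.IsInducedByQ hι Q ∧
      (∀ v (hv : v ∈ Submodule.span ℝ W.pairVelocities),
        ∃ hv' : v ∈ coneZ hι, Φ (cls _ v hv) = cls _ v hv') ∧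
      (∀ w (hw : w ∈ Submodule.span ℝ (lagVelocities hι ω₀)),
        ∃ hw' : w ∈ relZ hι, Ψ (cls _ w hw) = cls _ w hw') ∧
      (∀ β : Om J L 1, ∃ β' : Om I M 1, pull hι 1 β' = β) ∧
      (∀ (η : Om I M 2) (β : Om J L 1) (h : (η, β) ∈ coneZ hι)
        (β' : Om I M 1), pull hι 1 β' = β →
        ∃ h' : η - d I M 1 β' ∈ relZ hι,
          Θ (cls _ (η, β) h) = cls _ (η - d I M 1 β') h') ∧
      W.IsFormalLinearization hι Q dq ∧
      (∀ T, W.IsFormalLinearization hι Q T → T = dq) ∧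
      (∀ τ, Ψ (dq τ) = Θ (Φ τ)) ∧
      Function.Bijective dq := by
  have s1 : Submodule.span ℝ W.pairVelocities = coneZ hι := by rw [h1, Submodule.span_eq]
  have s2 : Submodule.span ℝ W.trivialPairVelocities = coneB hι := by
    rw [h2, Submodule.span_eq]
  have s3 : Submodule.span ℝ (lagVelocities hι ω₀) = relZ hι := by
    rw [h3, Submodule.span_eq]
  have s4 : Submodule.span ℝ (trivialLagVelocities hι ω₀) = relB hι := by
    rw [h4, Submodule.span_eq]
  obtain ⟨Q, hQ⟩ := W.exists_isInducedByQ hι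
  obtain ⟨Φ, hΦ⟩ := exists_subQuotEquiv s1 s2
  obtain ⟨Ψ, hΨ⟩ := exists_subQuotEquiv s3 s4
  obtain ⟨Θ, hΘ⟩ := WeinsteinData.exists_cohomologyEquiv hι W
  let e : W.PairTangent ≃ₗ[ℝ] LagTangent hι ω₀ := (Φ.trans Θ).trans Ψ.symm
  have he : ∀ τ, Ψ (e τ) = Θ (Φ τ) := fun τ => Ψ.apply_symm_apply _
  have hlin : W.IsFormalLinearization hι Q e.toLinearMap := by
    refine WeinsteinData.isFormalLinearization_of_classes hQ fun v β hv c hw hc => Ψ.injective ?_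
    refine (he _).trans ?_
    obtain ⟨hv', h5⟩ := hΦ _ hv
    obtain ⟨hw', h6⟩ := hΨ _ hw
    obtain ⟨h', h7⟩ := hΘ v β hv' (-c) (by rw [map_neg, hc, neg_neg])
    rw [h5, h6, h7, cls_eq_iff, map_neg, sub_neg_eq_add, sub_self]
    exact zero_mem _
  refine ⟨Q, Φ, Ψ, Θ, e.toLinearMap, hQ, hΦ, hΨ, W.exists_extension hι, hΘ,
    hlin, fun T hT => hT.unique hlin fun v hv => ?_, he, e.bijective⟩
  rw [s1] at hv
  rw [h1]
  exact hv

end WeinsteinData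

end Linearization

end SymplecticDeformation

theorem mainTheorem6 {n : ℕ}
    {M : Type*} [TopologicalSpace M] [ChartedSpace (EuclideanSpace ℝ (Fin (2 * n))) M]
    [IsManifold (𝓡 (2 * n)) ∞ M] [T2Space M] [CompactSpace M]
    {L : Type*} [TopologicalSpace L] [ChartedSpace (EuclideanSpace ℝ (Fin n)) L]
    [IsManifold (𝓡 n) ∞ L] [T2Space L] [CompactSpace L]
    (ω₀ : Om (𝓡 (2 * n)) M 2) (hω₀ : IsSymplectic ω₀)
    (ι : L → M) (hι : Manifold.IsSmoothEmbedding (𝓡 n) (𝓡 (2 * n)) ∞ ι)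
    (hL : pull hι.contMDiff 2 ω₀ = 0)
    (W : WeinsteinData (J := 𝓡 n) ι ω₀) :
    -- first order deformations are the cocycles, trivial ones are the coboundaries
    W.pairVelocities = (coneZ hι.contMDiff : Set _) ∧
    W.trivialPairVelocities = (coneB hι.contMDiff : Set _) ∧
    lagVelocities hι.contMDiff ω₀ = (relZ hι.contMDiff : Set _) ∧
    trivialLagVelocities hι.contMDiff ω₀ = (relB hι.contMDiff : Set _) ∧
    ∃ (Q : W.PairModuli → LagModuli hι.contMDiff)
      (Φ : W.PairTangent ≃ₗ[ℝ] H2Cone hι.contMDiff)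
      (Ψ : LagTangent hι.contMDiff ω₀ ≃ₗ[ℝ] H2Rel hι.contMDiff)
      (J : H2Cone hι.contMDiff ≃ₗ[ℝ] H2Rel hι.contMDiff)
      (dq : W.PairTangent →ₗ[ℝ] LagTangent hι.contMDiff ω₀),
      -- `Q` is the map of moduli spaces induced by `q`
      W.IsInducedByQ hι.contMDiff Q ∧
      -- the identifications of the formal tangent spaces with the cohomology groups
      (∀ v (hv : v ∈ Submodule.span ℝ W.pairVelocities),
        ∃ hv' : v ∈ coneZ hι.contMDiff, Φ (cls _ v hv) = cls _ v hv') ∧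
      (∀ w (hw : w ∈ Submodule.span ℝ (lagVelocities hι.contMDiff ω₀)),
        ∃ hw' : w ∈ relZ hι.contMDiff, Ψ (cls _ w hw) = cls _ w hw') ∧
      -- the isomorphism `J : [(η, β)] ↦ [η - dβ']`, for any extension `β'` of `β`
      (∀ β : Om (𝓡 n) L 1, ∃ β' : Om (𝓡 (2 * n)) M 1, pull hι.contMDiff 1 β' = β) ∧
      (∀ (η : Om (𝓡 (2 * n)) M 2) (β : Om (𝓡 n) L 1) (h : (η, β) ∈ coneZ hι.contMDiff)
        (β' : Om (𝓡 (2 * n)) M 1), pull hι.contMDiff 1 β' = β →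
        ∃ h' : η - d (𝓡 (2 * n)) M 1 β' ∈ relZ hι.contMDiff,
          J (cls _ (η, β) h) = cls _ (η - d (𝓡 (2 * n)) M 1 β') h') ∧
      -- `dq` is the formal linearization of `Q`, and the diagram commutes
      W.IsFormalLinearization hι.contMDiff Q dq ∧
      (∀ T, W.IsFormalLinearization hι.contMDiff Q T → T = dq) ∧
      (∀ τ, Ψ (dq τ) = J (Φ τ)) ∧
      Function.Bijective dq := by
  have hdim : Module.finrank ℝ (EuclideanSpace ℝ (Fin (2 * n))) =
      2 * Module.finrank ℝ (EuclideanSpace ℝ (Fin n)) := by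
    rw [finrank_euclideanSpace_fin, finrank_euclideanSpace_fin]
  have h1 : W.pairVelocities = (coneZ hι.contMDiff : Set _) :=
    (W.pairVelocities_subset _).antisymm (WeinsteinData.coneZ_subset_pairVelocities W _ hω₀ hL)
  have h2 : W.trivialPairVelocities = (coneB hι.contMDiff : Set _) :=
    (trivialPairVelocities_subset W _ hL).antisymm (coneB_subset_trivialPairVelocities hdim W _ hω₀ hL)
  have h3 : lagVelocities hι.contMDiff ω₀ = (relZ hι.contMDiff : Set _) :=
    (lagVelocities_subset _).antisymm (relZ_subset_lagVelocities _ hω₀ hL)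
  have h4 : trivialLagVelocities hι.contMDiff ω₀ = (relB hι.contMDiff : Set _) :=
    (trivialLagVelocities_subset W _ hL).antisymm (relB_subset_trivialLagVelocities hdim W _ hω₀ hL)
  exact ⟨h1, h2, h3, h4, WeinsteinData.exists_formalLinearization h1 h2 h3 h4⟩
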